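/- Let $M$ be a smooth manifold of dimension $n\ge 1$ and $\mathrm g$ a pseudo-Riemannian metric on $M$, of any signature, with Levi-Civita connection $\nabla$, Ricci tensor $R_{ij}$ (positive on round spheres) and scalar curvature $R$. Let $\lambda,\mu\in\mathbb R$ (or $\mathbb C$) and put $\delta=\mu-\lambda$. Let $\mathcal F_\lambda$ be the space of smooth tensor densities of degree $\lambda$ (smooth sections of $|\Lambda^nT^*M|^{\otimes\lambda}$), let $\mathcal S^2_\delta$ be the space of symbols $P=P_2^{ij}\xi_i\xi_j+P_1^i\xi_i+P_0$ of degree at most two (symmetric contravariant tensor fields with values in $\mathcal F_\delta$), and let $\mathcal D^2_{\lambda,\mu}$ be the space of differential operators $\mathcal F_\lambda\to\mathcal F_\mu$ of order at most two. The connection acts on densities of degree $\lambda$ by $\nabla_i\phi=\partial_i\phi-\lambda\Gamma^j_{ij}\phi$, and correspondingly on density-valued tensors. Assume that $\delta\notin\{\frac2n,\frac{n+2}{2n},1,\frac{n+1}n,\frac{n+2}n\}$ if $n\ge2$, and $\delta\notin\{1,\frac32,2\}$ if $n=1$. Write $$\alpha=\tfrac{\lambda}{1-\delta},\quad \beta_1=\tfrac{2(n\lambda+1)}{2+n(1-\delta)},\quad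 \beta_2=\tfrac{n(\lambda+\mu-1)}{(2+n(1-\delta))(2-n\delta)},\quad \beta_3=\tfrac{n\lambda(n\lambda+1)}{(1+n(1-\delta))(2+n(1-\delta))},$$ $$\beta_4=\tfrac{n\lambda\,(n^2\mu(2-\lambda-\mu)+2(n\lambda+1)^2-n(n+1))}{(1+n(1-\delta))(2+n(1-\delta))(2+n(1-2\delta))(2-n\delta)},\quad \beta_5=\tfrac{n^2\lambda(\mu-1)}{(n-2)(1+n(1-\delta))},\quad \beta_6=\tfrac{n^2\lambda(\mu-1)(n\delta-2)}{(n-1)(n-2)(1+n(1-\delta))(2+n(1-2\delta))}.$$ If $n\le2$, the following is also given and kept fixed. Let $\varepsilon_1,\dots,\varepsilon_n\in\{1,-1\}$, let $p$ and $q$ be the numbers of the signs $1$ and $-1$, and put $\langle x,x\rangle=\sum_i\varepsilon_i(x^i)^2$. Given is a flat conformal structure on $M$, that is, a family of smooth charts $\varphi:U_\varphi\to\mathbb R^n$ covering $M$ whose changes of coordinates are locally given by the action of $\mathrm O(p+1,q+1)$ on $\mathbb R^n$, together with a metric $\mathrm g_0=\sum_i\varepsilon_i(dx^i)^2/(1+\frac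 K4\langle x,x\rangle)^2$ of constant curvature $K$ that is regular on the images of the charts. If $K\ne0$, the metrics $\varphi^*\mathrm g_0$ coincide on overlaps. On each $U_\varphi$ one has $F\mathrm g=\varphi^*\mathrm g_0$ with $F>0$. Consider the linear map $\mathcal Q_{\lambda,\mu}:\mathcal S^2_\delta\to\mathcal D^2_{\lambda,\mu}$ given as follows, in all local coordinate systems unless stated otherwise. * On symbols of degree at most one, $\mathcal Q_{\lambda,\mu}(P)=P_1^i\nabla_i+\alpha\nabla_i(P_1^i)+P_0$. * On $P=P^{ij}\xi_i\xi_j$, if $n\ge3$, $$\mathcal Q_{\lambda,\mu}(P)=P^{ij}\nabla_i\nabla_j+(\beta_1\nabla_iP^{ij}+\beta_2\mathrm g^{ij}\mathrm g_{k\ell}\nabla_iP^{k\ell})\nabla_j+\beta_3\nabla_i\nabla_j(P^{ij})+\beta_4\mathrm g^{ij}\mathrm g_{k\ell}\nabla_i\nabla_j(P^{k\ell})+\beta_5R_{ij}P^{ij}+\beta_6R\,\mathrm g_{ij}P^{ij}.$$ * If $n=2$, the last two terms are replaced by $$\frac{4\lambda(\mu-1)}{2\delta-3}\Big(S(\varphi)_{ij}P^{ij}+\frac1{8(\delta-1)}R\,\mathrm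 g_{ij}P^{ij}\Big),\qquad S(\varphi)=-\Big(\frac{\nabla dF}{2F}-\frac{3\,dF\otimes dF}{4F^2}+\frac{\mathrm g^{-1}(dF,dF)}{8F^2}\,\mathrm g\Big),$$ for every $\varphi$ of the given family defined around the point. * If $n=1$ and $P=P\xi^2$, in each coordinate $x$ of the given family, with $\mathrm g=\pm\varphi^*(dx^2)$ locally for a local diffeomorphism $\varphi$ of the line, $$\mathcal Q_{\lambda,\mu}(P)=P\nabla^2+\frac{2\lambda+1}{2-\delta}(\nabla P)\nabla+\frac{\lambda(2\lambda+1)}{(3-2\delta)(2-\delta)}(\nabla^2P)-\frac{2\lambda(\mu-1)}{3-2\delta}\,S(\varphi)P,\qquad S(\varphi)=\frac{\varphi'''}{\varphi'}-\frac32\Big(\frac{\varphi''}{\varphi'}\Big)^2.$$ Then these formulas define one and only one linear map $\mathcal Q_{\lambda,\mu}:\mathcal S^2_\delta\to\mathcal D^2_{\lambda,\mu}$ on $M$ (in particular, the result does not depend on the coordinates or on the choice of $\varphi$ in the given family). This map depends only on the conformal class of the metric: for every smooth function $G>0$ on $M$, the metrics $\mathrm g$ and $G\mathrm g$ define the same map.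 -/

import Mathlib

open scoped ContDiff Manifold Topology Matrix

noncomputable section

namespace ConfQuant

/-- The model space `ℝⁿ`. -/
abbrev E (n : ℕ) : Type := EuclideanSpace ℝ (Fin n)

/-- The coordinate vector `∂/∂xⁱ` of the model space. -/
def e {n : ℕ} (i : Fin n) : E n := EuclideanSpace.single i 1

/-- The partial derivative `∂ᵢ f`. -/
def pd {n : ℕ} {V : Type*} [NormedAddCommGroup V] [NormedSpace ℝ V]
    (i : Fin n) (f : E n → V) (x : E n) : V := fderiv ℝ f x (e i)

section Charts

/-- All smooth charts (local coordinate systems) of an `n`-dimensional manifold. -/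
abbrev Chart (n : ℕ) (M : Type*) [TopologicalSpace M] [ChartedSpace (E n) M] :=
  {c : OpenPartialHomeomorph M (E n) // c ∈ IsManifold.maximalAtlas (𝓡 n) ∞ M}

variable {n : ℕ} {M : Type*} [TopologicalSpace M] [ChartedSpace (E n) M]

/-- The change of coordinates from the chart `c` to the chart `d`. -/
def trans (c d : Chart n M) : E n → E n := fun y => d.1 (c.1.symm y)

/-- The set, in the coordinates `c`, of the points that lie in the domains of both `c` and `d`. -/
def overlap (c d : Chart n M) : Set (E n) := {y | y ∈ c.1.target ∧ c.1.symm y ∈ d.1.source}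

/-- The Jacobian matrix `∂(dᵏ)/∂(cⁱ)` of the change of coordinates from `c` to `d`. -/
def jac (c d : Chart n M) (y : E n) : Matrix (Fin n) (Fin n) ℝ :=
  Matrix.of fun k i => pd i (trans c d) y k

end Charts

/-! ### Pseudo-Riemannian metrics -/

/-- A smooth pseudo-Riemannian metric (of any signature): a smooth, symmetric, non-degenerate
twice covariant tensor field, given by its components `g_{ij}` in every chart. -/
structure Metric (n : ℕ) (M : Type*) [TopologicalSpace M] [ChartedSpace (E n) M] where
  coeff : Chart n M → E n → Matrix (Fin n) (Fin n) ℝ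
  smooth : ∀ c i j, ContDiffOn ℝ ∞ (fun y => coeff c y i j) c.1.target
  symm : ∀ c, ∀ y ∈ c.1.target, (coeff c y).IsSymm
  nondeg : ∀ c, ∀ y ∈ c.1.target, (coeff c y).det ≠ 0
  compat : ∀ c d, ∀ y ∈ overlap c d, ∀ i j, coeff c y i j =
    ∑ k, ∑ l, jac c d y k i * jac c d y l j * coeff d (trans c d y) k l

/-- `ĝ = F g` for a smooth, strictly positive function `F` on `M`. -/
def Conformal {n : ℕ} {M : Type*} [TopologicalSpace M] [ChartedSpace (E n) M]
    (g g' : Metric n M) : Prop :=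
  ∃ F : M → ℝ, ContMDiff (𝓡 n) 𝓘(ℝ, ℝ) ∞ F ∧ (∀ x, 0 < F x) ∧
    ∀ c, ∀ y ∈ c.1.target, g'.coeff c y = F (c.1.symm y) • g.coeff c y

/-! ### Densities and symbols -/

/-- `|d|^w` for a real number `d ≠ 0` and a real or complex exponent `w`
(`Real.log d` is `log |d|`). -/
def absPow {𝕜 : Type*} [RCLike 𝕜] (d : ℝ) (w : 𝕜) : 𝕜 :=
  NormedSpace.exp (((Real.log d : ℝ) : 𝕜) * w)

section Tensors

variable {𝕜 : Type*} [RCLike 𝕜] (n : ℕ) (M : Type*) [TopologicalSpace M] [ChartedSpace (E n) M]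

/-- Tensor densities of degree `w`, that is, smooth sections of `|Λⁿ T*M|^w`: the component in a
chart (set to `0` outside the range of the chart) is smooth and gets multiplied by `|det J|^w`. -/
def Density (w : 𝕜) : Submodule 𝕜 (Chart n M → E n → 𝕜) where
  carrier := {φ | (∀ c, ∀ y ∉ c.1.target, φ c y = 0) ∧
    (∀ c, ContDiffOn ℝ ∞ (φ c) c.1.target) ∧
    ∀ c d, ∀ y ∈ overlap c d, φ c y = absPow (jac c d y).det w * φ d (trans c d y)}
  zero_mem' := ⟨fun _ _ _ => rfl, fun _ => contDiffOn_const, fun _ _ _ _ => by simp⟩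
  add_mem' := by
    rintro a b ⟨ha0, ha1, ha2⟩ ⟨hb0, hb1, hb2⟩
    refine ⟨fun c y hy => ?_, fun c => (ha1 c).add (hb1 c), fun c d y hy => ?_⟩
    · simp [ha0 c y hy, hb0 c y hy]
    · simp only [Pi.add_apply, ha2 c d y hy, hb2 c d y hy]; ring
  smul_mem' := by
    rintro r a ⟨ha0, ha1, ha2⟩
    refine ⟨fun c y hy => ?_, fun c => contDiffOn_const.mul (ha1 c), fun c d y hy => ?_⟩
    · simp [ha0 c y hy]
    · simp only [Pi.smul_apply, smul_eq_mul, ha2 c d y hy]; ring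

/-- Homogeneous symbols of degree one, `P(ξ) = Pⁱ ξᵢ`: vector fields with values in the densities
of degree `w`. -/
def Symbol1 (w : 𝕜) : Submodule 𝕜 (Chart n M → E n → Fin n → 𝕜) where
  carrier := {P | (∀ c, ∀ y ∉ c.1.target, ∀ i, P c y i = 0) ∧
    (∀ c i, ContDiffOn ℝ ∞ (fun y => P c y i) c.1.target) ∧
    ∀ c d, ∀ y ∈ overlap c d, ∀ k, ∑ i, (jac c d y k i : 𝕜) * P c y i =
      absPow (jac c d y).det w * P d (trans c d y) k}
  zero_mem' := ⟨fun _ _ _ _ => rfl, fun _ _ => contDiffOn_const, fun _ _ _ _ _ => by simp⟩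
  add_mem' := by
    rintro a b ⟨ha0, ha1, ha2⟩ ⟨hb0, hb1, hb2⟩
    refine ⟨fun c y hy i => ?_, fun c i => (ha1 c i).add (hb1 c i), fun c d y hy k => ?_⟩
    · simp [ha0 c y hy, hb0 c y hy]
    · simp only [Pi.add_apply, mul_add, Finset.sum_add_distrib, ha2 c d y hy, hb2 c d y hy]
  smul_mem' := by
    rintro r a ⟨ha0, ha1, ha2⟩
    refine ⟨fun c y hy i => ?_, fun c i => contDiffOn_const.mul (ha1 c i), fun c d y hy k => ?_⟩
    · simp [ha0 c y hy]
    · simp only [Pi.smul_apply, smul_eq_mul, mul_left_comm _ r, ← Finset.mul_sum, ha2 c d y hy]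

/-- Homogeneous symbols of degree two, `P(ξ) = Pⁱʲ ξᵢ ξⱼ`: symmetric twice contravariant tensor
fields with values in the densities of degree `w`. -/
def Symbol2 (w : 𝕜) : Submodule 𝕜 (Chart n M → E n → Fin n → Fin n → 𝕜) where
  carrier := {P | (∀ c, ∀ y ∉ c.1.target, ∀ i j, P c y i j = 0) ∧
    (∀ c i j, ContDiffOn ℝ ∞ (fun y => P c y i j) c.1.target) ∧
    (∀ c y i j, P c y i j = P c y j i) ∧
    ∀ c d, ∀ y ∈ overlap c d, ∀ k l,
      ∑ i, ∑ j, (jac c d y k i : 𝕜) * (jac c d y l j : 𝕜) * P c y i j =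
        absPow (jac c d y).det w * P d (trans c d y) k l}
  zero_mem' := ⟨fun _ _ _ _ _ => rfl, fun _ _ _ => contDiffOn_const, fun _ _ _ _ => rfl,
    fun _ _ _ _ _ _ => by simp⟩
  add_mem' := by
    rintro a b ⟨ha0, ha1, has, ha2⟩ ⟨hb0, hb1, hbs, hb2⟩
    refine ⟨fun c y hy i j => ?_, fun c i j => (ha1 c i j).add (hb1 c i j),
      fun c y i j => ?_, fun c d y hy k l => ?_⟩
    · simp [ha0 c y hy, hb0 c y hy]
    · simp only [Pi.add_apply, has c y i j, hbs c y i j]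
    · simp only [Pi.add_apply, mul_add, Finset.sum_add_distrib, ha2 c d y hy, hb2 c d y hy]
  smul_mem' := by
    rintro r a ⟨ha0, ha1, has, ha2⟩
    refine ⟨fun c y hy i j => ?_, fun c i j => contDiffOn_const.mul (ha1 c i j),
      fun c y i j => ?_, fun c d y hy k l => ?_⟩
    · simp [ha0 c y hy]
    · simp only [Pi.smul_apply, has c y i j]
    · simp only [Pi.smul_apply, smul_eq_mul, mul_left_comm _ r, ← Finset.mul_sum,
        ha2 c d y hy]

/-- The space `S²_w` of symbols `P₂ⁱʲ ξᵢ ξⱼ + P₁ⁱ ξᵢ + P₀` of degree at most two with values in the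
densities of degree `w`; an element is the triple `(P₂, P₁, P₀)`. -/
abbrev Symbol (w : 𝕜) : Type _ := Symbol2 n M w × Symbol1 n M w × Density n M w

/-! ### Differential operators -/

variable {n M}

/-- Multiplication of densities by a smooth function. -/
def mulFun {w : 𝕜} (f : C^∞⟮𝓡 n, M; 𝓘(ℝ, 𝕜), 𝕜⟯) : Density n M w →ₗ[𝕜] Density n M w where
  toFun φ := ⟨fun c y => f (c.1.symm y) * φ.1 c y, by
    obtain ⟨φ, h0, h1, h2⟩ := φ
    refine ⟨fun c y hy => by simp [h0 c y hy], fun c => ?_, fun c d y hy => ?_⟩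
    · have h := f.contMDiff.comp_contMDiffOn
        (contMDiffOn_symm_of_mem_maximalAtlas c.2)
      exact h.contDiffOn.mul (h1 c)
    · have h : d.1.symm (trans c d y) = c.1.symm y := d.1.left_inv hy.2
      simp only [h2 c d y hy, h]; ring⟩
  map_add' φ ψ := by ext c y; simp [mul_add]
  map_smul' r φ := by ext c y; simp [mul_left_comm]

/-- The commutator `[A, f] = A ∘ f - f ∘ A` of an operator with a smooth function. -/
def comm {l m : 𝕜} (A : Density n M l →ₗ[𝕜] Density n M m) (f : C^∞⟮𝓡 n, M; 𝓘(ℝ, 𝕜), 𝕜⟯) :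
    Density n M l →ₗ[𝕜] Density n M m where
  toFun φ := A (mulFun f φ) - mulFun f (A φ)
  map_add' φ ψ := by simp only [map_add]; abel
  map_smul' r φ := by simp only [map_smul, RingHom.id_apply, smul_sub]

/-- `A` is a differential operator of order at most `k` from the densities of degree `l` to those
of degree `m`: for `k = 0` it is the multiplication by a density of degree `m - l`, and `A` has order
at most `k + 1` if all commutators `[A, f]` with smooth functions have order at most `k`. -/
def IsDiffOp {l m : 𝕜} : ℕ → (Density n M l →ₗ[𝕜] Density n M m) → Prop
  | 0, A => ∃ ρ : Density n M (m - l), ∀ φ c y, (A φ).1 c y = ρ.1 c y * φ.1 c y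
  | k + 1, A => ∀ f : C^∞⟮𝓡 n, M; 𝓘(ℝ, 𝕜), 𝕜⟯, IsDiffOp k (comm A f)

variable (n M) in
/-- The space `D^k_{l,m}` of differential operators of order at most `k`. -/
def DiffOp (l m : 𝕜) (k : ℕ) : Submodule 𝕜 (Density n M l →ₗ[𝕜] Density n M m) where
  carrier := {A | IsDiffOp k A}
  zero_mem' := by
    show IsDiffOp k 0
    induction k with
    | zero => exact ⟨0, fun φ c y => by simp⟩
    | succ k ih =>
      intro f
      have h : comm (0 : Density n M l →ₗ[𝕜] Density n M m) f = 0 := by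
        ext1 φ; simp [comm]
      rw [h]; exact ih
  add_mem' := by
    show ∀ {a b}, IsDiffOp k a → IsDiffOp k b → IsDiffOp k (a + b)
    induction k with
    | zero =>
      rintro a b ⟨r, hr⟩ ⟨s, hs⟩
      exact ⟨r + s, fun φ c y => by
        have h1 := hr φ c y
        have h2 := hs φ c y
        simp [h1, h2, add_mul]⟩
    | succ k ih =>
      intro a b ha hb f
      have h : comm (a + b) f = comm a f + comm b f := by
        refine LinearMap.ext fun φ => ?_
        simp only [comm, LinearMap.coe_mk, AddHom.coe_mk, LinearMap.add_apply, map_add]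
        abel
      rw [h]; exact ih (ha f) (hb f)
  smul_mem' := by
    show ∀ (r : 𝕜) {a}, IsDiffOp k a → IsDiffOp k (r • a)
    induction k with
    | zero =>
      rintro t a ⟨r, hr⟩
      exact ⟨t • r, fun φ c y => by
        have h1 := hr φ c y
        simp [h1, mul_assoc]⟩
    | succ k ih =>
      intro r a ha f
      have h : comm (r • a) f = r • comm a f := by
        refine LinearMap.ext fun φ => ?_
        simp only [comm, LinearMap.coe_mk, AddHom.coe_mk, LinearMap.smul_apply, map_smul, smul_sub]
      rw [h]; exact ih r (ha f)

end Tensors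

/-! ### Covariant derivatives and curvature in coordinates

In this part `G` holds the components of a metric in a coordinate system; all objects are
functions of the coordinates. -/

section Local

variable {𝕜 : Type*} [RCLike 𝕜] {n : ℕ}

/-- The components of a metric as real or complex valued functions. -/
def toField (G : E n → Matrix (Fin n) (Fin n) ℝ) : E n → Matrix (Fin n) (Fin n) 𝕜 :=
  fun x => (G x).map (fun t => (t : 𝕜))

variable (G : E n → Matrix (Fin n) (Fin n) 𝕜)

/-- The Christoffel symbol `Γᵏᵢⱼ` of the Levi-Civita connection. -/
def chris (k i j : Fin n) (x : E n) : 𝕜 :=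
  (1 / 2) * ∑ l, (G x)⁻¹ k l * (pd i (fun z => G z l j) x + pd j (fun z => G z l i) x
    - pd l (fun z => G z i j) x)

/-- The contracted Christoffel symbol `Γᵢ = Γʲᵢⱼ`. -/
def chris1 (i : Fin n) (x : E n) : 𝕜 := ∑ j, chris G j i j x

/-- The Ricci tensor
`Rᵢⱼ = ∂ₖ Γᵏᵢⱼ - ∂ⱼ Γᵏᵢₖ + Γᵏₖₘ Γᵐᵢⱼ - Γᵏⱼₘ Γᵐᵢₖ` (positive on round spheres). -/
def ricci (i j : Fin n) (x : E n) : 𝕜 :=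
  ∑ k, (pd k (chris G k i j) x - pd j (chris G k i k) x
    + ∑ m, (chris G k k m x * chris G m i j x - chris G k j m x * chris G m i k x))

/-- The scalar curvature `R = gⁱʲ Rᵢⱼ`. -/
def scal (x : E n) : 𝕜 := ∑ i, ∑ j, (G x)⁻¹ i j * ricci G i j x

/-- `∇ⱼ φ` for a density `φ` of degree `w`. -/
def nablaD (w : 𝕜) (φ : E n → 𝕜) (j : Fin n) (x : E n) : 𝕜 :=
  pd j φ x - w * chris1 G j x * φ x

/-- `∇ᵢ ∇ⱼ φ` for a density `φ` of degree `w`. -/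
def nabla2D (w : 𝕜) (φ : E n → 𝕜) (i j : Fin n) (x : E n) : 𝕜 :=
  pd i (nablaD G w φ j) x - ∑ m, chris G m i j x * nablaD G w φ m x
    - w * chris1 G i x * nablaD G w φ j x

/-- `∇ⱼ Pᵏ` for a vector field `P` with values in the densities of degree `w`. -/
def nablaV (w : 𝕜) (P : E n → Fin n → 𝕜) (j k : Fin n) (x : E n) : 𝕜 :=
  pd j (fun z => P z k) x + ∑ m, chris G k j m x * P x m - w * chris1 G j x * P x k

/-- `∇ⱼ Pᵏˡ` for a twice contravariant tensor `P` with values in the densities of degree `w`. -/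
def nablaT (w : 𝕜) (P : E n → Fin n → Fin n → 𝕜) (j k l : Fin n) (x : E n) : 𝕜 :=
  pd j (fun z => P z k l) x + ∑ m, chris G k j m x * P x m l + ∑ m, chris G l j m x * P x k m
    - w * chris1 G j x * P x k l

/-- `∇ᵢ ∇ⱼ Pᵏˡ` for a twice contravariant tensor `P` with values in the densities of
degree `w`. -/
def nabla2T (w : 𝕜) (P : E n → Fin n → Fin n → 𝕜) (i j k l : Fin n) (x : E n) : 𝕜 :=
  pd i (nablaT G w P j k l) x - ∑ m, chris G m i j x * nablaT G w P m k l x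
    + ∑ m, chris G k i m x * nablaT G w P j m l x + ∑ m, chris G l i m x * nablaT G w P j k m x
    - w * chris1 G i x * nablaT G w P j k l x

/-- `∇ᵢ ∂ⱼ F` for a function `F`. -/
def hess (F : E n → 𝕜) (i j : Fin n) (x : E n) : 𝕜 :=
  pd i (pd j F) x - ∑ m, chris G m i j x * pd m F x

/-! ### The quantization formulas in coordinates -/

/-- First order symbols: `P₁ⁱ ∇ᵢ φ + α (∇ᵢ P₁ⁱ) φ + P₀ φ` with `α = l / (1 - δ)`,
`δ = m - l`. -/
def quant1 (l m : 𝕜) (P₁ : E n → Fin n → 𝕜) (P₀ φ : E n → 𝕜) (x : E n) : 𝕜 :=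
  ∑ i, P₁ x i * nablaD G l φ i x
    + l / (1 - (m - l)) * (∑ i, nablaV G (m - l) P₁ i i x) * φ x + P₀ x * φ x

/-- The coefficient `β₁`. -/
def beta1 (n : ℕ) (l m : 𝕜) : 𝕜 := 2 * (n * l + 1) / (2 + n * (1 - (m - l)))

/-- The coefficient `β₂`. -/
def beta2 (n : ℕ) (l m : 𝕜) : 𝕜 :=
  n * (l + m - 1) / ((2 + n * (1 - (m - l))) * (2 - n * (m - l)))

/-- The coefficient `β₃`. -/
def beta3 (n : ℕ) (l m : 𝕜) : 𝕜 :=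
  n * l * (n * l + 1) / ((1 + n * (1 - (m - l))) * (2 + n * (1 - (m - l))))

/-- The coefficient `β₄`. -/
def beta4 (n : ℕ) (l m : 𝕜) : 𝕜 :=
  n * l * (n ^ 2 * m * (2 - l - m) + 2 * (n * l + 1) ^ 2 - n * (n + 1)) /
    ((1 + n * (1 - (m - l))) * (2 + n * (1 - (m - l))) * (2 + n * (1 - 2 * (m - l)))
      * (2 - n * (m - l)))

/-- The coefficient `β₅`. -/
def beta5 (n : ℕ) (l m : 𝕜) : 𝕜 := n ^ 2 * l * (m - 1) / ((n - 2) * (1 + n * (1 - (m - l))))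

/-- The coefficient `β₆`. -/
def beta6 (n : ℕ) (l m : 𝕜) : 𝕜 :=
  n ^ 2 * l * (m - 1) * (n * (m - l) - 2) /
    ((n - 1) * (n - 2) * (1 + n * (1 - (m - l))) * (2 + n * (1 - 2 * (m - l))))

/-- The part of the formulas for second order symbols that is common to all dimensions `n ≥ 2`:
`Pⁱʲ ∇ᵢ ∇ⱼ φ + (β₁ ∇ᵢ Pⁱʲ + β₂ gⁱʲ gₖₗ ∇ᵢ Pᵏˡ) ∇ⱼ φ + (β₃ ∇ᵢ ∇ⱼ Pⁱʲ + β₄ gⁱʲ gₖₗ ∇ᵢ ∇ⱼ Pᵏˡ) φ`. -/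
def quant2 (l m : 𝕜) (P : E n → Fin n → Fin n → 𝕜) (φ : E n → 𝕜) (x : E n) : 𝕜 :=
  ∑ i, ∑ j, P x i j * nabla2D G l φ i j x
    + ∑ j, (beta1 n l m * ∑ i, nablaT G (m - l) P i i j x
        + beta2 n l m * ∑ i, ∑ k, ∑ q, (G x)⁻¹ i j * G x k q * nablaT G (m - l) P i k q x)
      * nablaD G l φ j x
    + (beta3 n l m * ∑ i, ∑ j, nabla2T G (m - l) P i j i j x
        + beta4 n l m * ∑ i, ∑ j, ∑ k, ∑ q,
            (G x)⁻¹ i j * G x k q * nabla2T G (m - l) P i j k q x) * φ x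

/-- The curvature term `β₅ Rᵢⱼ Pⁱʲ + β₆ R gᵢⱼ Pⁱʲ` in dimension `n ≥ 3`. -/
def curvTerm (l m : 𝕜) (P : E n → Fin n → Fin n → 𝕜) (x : E n) : 𝕜 :=
  beta5 n l m * ∑ i, ∑ j, ricci G i j x * P x i j
    + beta6 n l m * scal G x * ∑ i, ∑ j, G x i j * P x i j

/-- The conformal factor `F` with `F g = h`, for conformal metrics with components `G` and `H`;
it is computed as `gⁱʲ hᵢⱼ / n`. -/
def confFactor (H : E n → Matrix (Fin n) (Fin n) 𝕜) (x : E n) : 𝕜 :=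
  (∑ i, ∑ j, (G x)⁻¹ i j * H x i j) / n

/-- The Schwarzian tensor `S = -(∇dF / (2F) - 3 dF ⊗ dF / (4F²) + g⁻¹(dF, dF) g / (8F²))`,
where `F g = φ^* g₀`. -/
def schwarz (F : E n → 𝕜) (i j : Fin n) (x : E n) : 𝕜 :=
  -(hess G F i j x / (2 * F x) - 3 / (4 * F x ^ 2) * (pd i F x * pd j F x)
    + 1 / (8 * F x ^ 2) * (∑ k, ∑ q, (G x)⁻¹ k q * pd k F x * pd q F x) * G x i j)

/-- The term `4 l (m - 1) / (2 δ - 3) (Sᵢⱼ Pⁱʲ + R gᵢⱼ Pⁱʲ / (8 (δ - 1)))` in dimension two, where `H`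
holds the components of `φ^* g₀`. -/
def schwarzTerm (H : E n → Matrix (Fin n) (Fin n) 𝕜) (l m : 𝕜) (P : E n → Fin n → Fin n → 𝕜)
    (x : E n) : 𝕜 :=
  4 * l * (m - 1) / (2 * (m - l) - 3) *
    ((∑ i, ∑ j, schwarz G (confFactor G H) i j x * P x i j)
      + 1 / (8 * ((m - l) - 1)) * scal G x * ∑ i, ∑ j, G x i j * P x i j)

/-- The classical Schwarzian derivative `φ''' / φ' - (3/2) (φ'' / φ')²`, written as a function of
`u = φ'`, in dimension one (where the only value of `i` and `j` is the only index). -/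
def schwarz1 (u : E n → 𝕜) (i j : Fin n) (x : E n) : 𝕜 :=
  pd i (pd j u) x / u x - 3 / 2 * (pd i u x / u x * (pd j u x / u x))

/-- Second order symbols in dimension one, where all sums have one term:
`P ∇²φ + (2l+1)/(2-δ) (∇P) ∇φ + l(2l+1)/((3-2δ)(2-δ)) (∇²P) φ - 2l(m-1)/(3-2δ) S(φ) P φ`;
`u` is the derivative of the local diffeomorphism whose Schwarzian derivative appears. -/
def quantOne (u : E n → 𝕜) (l m : 𝕜) (P : E n → Fin n → Fin n → 𝕜) (φ : E n → 𝕜)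
    (x : E n) : 𝕜 :=
  ∑ i, ∑ j, P x i j * nabla2D G l φ i j x
    + (2 * l + 1) / (2 - (m - l)) * ∑ i, ∑ j, nablaT G (m - l) P i i j x * nablaD G l φ j x
    + l * (2 * l + 1) / ((3 - 2 * (m - l)) * (2 - (m - l)))
        * (∑ i, ∑ j, nabla2T G (m - l) P i j i j x) * φ x
    - 2 * l * (m - 1) / (3 - 2 * (m - l)) * (∑ i, ∑ j, schwarz1 u i j x * P x i j) * φ x

end Local

/-! ### Uniformization in dimensions one and two -/

section Uniformization

variable {n : ℕ}

/-- The flat scalar product `⟨x, y⟩ = ∑ εᵢ xᵢ yᵢ`, with signs `εᵢ = ± 1`. -/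
def flat (ε : Fin n → ℝ) (x y : E n) : ℝ := ∑ i, ε i * x i * y i

/-- The metric `∑ εᵢ (dxⁱ)² / (1 + K ⟨x, x⟩ / 4)²` of constant curvature `K`. -/
def model (ε : Fin n → ℝ) (K : ℝ) (x : E n) : Matrix (Fin n) (Fin n) ℝ :=
  Matrix.diagonal fun i => ε i / (1 + K / 4 * flat ε x x) ^ 2

/-- The quadratic form `⟨x, x⟩ - a b` of signature `(p + 1, q + 1)` on `ℝ × ℝⁿ × ℝ`. -/
def bigForm (ε : Fin n → ℝ) (v : ℝ × E n × ℝ) : ℝ := flat ε v.2.1 v.2.1 - v.1 * v.2.2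

/-- The embedding `x ↦ (1, x, ⟨x, x⟩)` of `ℝⁿ` into the null cone of this form. -/
def lift (ε : Fin n → ℝ) (x : E n) : ℝ × E n × ℝ := (1, x, flat ε x x)

/-- Near `y`, the map `T` is given by the action of an element of `O(p + 1, q + 1)` on the lines of
the null cone, that is, by the local action of the conformal group on `ℝⁿ`. -/
def LocallyMoebius (ε : Fin n → ℝ) (T : E n → E n) (y : E n) : Prop :=
  ∃ A : (ℝ × E n × ℝ) →ₗ[ℝ] (ℝ × E n × ℝ), (∀ v, bigForm ε (A v) = bigForm ε v) ∧
    ∀ᶠ z in 𝓝 y, ∃ r : ℝ, r ≠ 0 ∧ A (lift ε z) = r • lift ε (T z)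

variable (n) in
/-- The data of local identifications `φ` (charts) of `M` with the model space `ℝⁿ`, equipped with
the metric `g₀ = model sign curv`. -/
structure ModelAtlas (M : Type*) [TopologicalSpace M] [ChartedSpace (E n) M] where
  sign : Fin n → ℝ
  curv : ℝ
  charts : Set (Chart n M)

variable {M : Type*} [TopologicalSpace M] [ChartedSpace (E n) M]

/-- The identifications `φ` form a flat conformal structure on `M` (they cover `M` and are related by
the action of the conformal group); if the curvature of `g₀` is not zero, the local metrics `φ^* g₀`
coincide on overlaps, so that they form one metric on `M`; and `φ^* g₀` is a positive multiple
of `g`. -/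
structure ModelAtlas.Uniformizes (U : ModelAtlas n M) (g : Metric n M) : Prop where
  sign_eq : ∀ i, U.sign i = 1 ∨ U.sign i = -1
  cover : ∀ x : M, ∃ a ∈ U.charts, x ∈ a.1.source
  moebius : ∀ a ∈ U.charts, ∀ b ∈ U.charts, ∀ y ∈ overlap a b,
    LocallyMoebius U.sign (trans a b) y
  regular : ∀ a ∈ U.charts, ∀ y ∈ a.1.target, 1 + U.curv / 4 * flat U.sign y y ≠ 0
  isometry : U.curv ≠ 0 → ∀ a ∈ U.charts, ∀ b ∈ U.charts, ∀ y ∈ overlap a b, ∀ i j,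
    model U.sign U.curv y i j = ∑ k, ∑ l, jac a b y k i * jac a b y l j *
      model U.sign U.curv (trans a b y) k l
  conformal : ∀ a ∈ U.charts, ∀ y ∈ a.1.target, ∃ t : ℝ, 0 < t ∧
    t • g.coeff a y = model U.sign U.curv y

/-- The components in the chart `c` of the metric `φ^* g₀`, where `φ` is the chart `a`. -/
def ModelAtlas.pullback (U : ModelAtlas n M) (a c : Chart n M) (y : E n) :
    Matrix (Fin n) (Fin n) ℝ :=
  (jac c a y)ᵀ * model U.sign U.curv (trans c a y) * jac c a y

end Uniformization

/-! ### The quantization map -/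

section Main

variable {𝕜 : Type*} [RCLike 𝕜] {n : ℕ} {M : Type*} [TopologicalSpace M] [ChartedSpace (E n) M]

/-- `Q` is the quantization map of the pseudo-Riemannian metric `g`: the density `Q(P)(φ)` is given in
coordinates by the formulas above. In dimension `n ≥ 3` they hold in all coordinate systems `c`. In
dimension two the Schwarzian tensor is that of any of the identifications `a` around the point, again
in all coordinate systems `c`. In dimension one the coordinate `x` is any of the identifications, and
`± g = φ^*(dx²)` says that `φ' = √|g₁₁|` up to a sign, which does not affect the Schwarzian
derivative. -/
def IsQuantization (U : ModelAtlas n M) (g : Metric n M) {l m : 𝕜}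
    (Q : Symbol n M (m - l) →ₗ[𝕜] DiffOp n M l m 2) : Prop :=
  ∀ (P : Symbol n M (m - l)) (φ : Density n M l),
    (3 ≤ n → ∀ c, ∀ y ∈ c.1.target,
      ((Q P).1 φ).1 c y =
        quant2 (toField (g.coeff c)) l m (P.1.1 c) (φ.1 c) y
        + curvTerm (toField (g.coeff c)) l m (P.1.1 c) y * φ.1 c y
        + quant1 (toField (g.coeff c)) l m (P.2.1.1 c) (P.2.2.1 c) (φ.1 c) y) ∧
    (n = 2 → ∀ c, ∀ a ∈ U.charts, ∀ y ∈ overlap c a,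
      ((Q P).1 φ).1 c y =
        quant2 (toField (g.coeff c)) l m (P.1.1 c) (φ.1 c) y
        + schwarzTerm (toField (g.coeff c)) (toField (U.pullback a c)) l m (P.1.1 c) y * φ.1 c y
        + quant1 (toField (g.coeff c)) l m (P.2.1.1 c) (P.2.2.1 c) (φ.1 c) y) ∧
    (n = 1 → ∀ a ∈ U.charts, ∀ y ∈ a.1.target,
      ((Q P).1 φ).1 a y =
        quantOne (toField (g.coeff a)) (fun z => ((√|(g.coeff a z).det| : ℝ) : 𝕜)) l m
          (P.1.1 a) (φ.1 a) y
        + quant1 (toField (g.coeff a)) l m (P.2.1.1 a) (P.2.2.1 a) (φ.1 a) y)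

/-- `δ` is not a resonance: the denominators of the formulas in dimension `n` do not vanish. -/
def NonResonant (n : ℕ) (δ : 𝕜) : Prop :=
  δ ≠ 2 / n ∧ δ ≠ (n + 2) / (2 * n) ∧ δ ≠ 1 ∧ δ ≠ (n + 1) / n ∧ (2 ≤ n → δ ≠ (n + 2) / n)

end Main

end ConfQuant

end

/-! The theorem rests on two invariances of one explicit formula: under changes of coordinates and
under conformal changes of the metric. Both are algebraic identities between finitely many
derivatives. They are therefore proved over a commutative ring `R` with derivations `D i`, where an
invertible function comes with its inverse as a second element; the ring of smooth functions on an
open subset of `ℝⁿ` (`smoothAlg`) is inserted afterwards.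

Conformal invariance. Since `∇` commutes with the metric trace, the terms with `β₂` and `β₄` are the
gradient and the Laplacian of the density `gtr a P`, and those with `β₁` and `β₃` are divergences;
this is `quantR`. For `ĝ = F g` put `Υ = dF / (2F)`. The Christoffel symbols change by `confA`, and
`ConfChange.quantR_eq` writes the change of the formula as a combination of eight scalars. Four of
them contain a derivative of `φ` or of `P`; the vanishing of their coefficients is a triangular
linear system whose solution is `β₁, …, β₄`. The rest is `K (Pⁱʲ(∇ᵢΥⱼ - ΥᵢΥⱼ) + trace terms) φ` with
`K = n²λ(μ-1)/(1+n(1-δ))` (`quantR_conf_aux`). For `n ≥ 3` the changes of the Ricci tensor and of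
the scalar curvature cancel it (`conf_three`). For `n = 2` the change of the Ricci tensor is a
multiple of the metric, and the Schwarzian tensor, being a cocycle, takes its place (`conf_two`);
for `n = 1` the classical Schwarzian derivative does (`conf_one`).

Coordinates. The factor `|det J|^w` of a density has logarithmic derivative `w` times that of `det
J`, which compensates the inhomogeneous term in the transformation of the contracted Christoffel
symbol (`MetricRel.totR_eq`). The curvature is treated as the curvature of a matrix-valued
connection form.

Choice of `φ` for `n ≤ 2`. A change of identifications is a Möbius map. It rescales the flat metric
by `r⁻²` for a quadratic function `r` with `2 r ∂ᵢ∂ⱼr = |dr|² ηᵢⱼ`, where `η` is the flat metric,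
and this equation says that its Schwarzian vanishes (`quadFun_eq`, `schwR_flat`). For `K ≠ 0` in
dimension two the conformal factors agree because the model metrics do.

Globalization. The zeroth order correction is written `Xᵢⱼ Pⁱʲ` for a covariant tensor `X`, which
extends from a covering family of charts to all charts (`IsTensorOn.extend`). The local formulas
then define densities, and the double commutator with functions `f, f'` is the multiplication by `2
Pⁱʲ ∂ᵢf ∂ⱼf'`, so the order is at most two. Uniqueness holds because a density is determined by its
components in a covering family of charts. -/

noncomputable section

namespace ConfQuant

set_option linter.unusedSectionVars false

/-! ### Metrics and Levi-Civita connections over a ring with derivations -/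

section Calculus

variable {𝕜 : Type*} [Field 𝕜] [CharZero 𝕜] {R : Type*} [CommRing R] [Algebra 𝕜 R] {n : ℕ}

/-- The components of a metric and of its inverse, with values in a commutative ring. -/
structure MetricPair (n : ℕ) (R : Type*) [CommRing R] where
  g : Fin n → Fin n → R
  h : Fin n → Fin n → R
  g_symm : ∀ i j, g i j = g j i
  h_symm : ∀ i j, h i j = h j i
  g_mul_h : ∀ i j, ∑ k, g i k * h k j = if i = j then 1 else 0

namespace MetricPair

variable (a : MetricPair n R)

/-- Raising an index. -/
def raise (X : Fin n → R) (k : Fin n) : R := ∑ l, a.h k l * X l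

lemma h_mul_g (i j : Fin n) : ∑ k, a.h i k * a.g k j = if i = j then 1 else 0 := by
  have := a.g_mul_h j i
  simp only [eq_comm (a := j)] at this
  rw [← this]
  exact Finset.sum_congr rfl fun k _ => by rw [a.h_symm i k, a.g_symm k j, mul_comm]

lemma sum_delta (X : Fin n → R) (i : Fin n) : ∑ j, (if i = j then 1 else 0) * X j = X i := by
  simp

lemma lower_raise (X : Fin n → R) (i : Fin n) : ∑ j, a.g i j * a.raise X j = X i := by
  simp only [raise, Finset.mul_sum, ← mul_assoc]
  rw [Finset.sum_comm]
  simp only [← Finset.sum_mul, g_mul_h]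
  exact sum_delta X i

lemma raise_lower (X : Fin n → R) (i : Fin n) : a.raise (fun j => ∑ l, a.g j l * X l) i = X i := by
  simp only [raise, Finset.mul_sum, ← mul_assoc]
  rw [Finset.sum_comm]
  simp only [← Finset.sum_mul, h_mul_g]
  exact sum_delta X i

lemma raise_pair (X Y : Fin n → R) : ∑ i, a.raise X i * Y i = ∑ i, X i * a.raise Y i := by
  simp only [raise, Finset.mul_sum, Finset.sum_mul]
  rw [Finset.sum_comm]
  refine Finset.sum_congr rfl fun i _ => Finset.sum_congr rfl fun j _ => ?_
  rw [a.h_symm j i]; ring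

lemma trace_g_h : ∑ i, ∑ j, a.h i j * a.g i j = (n : R) := by
  have : ∀ i, ∑ j, a.h i j * a.g i j = 1 := fun i => by
    rw [← (a.h_mul_g i i).trans (if_pos rfl)]
    exact Finset.sum_congr rfl fun j _ => by rw [a.g_symm i j]
  simp [this]

end MetricPair

variable (D : Fin n → Derivation 𝕜 R R)

/-- The Christoffel symbols `Γᵏᵢⱼ` of a metric. -/
def levi (a : MetricPair n R) (k i j : Fin n) : R :=
  algebraMap 𝕜 R (1 / 2) *
    ∑ l, a.h k l * (D i (a.g l j) + D j (a.g l i) - D l (a.g i j))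

/-- A connection is compatible with a metric. -/
def Compat (a : MetricPair n R) (Γ : Fin n → Fin n → Fin n → R) : Prop :=
  ∀ i k l, D i (a.g k l) = ∑ m, Γ m i k * a.g m l + ∑ m, Γ m i l * a.g k m

variable {D}

lemma levi_symm (a : MetricPair n R) (k i j : Fin n) : levi D a k i j = levi D a k j i := by
  simp only [levi]
  congr 1
  refine Finset.sum_congr rfl fun l _ => ?_
  rw [a.g_symm i j]; ring

lemma half_add_half : algebraMap 𝕜 R (1 / 2) + algebraMap 𝕜 R (1 / 2) = 1 := by
  rw [← map_add, add_halves, map_one]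

lemma levi_lower (a : MetricPair n R) (l i j : Fin n) : ∑ m, levi D a m i j * a.g m l =
    algebraMap 𝕜 R (1 / 2) * (D i (a.g l j) + D j (a.g l i) - D l (a.g i j)) := by
  rw [← a.lower_raise (fun l => D i (a.g l j) + D j (a.g l i) - D l (a.g i j)) l, Finset.mul_sum]
  refine Finset.sum_congr rfl fun m _ => ?_
  rw [levi, a.g_symm m l, MetricPair.raise]; ring

lemma levi_compat (a : MetricPair n R) : Compat D a (levi D a) := by
  intro i k l
  have h1 := levi_lower (D := D) a l i k
  have h2 := levi_lower (D := D) a k i l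
  simp only [a.g_symm k]
  rw [h1, h2, a.g_symm k i, a.g_symm k l, a.g_symm i l]
  linear_combination (-D i (a.g l k)) * half_add_half (𝕜 := 𝕜) (R := R)

/-- Koszul's argument: in the alternating sum of three compatibility relations, torsion-freeness
cancels all but one term, and the inverse metric isolates `Γ`. The Christoffel symbols of a
conformal or a pulled-back metric are later found by checking symmetry and compatibility of a
candidate. -/
lemma levi_unique (a : MetricPair n R) {Γ : Fin n → Fin n → Fin n → R}
    (hs : ∀ k i j, Γ k i j = Γ k j i) (hc : Compat D a Γ) : Γ = levi D a := by
  funext k i j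
  have key : ∀ l, algebraMap 𝕜 R (1 / 2) * (D i (a.g l j) + D j (a.g l i) - D l (a.g i j)) =
      ∑ m, a.g l m * Γ m i j := fun l => by
    rw [hc i l j, hc j l i, hc l i j]
    simp only [hs _ l i, hs _ l j, hs _ j i, a.g_symm _ i]
    have e : ∀ x y z : R, algebraMap 𝕜 R (1 / 2) * (x + y + (z + y) - (x + z)) = y := by
      intro x y z
      linear_combination y * half_add_half (𝕜 := 𝕜) (R := R)
    have e2 : ∑ m, Γ m i j * a.g l m = ∑ m, a.g l m * Γ m i j :=
      Finset.sum_congr rfl fun m _ => mul_comm _ _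
    rw [← e2]
    convert e _ _ _ using 3
  rw [← a.raise_lower (fun k => Γ k i j) k]
  simp only [← key, MetricPair.raise, levi, Finset.mul_sum]
  refine Finset.sum_congr rfl fun l _ => ?_
  ring

end Calculus

/-! ### Covariant derivatives, divergences and traces -/

section Connection

lemma sum_rot {R : Type*} [AddCommMonoid R] {n : ℕ} (f : Fin n → Fin n → Fin n → R) :
    ∑ k, ∑ q, ∑ m, f k q m = ∑ m, ∑ k, ∑ q, f k q m := by
  rw [Finset.sum_comm (f := fun m k => ∑ q, f k q m)]
  exact Finset.sum_congr rfl fun k _ => Finset.sum_comm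

lemma sum_swap13 {R : Type*} [AddCommMonoid R] {n : ℕ} (f : Fin n → Fin n → Fin n → R) :
    ∑ k, ∑ q, ∑ m, f k q m = ∑ k, ∑ q, ∑ m, f m q k := by
  rw [sum_rot]
  exact Finset.sum_congr rfl fun k _ => Finset.sum_comm

variable {𝕜 : Type*} [Field 𝕜] [CharZero 𝕜] {R : Type*} [CommRing R] [Algebra 𝕜 R] {n : ℕ}
variable (D : Fin n → Derivation 𝕜 R R) (Γ : Fin n → Fin n → Fin n → R) (w : R)

/-- The contracted connection coefficients. -/
def ctr (i : Fin n) : R := ∑ j, Γ j i j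

/-- The covariant derivative of a density of degree `w`. -/
def covD (φ : R) (j : Fin n) : R := D j φ - w * ctr Γ j * φ

/-- The covariant derivative of a covector field. -/
def covC (ψ : Fin n → R) (i j : Fin n) : R := D i (ψ j) - ∑ m, Γ m i j * ψ m

/-- The second covariant derivative of a density of degree `w`. -/
def covH (φ : R) (i j : Fin n) : R :=
  D i (covD D Γ w φ j) - ∑ m, Γ m i j * covD D Γ w φ m - w * ctr Γ i * covD D Γ w φ j

/-- The covariant derivative of a twice contravariant tensor density of degree `w`. -/
def covT (P : Fin n → Fin n → R) (j k l : Fin n) : R :=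
  D j (P k l) + ∑ m, Γ k j m * P m l + ∑ m, Γ l j m * P k m - w * ctr Γ j * P k l

/-- The second covariant derivative of a twice contravariant tensor density of degree `w`. -/
def covT2 (P : Fin n → Fin n → R) (i j k l : Fin n) : R :=
  D i (covT D Γ w P j k l) - ∑ m, Γ m i j * covT D Γ w P m k l
    + ∑ m, Γ k i m * covT D Γ w P j m l + ∑ m, Γ l i m * covT D Γ w P j k m
    - w * ctr Γ i * covT D Γ w P j k l

/-- The divergence of a vector density of degree `w`. -/
def divV (V : Fin n → R) : R := ∑ i, D i (V i) + (1 - w) * ∑ i, ctr Γ i * V i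

/-- The divergence of a twice contravariant tensor density of degree `w`. -/
def divT (P : Fin n → Fin n → R) (j : Fin n) : R :=
  ∑ i, D i (P i j) + (1 - w) * ∑ i, ctr Γ i * P i j + ∑ i, ∑ m, Γ j i m * P i m

/-- The Ricci tensor of a connection. -/
def ricc (i j : Fin n) : R :=
  ∑ k, (D k (Γ k i j) - D j (Γ k i k) + ∑ m, (Γ k k m * Γ m i j - Γ k j m * Γ m i k))

variable {D Γ w}

/-- Torsion-freeness turns `Γⁱᵢₘ` into the contracted symbol, so a divergence sees the connection
only through `ctr`, with the factor `1 - w`. -/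
lemma sum_covV (hΓ : ∀ k i j, Γ k i j = Γ k j i) (V : Fin n → R) :
    ∑ i, (D i (V i) + ∑ m, Γ i i m * V m - w * ctr Γ i * V i) = divV D Γ w V := by
  have : ∑ i, ∑ m, Γ i i m * V m = ∑ i, ctr Γ i * V i := by
    rw [Finset.sum_comm]
    refine Finset.sum_congr rfl fun m _ => ?_
    simp only [ctr, Finset.sum_mul]
    exact Finset.sum_congr rfl fun i _ => by rw [hΓ]
  simp only [Finset.sum_add_distrib, Finset.sum_sub_distrib, this, divV, mul_assoc,
    ← Finset.mul_sum]
  ring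

lemma sum_covT (hΓ : ∀ k i j, Γ k i j = Γ k j i) (P : Fin n → Fin n → R) (j : Fin n) :
    ∑ i, covT D Γ w P i i j = divT D Γ w P j := by
  have := sum_covV (D := D) (w := w) hΓ (fun i => P i j)
  simp only [divV, Finset.sum_add_distrib, Finset.sum_sub_distrib] at this
  simp only [covT, divT, Finset.sum_add_distrib, Finset.sum_sub_distrib]
  linear_combination this

lemma covT_symm {P : Fin n → Fin n → R} (hP : ∀ i j, P i j = P j i) (j k l : Fin n) :
    covT D Γ w P j k l = covT D Γ w P j l k := by
  simp only [covT, hP k]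
  have : ∀ m, P m l = P l m := fun m => hP m l
  simp only [this]
  ring

/-- Contraction commutes with the outer derivative. The Christoffel terms of the lower index `j` and
of the upper index `j` cancel, and the symmetry of `P` lets the inner divergence be taken over
either upper index. -/
lemma sum_covT2 (hΓ : ∀ k i j, Γ k i j = Γ k j i) {P : Fin n → Fin n → R}
    (hP : ∀ i j, P i j = P j i) :
    ∑ i, ∑ j, covT2 D Γ w P i j i j = divV D Γ w (divT D Γ w P) := by
  rw [← sum_covV hΓ]
  refine Finset.sum_congr rfl fun i _ => ?_
  have e : ∀ i, ∑ j, covT D Γ w P j i j = divT D Γ w P i := fun i => by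
    rw [← sum_covT hΓ]
    exact Finset.sum_congr rfl fun j _ => covT_symm hP _ _ _
  have e1 : ∑ j, D i (covT D Γ w P j i j) = D i (divT D Γ w P i) := by rw [← e, map_sum]
  have e2 : ∑ j, ∑ m, Γ i i m * covT D Γ w P j m j = ∑ m, Γ i i m * divT D Γ w P m := by
    rw [Finset.sum_comm]
    simp only [← Finset.mul_sum, e]
  have e3 : ∑ j, ∑ m, Γ j i m * covT D Γ w P j i m = ∑ j, ∑ m, Γ m i j * covT D Γ w P m i j := by
    rw [Finset.sum_comm]
  simp only [covT2, Finset.sum_add_distrib, Finset.sum_sub_distrib, e1, e2, e3, ← Finset.mul_sum,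
    e]
  ring

/-- A metric connection commutes with the metric trace. Because of this identity and the next one,
the terms with `β₂` and `β₄` depend on `P` only through its trace density. -/
lemma sum_g_covT {a : MetricPair n R} (hc : Compat D a Γ) (P : Fin n → Fin n → R) (j : Fin n) :
    ∑ k, ∑ q, a.g k q * covT D Γ w P j k q = covD D Γ w (∑ k, ∑ q, a.g k q * P k q) j := by
  simp only [covD, covT, map_sum, Derivation.leibniz, smul_eq_mul, hc j]
  simp only [mul_add, mul_sub, Finset.sum_add_distrib, Finset.sum_sub_distrib, Finset.mul_sum]
  have e1 : ∑ k, ∑ q, ∑ m, a.g k q * (Γ k j m * P m q) =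
      ∑ k, ∑ q, ∑ m, P k q * (Γ m j k * a.g m q) := by
    rw [sum_swap13]
    exact Finset.sum_congr rfl fun k _ => Finset.sum_congr rfl fun q _ =>
      Finset.sum_congr rfl fun m _ => by ring
  have e2 : ∑ k, ∑ q, ∑ m, a.g k q * (Γ q j m * P k m) =
      ∑ k, ∑ q, ∑ m, P k q * (Γ m j q * a.g k m) := by
    refine Finset.sum_congr rfl fun k _ => ?_
    rw [Finset.sum_comm]
    refine Finset.sum_congr rfl fun q _ => Finset.sum_congr rfl fun m _ => by ring
  have e3 : ∑ k, ∑ q, a.g k q * (w * ctr Γ j * P k q) =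
      ∑ k, ∑ q, w * ctr Γ j * (a.g k q * P k q) :=
    Finset.sum_congr rfl fun k _ => Finset.sum_congr rfl fun q _ => by ring
  rw [e1, e2, e3]
  ring

lemma sum_g_covT2 {a : MetricPair n R} (hc : Compat D a Γ) (P : Fin n → Fin n → R)
    (i j : Fin n) :
    ∑ k, ∑ q, a.g k q * covT2 D Γ w P i j k q = covH D Γ w (∑ k, ∑ q, a.g k q * P k q) i j := by
  -- With `j` frozen, `∇ⱼP` is treated as a tensor with two upper indices; the Christoffel term
  -- belonging to `j` is restored in `e`.
  have h := sum_g_covT (w := w) hc (covT D Γ w P j) i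
  have e : ∀ k q, covT2 D Γ w P i j k q = covT D Γ w (covT D Γ w P j) i k q
      - ∑ m, Γ m i j * covT D Γ w P m k q := fun k q => by
    simp only [covT2, covT]; ring
  simp only [e, mul_sub, Finset.sum_sub_distrib, h, sum_g_covT hc, covH]
  have e2 : ∑ k, ∑ q, a.g k q * ∑ m, Γ m i j * covT D Γ w P m k q =
      ∑ m, Γ m i j * covD D Γ w (∑ k, ∑ q, a.g k q * P k q) m := by
    simp only [← sum_g_covT hc, Finset.mul_sum]
    rw [sum_rot]
    exact Finset.sum_congr rfl fun m _ => Finset.sum_congr rfl fun k _ =>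
      Finset.sum_congr rfl fun q _ => by ring
  rw [e2, covD]
  ring

end Connection

/-! ### Conformal change of connection, divergence and Ricci tensor -/

section ConformalChange

variable {𝕜 : Type*} [Field 𝕜] [CharZero 𝕜] {R : Type*} [CommRing R] [Algebra 𝕜 R] {n : ℕ}
variable (D : Fin n → Derivation 𝕜 R R)

/-- The metric `b` is the multiple `F a` of the metric `a`, with `dF = 2 F Υ`. -/
structure ConfChange (a b : MetricPair n R) (F F' : R) (Υ : Fin n → R) : Prop where
  mul_inv : F * F' = 1
  g_eq : ∀ i j, b.g i j = F * a.g i j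
  h_eq : ∀ i j, b.h i j = F' * a.h i j
  der : ∀ i, D i F = 2 * Υ i * F

/-- The difference of the Christoffel symbols of two conformal metrics. -/
def confA (a : MetricPair n R) (Υ : Fin n → R) (k i j : Fin n) : R :=
  Υ i * (if k = j then 1 else 0) + Υ j * (if k = i then 1 else 0) - a.g i j * a.raise Υ k

variable {D} {a b : MetricPair n R} {Υ : Fin n → R} {F F' : R} {Γ : Fin n → Fin n → Fin n → R}
  {w : R}

lemma confA_symm (k i j : Fin n) : confA a Υ k i j = confA a Υ k j i := by
  rw [confA, confA, a.g_symm i j]; ring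

lemma sum_confA_mul (X : Fin n → R) (i j : Fin n) : ∑ m, confA a Υ m i j * X m =
    Υ i * X j + Υ j * X i - a.g i j * ∑ m, a.raise Υ m * X m := by
  simp only [confA, add_mul, sub_mul, Finset.sum_add_distrib, Finset.sum_sub_distrib, mul_assoc,
    ← Finset.mul_sum]
  simp

lemma ctr_confA (i : Fin n) : ctr (confA a Υ) i = n * Υ i := by
  simp only [ctr, confA, Finset.sum_add_distrib, Finset.sum_sub_distrib, ← Finset.mul_sum,
    a.lower_raise]
  simp [mul_comm]

lemma sum_confA_contract {P : Fin n → Fin n → R} (hP : ∀ i j, P i j = P j i) (j : Fin n) :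
    ∑ i, ∑ m, confA a Υ j i m * P i m =
      2 * ∑ i, Υ i * P i j - (∑ k, ∑ q, a.g k q * P k q) * a.raise Υ j := by
  simp only [confA, add_mul, sub_mul, Finset.sum_add_distrib, Finset.sum_sub_distrib, mul_assoc,
    ← Finset.mul_sum, ite_mul, one_mul, zero_mul, Finset.sum_ite_eq, Finset.mem_univ, if_true,
    mul_ite, mul_one, mul_zero]
  have e1 : ∑ x, ∑ i, (if j = x then Υ i * P x i else 0) = ∑ i, Υ i * P i j := by
    rw [Finset.sum_comm]
    simp [hP j]
  have e2 : ∑ x, ∑ i, a.g x i * (a.raise Υ j * P x i) =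
      (∑ k, ∑ q, a.g k q * P k q) * a.raise Υ j := by
    simp only [Finset.sum_mul]
    exact Finset.sum_congr rfl fun k _ => Finset.sum_congr rfl fun q _ => by ring
  rw [e1, e2]
  ring

/-- After lowering and symmetrizing, only `2 Υᵢ` times the metric survives of `confA`, which is what
`dF = 2 F Υ` demands of a connection compatible with `F a`; `levi_unique` concludes. -/
lemma ConfChange.levi_conf (hc : ConfChange D a b F F' Υ) :
    levi D b = fun k i j => levi D a k i j + confA a Υ k i j := by
  symm
  refine levi_unique b (fun k i j => ?_) fun i k l => ?_
  · rw [levi_symm, confA_symm]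
  · have h1 := levi_compat (D := D) a i k l
    have h2 := sum_confA_mul (a := a) (Υ := Υ) (fun m => a.g m l) i k
    have h3 := sum_confA_mul (a := a) (Υ := Υ) (fun m => a.g k m) i l
    have e1 : ∑ m, a.raise Υ m * a.g m l = Υ l := by
      rw [← a.lower_raise Υ l]
      exact Finset.sum_congr rfl fun m _ => by rw [a.g_symm m l, mul_comm]
    have e2 : ∑ m, a.raise Υ m * a.g k m = Υ k := by
      rw [← a.lower_raise Υ k]
      exact Finset.sum_congr rfl fun m _ => by rw [mul_comm]
    rw [e1] at h2
    rw [e2] at h3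
    simp only [hc.g_eq, Derivation.leibniz, smul_eq_mul, hc.der, mul_left_comm _ F,
      ← Finset.mul_sum, add_mul, Finset.sum_add_distrib, h1, h2, h3]
    rw [a.g_symm k i]
    ring

variable (hw : ∀ i, D i w = 0)

/-- The covariant derivatives of a connection after the conformal change `confA`. -/
abbrev addA (a : MetricPair n R) (Υ : Fin n → R) (Γ : Fin n → Fin n → Fin n → R) :
    Fin n → Fin n → Fin n → R := fun k i j => Γ k i j + confA a Υ k i j

lemma ctr_addA (i : Fin n) : ctr (addA a Υ Γ) i = ctr Γ i + n * Υ i := by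
  rw [← ctr_confA (a := a)]
  simp only [ctr, addA, Finset.sum_add_distrib]

lemma covD_addA (φ : R) (j : Fin n) :
    covD D (addA a Υ Γ) w φ j = covD D Γ w φ j - w * n * Υ j * φ := by
  simp only [covD, ctr_addA]; ring

-- In the factor `w * n + 1`, the part `w * n` comes from the density weight and `1` from the
-- covector index of `∇φ`. The multiple of `a.g i j` stems from the last summand of `confA`.
include hw in
lemma covH_addA (φ : R) (i j : Fin n) :
    covH D (addA a Υ Γ) w φ i j = covH D Γ w φ i j - w * n * covC D Γ Υ i j * φ
      - (w * n + 1) * (Υ i * covD D Γ w φ j + Υ j * covD D Γ w φ i)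
      + a.g i j * (∑ m, a.raise Υ m * covD D Γ w φ m - w * n * φ * ∑ m, a.raise Υ m * Υ m)
      + (w ^ 2 * n ^ 2 + 2 * w * n) * Υ i * Υ j * φ := by
  have h := sum_confA_mul (a := a) (Υ := Υ) (fun m => covD D (addA a Υ Γ) w φ m) i j
  have e : ∑ m, a.raise Υ m * covD D (addA a Υ Γ) w φ m =
      ∑ m, a.raise Υ m * covD D Γ w φ m - w * n * φ * ∑ m, a.raise Υ m * Υ m := by
    simp only [covD_addA, mul_sub, Finset.sum_sub_distrib, Finset.mul_sum]
    congr 1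
    exact Finset.sum_congr rfl fun m _ => by ring
  have e2 : ∑ m, Γ m i j * covD D (addA a Υ Γ) w φ m =
      ∑ m, Γ m i j * covD D Γ w φ m - w * n * φ * ∑ m, Γ m i j * Υ m := by
    simp only [covD_addA, mul_sub, Finset.sum_sub_distrib, Finset.mul_sum]
    congr 1
    exact Finset.sum_congr rfl fun m _ => by ring
  rw [e] at h
  simp only [covH, add_mul, Finset.sum_add_distrib, h, e2]
  simp only [ctr_addA, covD_addA, map_sub, Derivation.leibniz, smul_eq_mul, hw,
    Derivation.map_natCast, covC]
  have e3 : D i φ = covD D Γ w φ i + w * ctr Γ i * φ := by rw [covD]; ring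
  rw [e3]
  ring

lemma divT_addA {P : Fin n → Fin n → R} (hP : ∀ i j, P i j = P j i) (j : Fin n) :
    divT D (addA a Υ Γ) w P j = divT D Γ w P j
      + (n * (1 - w) + 2) * ∑ i, Υ i * P i j - (∑ k, ∑ q, a.g k q * P k q) * a.raise Υ j := by
  have h := sum_confA_contract (a := a) (Υ := Υ) hP j
  simp only [divT, ctr_addA, add_mul, Finset.sum_add_distrib, h, mul_assoc, ← Finset.mul_sum]
  ring

lemma divV_addA (V : Fin n → R) :
    divV D (addA a Υ Γ) w V = divV D Γ w V + n * (1 - w) * ∑ i, Υ i * V i := by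
  simp only [divV, ctr_addA, add_mul, Finset.sum_add_distrib, mul_assoc, ← Finset.mul_sum]
  ring

/-- Compatibility makes `∇` commute with raising an index (claim `e`), so the trace of `∇X` is the
divergence of the raised field. -/
lemma sum_h_covC (hc : Compat D a Γ) (X : Fin n → R) :
    ∑ i, ∑ j, a.h i j * covC D Γ X i j = ∑ i, (D i (a.raise X i) + ∑ m, Γ i i m * a.raise X m) := by
  have e : ∀ i j, covC D Γ X i j =
      ∑ l, a.g j l * (D i (a.raise X l) + ∑ m, Γ l i m * a.raise X m) := fun i j => by
    have h1 : D i (X j) = ∑ l, (a.g j l * D i (a.raise X l) + a.raise X l * D i (a.g j l)) := by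
      rw [← a.lower_raise X j, map_sum]
      simp only [Derivation.leibniz, smul_eq_mul]
    have h2 : ∑ m, Γ m i j * X m = ∑ l, a.raise X l * ∑ m, Γ m i j * a.g m l := by
      simp only [← a.lower_raise X, Finset.mul_sum]
      rw [Finset.sum_comm]
      exact Finset.sum_congr rfl fun l _ => Finset.sum_congr rfl fun m _ => by ring
    have h3 : ∑ l, a.raise X l * ∑ m, Γ m i l * a.g j m =
        ∑ l, a.g j l * ∑ m, Γ l i m * a.raise X m := by
      simp only [Finset.mul_sum]
      rw [Finset.sum_comm]
      exact Finset.sum_congr rfl fun l _ => Finset.sum_congr rfl fun m _ => by ring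
    rw [covC, h1, h2]
    simp only [hc i, mul_add, Finset.sum_add_distrib, h3]
    ring
  refine Finset.sum_congr rfl fun i _ => ?_
  simp only [e]
  exact a.raise_lower (fun l => D i (a.raise X l) + ∑ m, Γ l i m * a.raise X m) i

/-- The Leibniz rule for `∇ⱼ(Υᵢ Pⁱʲ)`, with the whole density weight carried by `P`; the Christoffel
term of `divT` completes `D i (Υ j)` to `∇Υ`. -/
lemma divV_contract {P : Fin n → Fin n → R} (hP : ∀ i j, P i j = P j i) :
    divV D Γ w (fun j => ∑ i, Υ i * P i j) =
      ∑ j, Υ j * divT D Γ w P j + ∑ i, ∑ j, P i j * covC D Γ Υ i j := by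
  have e1 : ∑ j, D j (∑ i, Υ i * P i j) =
      ∑ i, ∑ j, P i j * D i (Υ j) + ∑ j, Υ j * ∑ i, D i (P i j) := by
    simp only [map_sum, Derivation.leibniz, smul_eq_mul, Finset.sum_add_distrib, Finset.mul_sum]
    rw [add_comm, Finset.sum_comm (f := fun i j => Υ i * D j (P j i))]
    simp only [hP]
  have e2 : ∑ j, ctr Γ j * ∑ i, Υ i * P i j = ∑ j, Υ j * ∑ i, ctr Γ i * P i j := by
    simp only [Finset.mul_sum]
    rw [Finset.sum_comm]
    exact Finset.sum_congr rfl fun i _ => Finset.sum_congr rfl fun j _ => by rw [hP i j]; ring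
  have e3 : ∑ j, Υ j * divT D Γ w P j = ∑ j, Υ j * ∑ i, D i (P i j)
      + (1 - w) * ∑ j, Υ j * ∑ i, ctr Γ i * P i j + ∑ j, Υ j * ∑ i, ∑ m, Γ j i m * P i m := by
    simp only [divT, mul_add, Finset.sum_add_distrib, mul_left_comm (Υ _) (1 - w),
      ← Finset.mul_sum _ _ (1 - w)]
  have e4 : ∑ i, ∑ j, P i j * covC D Γ Υ i j = ∑ i, ∑ j, P i j * D i (Υ j)
      - ∑ j, Υ j * ∑ i, ∑ m, Γ j i m * P i m := by
    have : ∑ j, Υ j * ∑ i, ∑ m, Γ j i m * P i m = ∑ i, ∑ j, P i j * ∑ m, Γ m i j * Υ m := by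
      simp only [Finset.mul_sum]
      rw [sum_rot (fun i j m => P i j * (Γ m i j * Υ m))]
      exact Finset.sum_congr rfl fun i _ => Finset.sum_congr rfl fun j _ =>
        Finset.sum_congr rfl fun m _ => by ring
    simp only [covC, mul_sub, Finset.sum_sub_distrib, this]
  rw [divV, e1, e2, e3, e4]
  ring

/-- The weight is carried by `t` alone, so `V` counts as an ordinary vector field and its divergence
contains `ctr` with coefficient `1`. -/
lemma divV_mul (t : R) (V : Fin n → R) :
    divV D Γ w (fun j => t * V j) = ∑ j, V j * covD D Γ w t j
      + t * (∑ i, D i (V i) + ∑ i, ctr Γ i * V i) := by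
  have e : ∑ i, V i * (w * ctr Γ i * t) = w * t * ∑ i, ctr Γ i * V i := by
    rw [Finset.mul_sum]
    exact Finset.sum_congr rfl fun i _ => by ring
  simp only [divV, covD, Derivation.leibniz, smul_eq_mul, Finset.sum_add_distrib, mul_sub,
    Finset.sum_sub_distrib, e, mul_left_comm _ t, ← Finset.mul_sum]
  ring

lemma sum_ctr (hΓ : ∀ k i j, Γ k i j = Γ k j i) (X : Fin n → R) :
    ∑ i, ∑ m, Γ i i m * X m = ∑ m, ctr Γ m * X m := by
  rw [Finset.sum_comm]
  simp only [ctr, Finset.sum_mul]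
  exact Finset.sum_congr rfl fun i _ => Finset.sum_congr rfl fun j _ => by rw [hΓ]

lemma sum_confA_mul2 (X : Fin n → Fin n → R) (j : Fin n) :
    ∑ k, ∑ m, confA a Υ k j m * X k m = Υ j * ∑ k, X k k + ∑ m, Υ m * X j m
      - ∑ k, ∑ m, a.g j m * a.raise Υ k * X k m := by
  simp only [confA, add_mul, sub_mul, Finset.sum_add_distrib, Finset.sum_sub_distrib, mul_assoc,
    ite_mul, zero_mul, mul_ite, mul_one, mul_zero]
  rw [Finset.sum_comm (f := fun k m => if k = j then Υ m * X k m else 0)]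
  simp [Finset.mul_sum]

lemma ricc_eq (hΓ : ∀ k i j, Γ k i j = Γ k j i) (i j : Fin n) :
    ricc D Γ i j = ∑ k, D k (Γ k i j) - D j (ctr Γ i) + ∑ m, ctr Γ m * Γ m i j
      - ∑ k, ∑ m, Γ k j m * Γ m i k := by
  rw [← sum_ctr hΓ fun m => Γ m i j]
  simp only [ricc, ctr, Finset.sum_add_distrib, Finset.sum_sub_distrib, map_sum]
  ring

/-- Inserting `Γ + confA` gives terms with derivatives of `confA`, mixed terms, and quadratic terms.
Compatibility assembles the first two kinds into covariant derivatives of `Υ`, and closedness of `Υ`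
identifies `∂ᵢΥⱼ` with `∂ⱼΥᵢ`. -/
lemma ricc_addA (hΓ : ∀ k i j, Γ k i j = Γ k j i) (hc : Compat D a Γ)
    (hΥ : ∀ i j, D i (Υ j) = D j (Υ i)) (i j : Fin n) :
    ricc D (addA a Υ Γ) i j = ricc D Γ i j - (n - 2) * (covC D Γ Υ i j - Υ i * Υ j)
      - (∑ p, ∑ q, a.h p q * covC D Γ Υ p q + (n - 2) * ∑ p, a.raise Υ p * Υ p) * a.g i j := by
  have q3 := sum_confA_mul (a := a) (Υ := Υ) (ctr Γ) i j
  have q4 := sum_confA_mul (a := a) (Υ := Υ) Υ i j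
  have q5 := sum_confA_mul2 (a := a) (Υ := Υ) (fun k m => Γ m i k) j
  have q6 := sum_confA_mul2 (a := a) (Υ := Υ) (fun k m => Γ m j k) i
  have q7 := sum_confA_mul2 (a := a) (Υ := Υ) (fun k m => confA a Υ m i k) j
  have q8 := ctr_confA (a := a) (Υ := Υ) i
  have q9 : ∑ k, ∑ m, a.g j m * a.raise Υ k * confA a Υ m i k =
      a.g i j * ∑ p, a.raise Υ p * Υ p := by
    have : ∀ k, ∑ m, a.g j m * a.raise Υ k * confA a Υ m i k = a.raise Υ k * (Υ i * a.g j k + Υ k * a.g j i - a.g i k * Υ j) := by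
      intro k
      rw [← a.lower_raise Υ j]
      simp only [confA, mul_add, mul_sub, Finset.sum_add_distrib, Finset.sum_sub_distrib, mul_ite, mul_one, mul_zero]
      simp only [Finset.sum_ite_eq', Finset.mem_univ, if_true, Finset.mul_sum]
      congr 1
      · ring
      · exact Finset.sum_congr rfl fun m _ => by ring
    have h2 : ∀ k, a.raise Υ k * (Υ i * a.g j k + Υ k * a.g j i - a.g i k * Υ j) =
        Υ i * (a.g j k * a.raise Υ k) + a.g i j * (a.raise Υ k * Υ k)
          - Υ j * (a.g i k * a.raise Υ k) := fun k => by rw [a.g_symm j i]; ring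
    simp only [this, h2, Finset.sum_add_distrib, Finset.sum_sub_distrib, ← Finset.mul_sum,
      a.lower_raise]
    ring
  have q10 : ∑ k, ∑ m, addA a Υ Γ k j m * addA a Υ Γ m i k = ∑ k, ∑ m, Γ k j m * Γ m i k
      + ∑ k, ∑ m, confA a Υ k j m * Γ m i k + ∑ k, ∑ m, confA a Υ k i m * Γ m j k
      + ∑ k, ∑ m, confA a Υ k j m * confA a Υ m i k := by
    rw [Finset.sum_comm (f := fun k m => confA a Υ k i m * Γ m j k)]
    simp only [← Finset.sum_add_distrib]
    exact Finset.sum_congr rfl fun k _ => Finset.sum_congr rfl fun m _ => by ring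
  have q11 : ∑ m, ctr (addA a Υ Γ) m * addA a Υ Γ m i j = ∑ m, ctr Γ m * Γ m i j
      + ∑ m, confA a Υ m i j * ctr Γ m + n * ∑ m, Γ m i j * Υ m
      + n * ∑ m, confA a Υ m i j * Υ m := by
    simp only [ctr_addA, Finset.mul_sum, ← Finset.sum_add_distrib]
    exact Finset.sum_congr rfl fun m _ => by ring
  have q12 : ∑ k, D k (confA a Υ k i j) = D i (Υ j) + D j (Υ i)
      - a.g i j * ∑ k, D k (a.raise Υ k) - ∑ k, a.raise Υ k * D k (a.g i j) := by
    have : ∀ k p q, D k (Υ p * if k = q then 1 else 0) = if k = q then D k (Υ p) else 0 :=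
      fun k p q => by split_ifs <;> simp
    simp only [confA, map_add, map_sub, this, Finset.sum_add_distrib, Finset.sum_sub_distrib]
    simp only [Derivation.leibniz, smul_eq_mul, Finset.sum_add_distrib, Finset.mul_sum]
    simp [hΥ i j]
    ring
  -- Compatibility trades the derivative of the metric for Christoffel terms, which cancel those in
  -- `q5` and `q6`.
  have q14 : ∑ k, a.raise Υ k * D k (a.g i j) = ∑ k, ∑ m, a.g j m * a.raise Υ k * Γ m i k
      + ∑ k, ∑ m, a.g i m * a.raise Υ k * Γ m j k := by
    simp only [hc _, mul_add, Finset.mul_sum, ← Finset.sum_add_distrib]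
    refine Finset.sum_congr rfl fun k _ => Finset.sum_congr rfl fun m _ => ?_
    rw [hΓ m k i, hΓ m k j, a.g_symm m j]
    ring
  have q15 := sum_h_covC hc Υ
  rw [Finset.sum_add_distrib, sum_ctr hΓ] at q15
  have q16 : ∑ m, Γ m j i * Υ m = ∑ m, Γ m i j * Υ m := by simp only [hΓ _ j i]
  have q17 : ∑ m, Υ m * Γ m i j = ∑ m, Γ m i j * Υ m :=
    Finset.sum_congr rfl fun m _ => mul_comm _ _
  have q18 : ∑ m, Υ m * Γ m j i = ∑ m, Γ m i j * Υ m := by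
    rw [← q17]; simp only [hΓ _ j i]
  have q19 : ∑ m, Υ m * confA a Υ m i j = ∑ m, confA a Υ m i j * Υ m :=
    Finset.sum_congr rfl fun m _ => mul_comm _ _
  have q20 : ∑ m, a.raise Υ m * ctr Γ m = ∑ m, ctr Γ m * a.raise Υ m :=
    Finset.sum_congr rfl fun m _ => mul_comm _ _
  simp only [q17, q18, q19, q20] at q3 q5 q6 q7
  have q8' := q8
  rw [ctr] at q8'
  rw [q9, q8', q4] at q7
  have q21 : ∑ k, D k (addA a Υ Γ k i j) =
      ∑ k, D k (Γ k i j) + ∑ k, D k (confA a Υ k i j) := by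
    simp only [addA, map_add, Finset.sum_add_distrib]
  have q22 : D j (ctr (addA a Υ Γ) i) = D j (ctr Γ i) + n * D j (Υ i) := by
    simp [ctr_addA]
  rw [ricc_eq (fun k i j => by simp only [addA, hΓ k i j, confA_symm k i j]), ricc_eq hΓ,
    q21, q12, q14, q22, q11, q3, q4, q10, q5, q6, q7, q15, covC, hΥ j i]
  simp only [ctr]
  ring

end ConformalChange

/-! ### The formula without curvature and its conformal defect -/

section QuantR

variable {𝕜 : Type*} [Field 𝕜] [CharZero 𝕜] {R : Type*} [CommRing R] [Algebra 𝕜 R] {n : ℕ}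
variable (D : Fin n → Derivation 𝕜 R R) (Γ : Fin n → Fin n → Fin n → R) (a : MetricPair n R)

/-- The metric trace of a twice contravariant tensor. -/
def gtr (P : Fin n → Fin n → R) : R := ∑ k, ∑ q, a.g k q * P k q

/-- The gradient of a density of degree `w`. -/
def grad (w t : R) (j : Fin n) : R := ∑ i, a.h i j * covD D Γ w t i

/-- The Laplacian of a density of degree `w`. -/
def lapl (w t : R) : R := ∑ i, ∑ j, a.h i j * covH D Γ w t i j

/-- The part of the quantization formula without curvature, with arbitrary coefficients. -/
def quantR (l δ b1 b2 b3 b4 : R) (P : Fin n → Fin n → R) (φ : R) : R :=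
  ∑ i, ∑ j, P i j * covH D Γ l φ i j
    + ∑ j, (b1 * divT D Γ δ P j + b2 * grad D Γ a δ (gtr a P) j) * covD D Γ l φ j
    + (b3 * divV D Γ δ (divT D Γ δ P) + b4 * lapl D Γ a δ (gtr a P)) * φ

variable {D Γ a} {b : MetricPair n R} {Υ : Fin n → R} {F F' w : R}

lemma ConfChange.gtr_eq (hc : ConfChange D a b F F' Υ) (P : Fin n → Fin n → R) :
    gtr b P = F * gtr a P := by
  simp only [gtr, hc.g_eq, Finset.mul_sum, mul_assoc]

lemma covD_mul (f φ : R) (j : Fin n) : covD D Γ w (f * φ) j = f * covD D Γ w φ j + D j f * φ := by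
  simp only [covD, Derivation.leibniz, smul_eq_mul]; ring

lemma covH_mul (f φ : R) (i j : Fin n) : covH D Γ w (f * φ) i j =
    f * covH D Γ w φ i j + D i f * covD D Γ w φ j + D j f * covD D Γ w φ i
      + covC D Γ (fun m => D m f) i j * φ := by
  have e : ∑ m, Γ m i j * covD D Γ w (f * φ) m =
      f * ∑ m, Γ m i j * covD D Γ w φ m + (∑ m, Γ m i j * D m f) * φ := by
    simp only [covD_mul, Finset.mul_sum, Finset.sum_mul, ← Finset.sum_add_distrib]
    exact Finset.sum_congr rfl fun m _ => by ring
  rw [covH, e]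
  simp only [covD_mul, map_add, Derivation.leibniz, smul_eq_mul, covH, covC]
  have e3 : D i φ = covD D Γ w φ i + w * ctr Γ i * φ := by rw [covD]; ring
  rw [e3]
  ring

lemma sum_h_mul_mul (X Y : Fin n → R) :
    ∑ i, ∑ j, a.h i j * (X i * Y j) = ∑ j, a.raise X j * Y j := by
  rw [Finset.sum_comm]
  refine Finset.sum_congr rfl fun j _ => ?_
  rw [MetricPair.raise, Finset.sum_mul]
  exact Finset.sum_congr rfl fun i _ => by rw [a.h_symm]; ring

lemma sum_h_mul_mul' (X Y : Fin n → R) :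
    ∑ i, ∑ j, a.h i j * (X j * Y i) = ∑ j, a.raise X j * Y j := by
  rw [← sum_h_mul_mul, Finset.sum_comm]
  exact Finset.sum_congr rfl fun j _ => Finset.sum_congr rfl fun i _ => by rw [a.h_symm]

lemma divV_add_sub (hc : ∀ i, D i F = 0) (X Y Z : Fin n → R) :
    divV D Γ w (fun j => X j + F * Y j - Z j) =
      divV D Γ w X + F * divV D Γ w Y - divV D Γ w Z := by
  simp only [divV, map_add, map_sub, Derivation.leibniz, hc, smul_eq_mul, mul_zero, add_zero,
    mul_add, mul_sub, Finset.sum_add_distrib, Finset.sum_sub_distrib, mul_left_comm _ F,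
    ← Finset.mul_sum]
  ring

/-- The trace of `P` scales by `F` and the inverse metric by `F'`, so these cancel. In `2 - w * n`,
the `2` is the derivative of `F` and `w * n` is the effect of the weight. -/
lemma ConfChange.grad_eq (hc : ConfChange D a b F F' Υ) (t : R) (j : Fin n) :
    grad D (addA a Υ Γ) b w (F * t) j = grad D Γ a w t j + (2 - w * n) * t * a.raise Υ j := by
  have : ∀ i, b.h i j * covD D (addA a Υ Γ) w (F * t) i =
      a.h i j * covD D Γ w t i + (2 - w * n) * t * (a.h j i * Υ i) := fun i => by
    rw [covD_addA, covD_mul, hc.h_eq, hc.der, a.h_symm i j]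
    linear_combination (a.h j i * (covD D Γ w t i + 2 * Υ i * t - w * n * Υ i * t)) * hc.mul_inv
  simp only [grad, this, Finset.sum_add_distrib, ← Finset.mul_sum, MetricPair.raise]

/-- The cancellation of `F` against `F'` is the same as for the gradient. Tracing the metric term of
`covH_addA` contributes a factor `n`, hence for instance `2 + n - 2 w n = 2 (1 - w n) + n`. -/
lemma ConfChange.lapl_eq (hw : ∀ i, D i w = 0) (hc : ConfChange D a b F F' Υ) (t : R) :
    lapl D (addA a Υ Γ) b w (F * t) = lapl D Γ a w t
      + (2 + n - 2 * w * n) * ∑ j, a.raise Υ j * covD D Γ w t j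
      + (2 - w * n) * t * ∑ i, ∑ j, a.h i j * covC D Γ Υ i j
      + (n - w * n) * (2 - w * n) * t * ∑ j, a.raise Υ j * Υ j := by
  have e1 : ∀ i j, covC D Γ (fun m => D m F) i j =
      F * (2 * covC D Γ Υ i j + 4 * (Υ i * Υ j)) := fun i j => by
    simp only [covC, hc.der, Derivation.leibniz, smul_eq_mul, mul_sub]
    have : ∑ m, Γ m i j * (2 * Υ m * F) = 2 * F * ∑ m, Γ m i j * Υ m := by
      rw [Finset.mul_sum]
      exact Finset.sum_congr rfl fun m _ => by ring
    rw [this]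
    have h2 : D i (2 : R) = 0 := by
      have := (D i).map_natCast 2
      exact_mod_cast this
    rw [h2]
    ring
  have e2 : ∑ m, a.raise Υ m * covD D Γ w (F * t) m =
      F * (∑ m, a.raise Υ m * covD D Γ w t m + 2 * t * ∑ m, a.raise Υ m * Υ m) := by
    simp only [covD_mul, hc.der, mul_add, Finset.sum_add_distrib, Finset.mul_sum]
    congr 1
    · exact Finset.sum_congr rfl fun m _ => by ring
    · exact Finset.sum_congr rfl fun m _ => by ring
  have key : ∀ i j, b.h i j * covH D (addA a Υ Γ) w (F * t) i j =
      a.h i j * covH D Γ w t i j + (1 - w * n) * (a.h i j * (Υ i * covD D Γ w t j))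
      + (1 - w * n) * (a.h i j * (Υ j * covD D Γ w t i))
      + (2 - w * n) * t * (a.h i j * covC D Γ Υ i j)
      + (4 - 4 * (w * n + 1) + w ^ 2 * n ^ 2 + 2 * w * n) * t * (a.h i j * (Υ i * Υ j))
      + (∑ m, a.raise Υ m * covD D Γ w t m + (2 - w * n) * t * ∑ m, a.raise Υ m * Υ m)
        * (a.h i j * a.g i j) := fun i j => by
    rw [covH_addA hw, covH_mul, e1, e2, covD_mul, covD_mul, hc.h_eq, hc.der, hc.der]
    linear_combination (a.h i j * (covH D Γ w t i j + (1 - w * n) * Υ i * covD D Γ w t j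
      + (1 - w * n) * Υ j * covD D Γ w t i + (2 - w * n) * t * covC D Γ Υ i j
      + (4 - 4 * (w * n + 1) + w ^ 2 * n ^ 2 + 2 * w * n) * t * Υ i * Υ j
      + (∑ m, a.raise Υ m * covD D Γ w t m + (2 - w * n) * t * ∑ m, a.raise Υ m * Υ m)
        * a.g i j)) * hc.mul_inv
  simp only [lapl, key, Finset.sum_add_distrib, ← Finset.mul_sum, sum_h_mul_mul, sum_h_mul_mul',
    a.trace_g_h]
  ring

/-- The change of the quantization formula under a conformal change of the metric. -/
lemma ConfChange.quantR_eq {l δ b1 b2 b3 b4 : R} (hl : ∀ i, D i l = 0) (hδ : ∀ i, D i δ = 0)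
    (hm : Compat D a Γ) (hΓ : ∀ k i j, Γ k i j = Γ k j i)
    (hc : ConfChange D a b F F' Υ) {P : Fin n → Fin n → R}
    (hP : ∀ i j, P i j = P j i) (φ : R) :
    quantR D (addA a Υ Γ) b l δ b1 b2 b3 b4 P φ = quantR D Γ a l δ b1 b2 b3 b4 P φ
      + (b3 * (n * (1 - δ) + 2) - l * n) * ((∑ i, ∑ j, P i j * covC D Γ Υ i j) * φ)
      + (b1 * (n * (1 - δ) + 2) - (2 * l * n + 2)) *
          ∑ j, (∑ i, Υ i * P i j) * covD D Γ l φ j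
      + (l ^ 2 * n ^ 2 + 2 * l * n - l * n * b1 * (n * (1 - δ) + 2)
          + b3 * n * (1 - δ) * (n * (1 - δ) + 2)) * (∑ j, (∑ i, Υ i * P i j) * Υ j) * φ
      + (1 - b1 + b2 * (2 - δ * n)) * (gtr a P * ∑ j, a.raise Υ j * covD D Γ l φ j)
      + (- (l * n) + l * n * b1 - l * n * b2 * (2 - δ * n) - b3 * n * (1 - δ)
          + b4 * (n - δ * n) * (2 - δ * n)) * (gtr a P * ∑ j, a.raise Υ j * Υ j) * φ
      + (- (l * n * b1) + b3 * (2 * n * (1 - δ) + 2)) * (∑ j, Υ j * divT D Γ δ P j) * φ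
      + (- (l * n * b2) - b3 + b4 * (2 + n - 2 * δ * n)) *
          (∑ j, a.raise Υ j * covD D Γ δ (gtr a P) j) * φ
      + (- b3 + b4 * (2 - δ * n)) * (gtr a P * ∑ i, ∑ j, a.h i j * covC D Γ Υ i j) * φ := by
  set t := gtr a P with ht
  set v := ∑ j, a.raise Υ j * Υ j with hv
  -- The ingredients are transformed one at a time: Hessian (`c1`), divergence (`c2`), gradient
  -- (`c3`) and Laplacian (`c4`) of the trace, double divergence (`c5`), and the first order part
  -- (`c6`). Collecting coefficients then finishes the proof.
  have c1 : ∑ i, ∑ j, P i j * covH D (addA a Υ Γ) l φ i j =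
      ∑ i, ∑ j, P i j * covH D Γ l φ i j - l * n * φ * ∑ i, ∑ j, P i j * covC D Γ Υ i j
      - 2 * (l * n + 1) * ∑ j, (∑ i, Υ i * P i j) * covD D Γ l φ j
      + t * (∑ m, a.raise Υ m * covD D Γ l φ m - l * n * φ * v)
      + (l ^ 2 * n ^ 2 + 2 * l * n) * φ * ∑ j, (∑ i, Υ i * P i j) * Υ j := by
    have key : ∀ i j, P i j * covH D (addA a Υ Γ) l φ i j =
      P i j * covH D Γ l φ i j - l * n * φ * (P i j * covC D Γ Υ i j)
      - (l * n + 1) * (Υ i * P i j * covD D Γ l φ j)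
      - (l * n + 1) * (Υ j * P j i * covD D Γ l φ i)
      + (∑ m, a.raise Υ m * covD D Γ l φ m - l * n * φ * v) * (a.g i j * P i j)
      + (l ^ 2 * n ^ 2 + 2 * l * n) * φ * (Υ i * P i j * Υ j) := fun i j => by
      rw [covH_addA hl, hP j i]; ring
    have s1 : ∀ X : Fin n → R, ∑ i, ∑ j, Υ i * P i j * X j = ∑ j, (∑ i, Υ i * P i j) * X j :=
      fun X => by
        rw [Finset.sum_comm]; simp only [Finset.sum_mul]
    have s2 : ∀ X : Fin n → R, ∑ i, ∑ j, Υ j * P j i * X i = ∑ j, (∑ i, Υ i * P i j) * X j :=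
      fun X => by simp only [Finset.sum_mul]
    have s3 : ∑ k, ∑ q, a.g k q * P k q = t := rfl
    simp only [key, Finset.sum_add_distrib, Finset.sum_sub_distrib, ← Finset.mul_sum, s1, s2, s3]
    ring
  have c2 : ∀ j, divT D (addA a Υ Γ) δ P j = divT D Γ δ P j
      + (n * (1 - δ) + 2) * ∑ i, Υ i * P i j - t * a.raise Υ j := fun j => divT_addA hP j
  have c3 : ∀ j, grad D (addA a Υ Γ) b δ (gtr b P) j =
      grad D Γ a δ t j + (2 - δ * n) * t * a.raise Υ j := fun j => by
    rw [hc.gtr_eq, hc.grad_eq]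
  have c4 : lapl D (addA a Υ Γ) b δ (gtr b P) = lapl D Γ a δ t
      + (2 + n - 2 * δ * n) * ∑ j, a.raise Υ j * covD D Γ δ t j
      + (2 - δ * n) * t * ∑ i, ∑ j, a.h i j * covC D Γ Υ i j
      + (n - δ * n) * (2 - δ * n) * t * v := by
    rw [hc.gtr_eq, hc.lapl_eq hδ]
  have c5 : divV D (addA a Υ Γ) δ (divT D (addA a Υ Γ) δ P) = divV D Γ δ (divT D Γ δ P)
      + (n * (1 - δ) + 2) * (∑ j, Υ j * divT D Γ δ P j + ∑ i, ∑ j, P i j * covC D Γ Υ i j)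
      - (∑ j, a.raise Υ j * covD D Γ δ t j + t * ∑ i, ∑ j, a.h i j * covC D Γ Υ i j)
      + n * (1 - δ) * (∑ j, Υ j * divT D Γ δ P j
        + (n * (1 - δ) + 2) * ∑ j, (∑ i, Υ i * P i j) * Υ j - t * v) := by
    have s1 : ∀ i, D i (n * (1 - δ) + 2) = 0 := fun i => by
      have h2 : D i (2 : R) = 0 := by
        have := (D i).map_natCast 2
        exact_mod_cast this
      simp [hδ, h2]
    have s2 : ∑ i, Υ i * divT D (addA a Υ Γ) δ P i = ∑ j, Υ j * divT D Γ δ P j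
        + (n * (1 - δ) + 2) * ∑ j, (∑ i, Υ i * P i j) * Υ j - t * v := by
      have : ∀ j, Υ j * (divT D Γ δ P j + (n * (1 - δ) + 2) * ∑ i, Υ i * P i j
          - t * a.raise Υ j) = Υ j * divT D Γ δ P j
            + (n * (1 - δ) + 2) * ((∑ i, Υ i * P i j) * Υ j) - t * (a.raise Υ j * Υ j) :=
        fun j => by ring
      simp only [c2, this, hv, Finset.sum_add_distrib, Finset.sum_sub_distrib, ← Finset.mul_sum]
    have s3 := sum_h_covC hm Υ
    rw [Finset.sum_add_distrib, sum_ctr hΓ] at s3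
    rw [divV_addA, s2, show divT D (addA a Υ Γ) δ P = fun j => divT D Γ δ P j
      + (n * (1 - δ) + 2) * ∑ i, Υ i * P i j - t * a.raise Υ j from funext c2,
      divV_add_sub s1, divV_contract hP, divV_mul, s3]
  have c6 : ∑ j, (b1 * divT D (addA a Υ Γ) δ P j + b2 * grad D (addA a Υ Γ) b δ (gtr b P) j)
        * covD D (addA a Υ Γ) l φ j =
      ∑ j, (b1 * divT D Γ δ P j + b2 * grad D Γ a δ t j) * covD D Γ l φ j
      + b1 * (n * (1 - δ) + 2) * ∑ j, (∑ i, Υ i * P i j) * covD D Γ l φ j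
      + (b2 * (2 - δ * n) - b1) * t * ∑ j, a.raise Υ j * covD D Γ l φ j
      - l * n * b1 * φ * ∑ j, Υ j * divT D Γ δ P j
      - l * n * b2 * φ * ∑ j, a.raise Υ j * covD D Γ δ t j
      - l * n * b1 * (n * (1 - δ) + 2) * φ * ∑ j, (∑ i, Υ i * P i j) * Υ j
      - l * n * (b2 * (2 - δ * n) - b1) * t * φ * v := by
    have s1 : ∑ j, a.raise Υ j * covD D Γ δ t j = ∑ j, grad D Γ a δ t j * Υ j := by
      rw [a.raise_pair, Finset.sum_congr rfl fun j _ => mul_comm _ _]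
      refine Finset.sum_congr rfl fun j _ => ?_
      congr 1
      exact Finset.sum_congr rfl fun i _ => by rw [a.h_symm]
    simp only [c2, c3, covD_addA, s1, hv]
    simp only [Finset.mul_sum _ _ (_ * t), Finset.mul_sum _ _ (_ * φ),
      Finset.mul_sum _ _ (b1 * (n * (1 - δ) + 2)), ← Finset.sum_add_distrib,
      ← Finset.sum_sub_distrib]
    exact Finset.sum_congr rfl fun i _ => by ring
  rw [quantR, c1, c6, c4, c5, quantR]
  ring

end QuantR

/-! ### Schwarzian tensor, curvature, and the coefficients `β₁` to `β₄` -/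

section ConformalInvariance

variable {𝕜 : Type*} [Field 𝕜] [CharZero 𝕜] {R : Type*} [CommRing R] [Algebra 𝕜 R] {n : ℕ}
variable (D : Fin n → Derivation 𝕜 R R) (Γ : Fin n → Fin n → Fin n → R) (a : MetricPair n R)

/-- The scalar curvature. -/
def scalR : R := ∑ i, ∑ j, a.h i j * ricc D Γ i j

/-- The Schwarzian tensor of the conformal factor `F` with `dF = 2 F Υ`. -/
def schwU (Υ : Fin n → R) (i j : Fin n) : R :=
  -(covC D Γ Υ i j - Υ i * Υ j
    + algebraMap 𝕜 R (1 / 2) * (∑ k, a.raise Υ k * Υ k) * a.g i j)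

/-- The Schwarzian tensor of a conformal factor `F` with inverse `F'`. -/
def schwR (F F' : R) (i j : Fin n) : R :=
  -(algebraMap 𝕜 R (1 / 2) * F' * covH D Γ 0 F i j
    - algebraMap 𝕜 R (3 / 4) * F' ^ 2 * (D i F * D j F)
    + algebraMap 𝕜 R (1 / 8) * F' ^ 2 * (∑ k, ∑ q, a.h k q * (D k F * D q F)) * a.g i j)

variable {D Γ a} {b : MetricPair n R} {Υ Ψ : Fin n → R} {F F' w : R}

lemma der_two (i : Fin n) : D i (2 : R) = 0 := by
  have := (D i).map_natCast 2
  exact_mod_cast this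

/-- From `dF = 2 F Υ` follows `∇dF = 2F (∇Υ + 2 Υ ⊗ Υ)`, so the constants `1/2`, `3/4`, `1/8` lead
to `∇Υ - Υ ⊗ Υ + |Υ|² g / 2`. The form in `Υ` is preferable because `Υ` is additive under
composition of conformal changes. -/
lemma schwR_eq_schwU (hF : F * F' = 1) (hΥ : ∀ i, D i F = 2 * Υ i * F) (i j : Fin n) :
    schwR D Γ a F F' i j = schwU D Γ a Υ i j := by
  have h1 : algebraMap 𝕜 R (1 / 2) * 2 = 1 := by
    rw [← map_ofNat (algebraMap 𝕜 R) 2, ← map_mul]; norm_num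
  have h2 : algebraMap 𝕜 R (3 / 4) * 4 = 3 := by
    rw [← map_ofNat (algebraMap 𝕜 R) 4, ← map_mul, ← map_ofNat (algebraMap 𝕜 R) 3]; norm_num
  have h3 : algebraMap 𝕜 R (1 / 8) * 4 = algebraMap 𝕜 R (1 / 2) := by
    rw [← map_ofNat (algebraMap 𝕜 R) 4, ← map_mul]; norm_num
  have e1 : covH D Γ 0 F i j = F * (2 * covC D Γ Υ i j + 4 * (Υ i * Υ j)) := by
    simp only [covH, covD, covC, hΥ, Derivation.leibniz, smul_eq_mul, mul_sub, zero_mul, sub_zero,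
      der_two]
    have : ∑ m, Γ m i j * (2 * Υ m * F) = 2 * F * ∑ m, Γ m i j * Υ m := by
      rw [Finset.mul_sum]
      exact Finset.sum_congr rfl fun m _ => by ring
    rw [this]
    ring
  have e2 : ∑ k, ∑ q, a.h k q * (D k F * D q F) = 4 * F ^ 2 * ∑ k, a.raise Υ k * Υ k := by
    rw [← sum_h_mul_mul, Finset.mul_sum]
    refine Finset.sum_congr rfl fun k _ => ?_
    rw [Finset.mul_sum]
    exact Finset.sum_congr rfl fun q _ => by rw [hΥ, hΥ]; ring
  have h4 : F' * F = 1 := by rw [mul_comm]; exact hF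
  have h5 : F' ^ 2 * F ^ 2 = 1 := by rw [← mul_pow, h4, one_pow]
  rw [schwR, e1, e2, hΥ, hΥ, schwU]
  have k1 : algebraMap 𝕜 R (1 / 2) * F' * (F * (2 * covC D Γ Υ i j + 4 * (Υ i * Υ j))) =
      covC D Γ Υ i j + 2 * (Υ i * Υ j) := by
    linear_combination (algebraMap 𝕜 R (1 / 2)) * (2 * covC D Γ Υ i j + 4 * (Υ i * Υ j)) * h4
      + (covC D Γ Υ i j + 2 * (Υ i * Υ j)) * h1
  have k2 : algebraMap 𝕜 R (3 / 4) * F' ^ 2 * (2 * Υ i * F * (2 * Υ j * F)) =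
      3 * (Υ i * Υ j) := by
    linear_combination (algebraMap 𝕜 R (3 / 4)) * 4 * (Υ i * Υ j) * h5 + (Υ i * Υ j) * h2
  have k3 : algebraMap 𝕜 R (1 / 8) * F' ^ 2 * (4 * F ^ 2 * ∑ k, a.raise Υ k * Υ k) * a.g i j =
      algebraMap 𝕜 R (1 / 2) * (∑ k, a.raise Υ k * Υ k) * a.g i j := by
    linear_combination (algebraMap 𝕜 R (1 / 8)) * 4 * (∑ k, a.raise Υ k * Υ k) * a.g i j * h5
      + (∑ k, a.raise Υ k * Υ k) * a.g i j * h3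
  rw [k1, k2, k3]
  ring

/-- The cocycle property of the Schwarzian tensor. -/
lemma ConfChange.schwU_eq (hc : ConfChange D a b F F' Υ) (i j : Fin n) :
    schwU D (addA a Υ Γ) b Ψ i j =
      schwU D Γ a (fun k => Υ k + Ψ k) i j - schwU D Γ a Υ i j := by
  have h1 := sum_confA_mul (a := a) (Υ := Υ) Ψ i j
  -- Raising with `b` yields `F'` and `b.g` yields `F`, so this product does not see the conformal
  -- factor.
  have e1 : (∑ k, b.raise Ψ k * Ψ k) * b.g i j = (∑ k, a.raise Ψ k * Ψ k) * a.g i j := by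
    have : ∀ k, b.raise Ψ k = F' * a.raise Ψ k := fun k => by
      simp only [MetricPair.raise, hc.h_eq, Finset.mul_sum, mul_assoc]
    simp only [this, hc.g_eq, mul_assoc, ← Finset.mul_sum]
    linear_combination (∑ k, a.raise Ψ k * Ψ k) * a.g i j * hc.mul_inv
  have e2 : ∑ k, a.raise (fun k => Υ k + Ψ k) k * (Υ k + Ψ k) = ∑ k, a.raise Υ k * Υ k
      + 2 * ∑ k, a.raise Υ k * Ψ k + ∑ k, a.raise Ψ k * Ψ k := by
    have e : ∑ k, a.raise Ψ k * Υ k = ∑ k, a.raise Υ k * Ψ k := by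
      rw [a.raise_pair]; exact Finset.sum_congr rfl fun k _ => mul_comm _ _
    have : ∀ k, a.raise (fun k => Υ k + Ψ k) k = a.raise Υ k + a.raise Ψ k := fun k => by
      simp only [MetricPair.raise, mul_add, Finset.sum_add_distrib]
    simp only [this, add_mul, mul_add, Finset.sum_add_distrib, e]
    ring
  have h2 : algebraMap 𝕜 R (1 / 2) * 2 = 1 := by
    rw [← map_ofNat (algebraMap 𝕜 R) 2, ← map_mul]; norm_num
  rw [schwU, schwU, schwU, mul_assoc, e1, e2]
  simp only [covC, addA, add_mul, Finset.sum_add_distrib, h1, map_add, mul_add]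
  linear_combination (∑ k, a.raise Υ k * Ψ k) * a.g i j * h2

/-- The trace of `ricc_addA`. Since `g` has trace `n`, the coefficient of `div Υ` is `(n - 2) + n =
2 (n - 1)`. -/
lemma ConfChange.scalR_eq (hc : ConfChange D a b F F' Υ)
    (hm : Compat D a Γ) (hΓ : ∀ k i j, Γ k i j = Γ k j i)
    (hΥ : ∀ i j, D i (Υ j) = D j (Υ i)) :
    scalR D (addA a Υ Γ) b = F' * (scalR D Γ a
      - 2 * (n - 1) * ∑ p, ∑ q, a.h p q * covC D Γ Υ p q
      - (n - 1) * (n - 2) * ∑ p, a.raise Υ p * Υ p) := by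
  have key : ∀ i j, b.h i j * ricc D (addA a Υ Γ) i j = F' * (a.h i j * ricc D Γ i j
      - (n - 2) * (a.h i j * covC D Γ Υ i j) + (n - 2) * (a.h i j * (Υ i * Υ j))
      - (∑ p, ∑ q, a.h p q * covC D Γ Υ p q + (n - 2) * ∑ p, a.raise Υ p * Υ p)
        * (a.h i j * a.g i j)) := fun i j => by
    rw [hc.h_eq, ricc_addA hΓ hm hΥ]; ring
  simp only [scalR, key, Finset.sum_add_distrib, Finset.sum_sub_distrib, ← Finset.mul_sum,
    sum_h_mul_mul, a.trace_g_h]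
  ring

lemma ConfChange.sum_ricc_eq (hm : Compat D a Γ) (hΓ : ∀ k i j, Γ k i j = Γ k j i)
    (hΥ : ∀ i j, D i (Υ j) = D j (Υ i)) (P : Fin n → Fin n → R) :
    ∑ i, ∑ j, ricc D (addA a Υ Γ) i j * P i j = ∑ i, ∑ j, ricc D Γ i j * P i j
      - (n - 2) * (∑ i, ∑ j, P i j * covC D Γ Υ i j - ∑ j, (∑ i, Υ i * P i j) * Υ j)
      - (∑ p, ∑ q, a.h p q * covC D Γ Υ p q + (n - 2) * ∑ p, a.raise Υ p * Υ p) * gtr a P := by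
  have e : ∑ j, (∑ i, Υ i * P i j) * Υ j = ∑ i, ∑ j, P i j * (Υ i * Υ j) := by
    simp only [Finset.sum_mul]
    rw [Finset.sum_comm]
    exact Finset.sum_congr rfl fun k _ => Finset.sum_congr rfl fun q _ => by ring
  have key : ∀ i j, ricc D (addA a Υ Γ) i j * P i j = ricc D Γ i j * P i j
      - (n - 2) * (P i j * covC D Γ Υ i j) + (n - 2) * (P i j * (Υ i * Υ j))
      - (∑ p, ∑ q, a.h p q * covC D Γ Υ p q + (n - 2) * ∑ p, a.raise Υ p * Υ p)
        * (a.g i j * P i j) := fun i j => by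
    rw [ricc_addA hΓ hm hΥ]; ring
  rw [e, gtr]
  simp only [key, Finset.sum_add_distrib, Finset.sum_sub_distrib, ← Finset.mul_sum]
  ring

lemma sum_schwU (P : Fin n → Fin n → R) :
    ∑ i, ∑ j, schwU D Γ a Υ i j * P i j = -(∑ i, ∑ j, P i j * covC D Γ Υ i j
      - ∑ j, (∑ i, Υ i * P i j) * Υ j
      + algebraMap 𝕜 R (1 / 2) * (∑ k, a.raise Υ k * Υ k) * gtr a P) := by
  have e : ∑ j, (∑ i, Υ i * P i j) * Υ j = ∑ i, ∑ j, P i j * (Υ i * Υ j) := by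
    simp only [Finset.sum_mul]
    rw [Finset.sum_comm]
    exact Finset.sum_congr rfl fun k _ => Finset.sum_congr rfl fun q _ => by ring
  have key : ∀ i j, schwU D Γ a Υ i j * P i j = -(P i j * covC D Γ Υ i j
      - P i j * (Υ i * Υ j)
      + algebraMap 𝕜 R (1 / 2) * (∑ k, a.raise Υ k * Υ k) * (a.g i j * P i j)) := fun i j => by
    rw [schwU]; ring
  rw [e, gtr]
  simp only [key, Finset.sum_neg_distrib, Finset.sum_add_distrib, Finset.sum_sub_distrib,
    ← Finset.mul_sum]

variable (D Γ a) in
/-- The curvature term in dimension at least three. -/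
def curvR (b5 b6 : R) (P : Fin n → Fin n → R) : R :=
  b5 * ∑ i, ∑ j, ricc D Γ i j * P i j + b6 * scalR D Γ a * gtr a P

variable (D Γ a) in
/-- The Schwarzian term in dimension two. -/
def schwTermR (F F' k c : R) (P : Fin n → Fin n → R) : R :=
  k * (∑ i, ∑ j, schwR D Γ a F F' i j * P i j + c * scalR D Γ a * gtr a P)

variable {l m δ : 𝕜}

/-- The eight coefficients of `ConfChange.quantR_eq` are evaluated at the actual `β`. The terms with
a derivative of `φ` or `P` disappear by `r2`, `r4`, `r6`, `r7`; read in this order, these equations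
successively determine `β₁`, `β₂`, `β₃`, `β₄`. The other four, `r1`, `r3`, `r5`, `r8`, are multiples
of the single constant `K`, so the defect is a multiplication operator. -/
lemma quantR_conf_aux (hn : n ≠ 0) (hδ : δ = m - l)
    (h1 : 1 + n * (1 - δ) ≠ 0) (h2 : 2 + n * (1 - δ) ≠ 0) (h3 : 2 + n * (1 - 2 * δ) ≠ 0)
    (h4 : 2 - n * δ ≠ 0)
    (hm : Compat D a Γ) (hΓ : ∀ k i j, Γ k i j = Γ k j i)
    (hc : ConfChange D a b F F' Υ) {P : Fin n → Fin n → R}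
    (hP : ∀ i j, P i j = P j i) (φ : R) :
    quantR D (addA a Υ Γ) b (algebraMap 𝕜 R l) (algebraMap 𝕜 R (m - l))
      (algebraMap 𝕜 R (2 * (n * l + 1) / (2 + n * (1 - (m - l)))))
      (algebraMap 𝕜 R (n * (l + m - 1) / ((2 + n * (1 - (m - l))) * (2 - n * (m - l)))))
      (algebraMap 𝕜 R (n * l * (n * l + 1) / ((1 + n * (1 - (m - l))) * (2 + n * (1 - (m - l))))))
      (algebraMap 𝕜 R (n * l * (n ^ 2 * m * (2 - l - m) + 2 * (n * l + 1) ^ 2 - n * (n + 1)) /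
    ((1 + n * (1 - (m - l))) * (2 + n * (1 - (m - l))) * (2 + n * (1 - 2 * (m - l)))
      * (2 - n * (m - l))))) P φ = quantR D Γ a (algebraMap 𝕜 R l) (algebraMap 𝕜 R (m - l))
      (algebraMap 𝕜 R (2 * (n * l + 1) / (2 + n * (1 - (m - l)))))
      (algebraMap 𝕜 R (n * (l + m - 1) / ((2 + n * (1 - (m - l))) * (2 - n * (m - l)))))
      (algebraMap 𝕜 R (n * l * (n * l + 1) / ((1 + n * (1 - (m - l))) * (2 + n * (1 - (m - l))))))
      (algebraMap 𝕜 R (n * l * (n ^ 2 * m * (2 - l - m) + 2 * (n * l + 1) ^ 2 - n * (n + 1)) /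
    ((1 + n * (1 - (m - l))) * (2 + n * (1 - (m - l))) * (2 + n * (1 - 2 * (m - l)))
      * (2 - n * (m - l))))) P φ
      + algebraMap 𝕜 R (n ^ 2 * l * (m - 1) / (1 + n * (1 - (m - l)))) *
        (∑ i, ∑ j, P i j * covC D Γ Υ i j - ∑ j, (∑ i, Υ i * P i j) * Υ j
          + algebraMap 𝕜 R (n * (1 - δ) / (2 + n * (1 - 2 * δ))) *
            ((∑ k, a.raise Υ k * Υ k) * gtr a P)
          + algebraMap 𝕜 R (1 / (2 + n * (1 - 2 * δ))) *
            (gtr a P * ∑ p, ∑ q, a.h p q * covC D Γ Υ p q)) * φ := by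
  subst hδ
  rw [hc.quantR_eq (fun i => (D i).map_algebraMap _) (fun i => (D i).map_algebraMap _) hm hΓ hP]
  have hn' : (n : 𝕜) ≠ 0 := Nat.cast_ne_zero.2 hn
  generalize hK : n ^ 2 * l * (m - 1) / (1 + n * (1 - (m - l))) = K
  generalize hb1 : 2 * (n * l + 1) / (2 + n * (1 - (m - l))) = b1
  generalize hb2 : n * (l + m - 1) / ((2 + n * (1 - (m - l))) * (2 - n * (m - l))) = b2
  generalize hb3 : n * l * (n * l + 1) / ((1 + n * (1 - (m - l))) * (2 + n * (1 - (m - l)))) = b3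
  generalize hb4 : n * l * (n ^ 2 * m * (2 - l - m) + 2 * (n * l + 1) ^ 2 - n * (n + 1)) /
    ((1 + n * (1 - (m - l))) * (2 + n * (1 - (m - l))) * (2 + n * (1 - 2 * (m - l)))
      * (2 - n * (m - l))) = b4
  generalize hs : 1 / (2 + n * (1 - 2 * (m - l))) = s
  -- Each coefficient becomes an atom, known only through its defining equation cleared of
  -- denominators. The relations below are then linear consequences, up to cancelling a non-zero
  -- factor.
  have k1 := (div_eq_iff h1).1 hK
  have k2 := (div_eq_iff h2).1 hb1
  have k3 := (div_eq_iff (mul_ne_zero h2 h4)).1 hb2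
  have k4 := (div_eq_iff (mul_ne_zero h1 h2)).1 hb3
  have k5 := (div_eq_iff (mul_ne_zero (mul_ne_zero (mul_ne_zero h1 h2) h3) h4)).1 hb4
  have k6 := (div_eq_iff h3).1 hs
  have r1 : b3 * (n * (1 - (m - l)) + 2) - l * n = K := by
    refine mul_left_cancel₀ h1 ?_
    linear_combination k1 - k4
  have r2 : b1 * (n * (1 - (m - l)) + 2) - (2 * l * n + 2) = 0 := by
    linear_combination -k2
  have r3 : l ^ 2 * n ^ 2 + 2 * l * n - l * n * b1 * (n * (1 - (m - l)) + 2)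
          + b3 * n * (1 - (m - l)) * (n * (1 - (m - l)) + 2) = - K := by
    linear_combination (-l * n) * r2 + n * (1 - (m - l)) * r1 - k1
  have r4 : 1 - b1 + b2 * (2 - (m - l) * n) = 0 := by
    refine mul_left_cancel₀ h2 ?_
    linear_combination k2 - k3
  have r8 : - b3 + b4 * (2 - (m - l) * n) = K * s := by
    refine mul_left_cancel₀ (mul_ne_zero (mul_ne_zero h1 h2) h3) ?_
    linear_combination (2 + n * (1 - 2 * (m - l))) * k4 - k5
      + (2 + n * (1 - (m - l))) * s * (2 + n * (1 - 2 * (m - l))) * k1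
      + (2 + n * (1 - (m - l))) * (n ^ 2 * l * (m - 1)) * k6
  have r5 : - (l * n) + l * n * b1 - l * n * b2 * (2 - (m - l) * n) - b3 * n * (1 - (m - l))
          + b4 * (n - (m - l) * n) * (2 - (m - l) * n) =
          K * (n * (1 - (m - l)) / (2 + n * (1 - 2 * (m - l)))) := by
    rw [div_eq_mul_one_div, hs]
    linear_combination (-l * n) * r4 + n * (1 - (m - l)) * r8
  have r6 : - (l * n * b1) + b3 * (2 * n * (1 - (m - l)) + 2) = 0 := by
    refine mul_left_cancel₀ h2 ?_
    linear_combination l * n * k2 - 2 * k4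
  have r7 : - (l * n * b2) - b3 + b4 * (2 + n - 2 * (m - l) * n) = 0 := by
    refine mul_left_cancel₀ (mul_ne_zero (mul_ne_zero h1 h2) h4) ?_
    linear_combination l * n * (1 + n * (1 - (m - l))) * k3 + (2 - n * (m - l)) * k4 - k5
  have t1 := congrArg (algebraMap 𝕜 R) r1
  have t2 := congrArg (algebraMap 𝕜 R) r2
  have t3 := congrArg (algebraMap 𝕜 R) r3
  have t4 := congrArg (algebraMap 𝕜 R) r4
  have t5 := congrArg (algebraMap 𝕜 R) r5
  have t6 := congrArg (algebraMap 𝕜 R) r6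
  have t7 := congrArg (algebraMap 𝕜 R) r7
  have t8 := congrArg (algebraMap 𝕜 R) r8
  generalize n * (1 - (m - l)) / (2 + n * (1 - 2 * (m - l))) = c1 at t5 ⊢
  simp only [map_sub, map_add, map_mul, map_neg, map_pow, map_natCast, map_ofNat, map_one,
    map_zero] at t1 t2 t3 t4 t5 t6 t7 t8 ⊢
  rw [t1, t2, t3, t4, t5, t6, t7, t8]
  ring

end ConformalInvariance

/-! ### Conformal invariance in dimensions at least three, two and one -/

section ConformalTotal

variable {𝕜 : Type*} [RCLike 𝕜] {R : Type*} [CommRing R] [Algebra 𝕜 R] {n : ℕ}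
variable (D : Fin n → Derivation 𝕜 R R)

/-- The half logarithmic derivative of an invertible element. -/
def hlog (F F' : R) (i : Fin n) : R := algebraMap 𝕜 R (1 / 2) * F' * D i F

variable {D} {a b : MetricPair n R} {F F' : R}

lemma der_eq_hlog (hF : F * F' = 1) (i : Fin n) : D i F = 2 * hlog D F F' i * F := by
  have h2 : algebraMap 𝕜 R (1 / 2) * 2 = 1 := by
    rw [← map_ofNat (algebraMap 𝕜 R) 2, ← map_mul]; norm_num
  rw [hlog]
  linear_combination (-D i F) * h2 - algebraMap 𝕜 R (1 / 2) * 2 * D i F * hF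

/-- `hlog` is half of a logarithmic differential, hence closed as soon as the derivations commute.
-/
lemma hlog_symm (hD : ∀ i j f, D i (D j f) = D j (D i f)) (hF : F * F' = 1) (i j : Fin n) :
    D i (hlog D F F' j) = D j (hlog D F F' i) := by
  have h : ∀ i, D i F' = - F' ^ 2 * D i F := fun i => by
    have := (D i).leibniz_of_mul_eq_one (show F' * F = 1 by rw [mul_comm]; exact hF)
    simpa using this
  simp only [hlog, Derivation.leibniz, Derivation.map_algebraMap, smul_eq_mul, h, hD i j F]
  ring

lemma confChange_hlog (hF : F * F' = 1) (hg : ∀ i j, b.g i j = F * a.g i j)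
    (hh : ∀ i j, b.h i j = F' * a.h i j) : ConfChange D a b F F' (hlog D F F') :=
  ⟨hF, hg, hh, der_eq_hlog hF⟩

variable (D a) in
/-- The part of the quantization formula common to all dimensions `n ≥ 2`. -/
def quantE (l m : 𝕜) (P : Fin n → Fin n → R) (φ : R) : R :=
  quantR D (levi D a) a (algebraMap 𝕜 R l) (algebraMap 𝕜 R (m - l)) (algebraMap 𝕜 R (beta1 n l m))
    (algebraMap 𝕜 R (beta2 n l m)) (algebraMap 𝕜 R (beta3 n l m)) (algebraMap 𝕜 R (beta4 n l m)) P φ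

variable {l m : 𝕜}

lemma NonResonant.denominators (hn : 2 ≤ n) (h : NonResonant n (m - l)) :
    1 + n * (1 - (m - l)) ≠ 0 ∧ 2 + n * (1 - (m - l)) ≠ 0 ∧ 2 + n * (1 - 2 * (m - l)) ≠ 0 ∧
      2 - n * (m - l) ≠ 0 := by
  have hn' : (n : 𝕜) ≠ 0 := Nat.cast_ne_zero.2 (by omega)
  obtain ⟨h1, h2, h3, h4, h5⟩ := h
  refine ⟨fun h => h4 ?_, fun h => h5 hn ?_, fun h => h2 ?_, fun h => h1 ?_⟩
  · rw [eq_div_iff hn']; linear_combination -h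
  · rw [eq_div_iff hn']; linear_combination -h
  · rw [eq_div_iff (mul_ne_zero two_ne_zero hn')]; linear_combination -h
  · rw [eq_div_iff hn']; linear_combination -h

lemma quantE_conf (hn : 2 ≤ n) (hres : NonResonant n (m - l))
    (hF : F * F' = 1) (hg : ∀ i j, b.g i j = F * a.g i j)
    (hh : ∀ i j, b.h i j = F' * a.h i j) {P : Fin n → Fin n → R}
    (hP : ∀ i j, P i j = P j i) (φ : R) :
    quantE D b l m P φ = quantE D a l m P φ
      + algebraMap 𝕜 R (n ^ 2 * l * (m - 1) / (1 + n * (1 - (m - l)))) *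
        (∑ i, ∑ j, P i j * covC D (levi D a) (hlog D F F') i j
          - ∑ j, (∑ i, hlog D F F' i * P i j) * hlog D F F' j
          + algebraMap 𝕜 R (n * (1 - (m - l)) / (2 + n * (1 - 2 * (m - l)))) *
            ((∑ k, a.raise (hlog D F F') k * hlog D F F' k) * gtr a P)
          + algebraMap 𝕜 R (1 / (2 + n * (1 - 2 * (m - l)))) *
            (gtr a P * ∑ p, ∑ q, a.h p q * covC D (levi D a) (hlog D F F') p q)) * φ := by
  have hc := confChange_hlog (D := D) hF hg hh
  obtain ⟨h1, h2, h3, h4⟩ := hres.denominators hn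
  have := quantR_conf_aux (Γ := levi D a) (by omega) rfl h1 h2 h3 h4 (levi_compat a)
    (levi_symm a) hc hP φ
  rw [quantE, hc.levi_conf]
  exact this

/-- The defect of `quantE` must cancel against the change of the curvature term. The tracefree part
gives `K = (n - 2) β₅` (`r1`), which is why `n = 2` is exceptional. The terms with `tr P · div Υ`
and `tr P · |Υ|²` give `r2` and `r3`: the former determines `β₆`, and the latter holds as well. -/
lemma conf_three (hn : 3 ≤ n) (hD : ∀ i j f, D i (D j f) = D j (D i f))
    (hres : NonResonant n (m - l))
    (hF : F * F' = 1) (hg : ∀ i j, b.g i j = F * a.g i j)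
    (hh : ∀ i j, b.h i j = F' * a.h i j) {P : Fin n → Fin n → R}
    (hP : ∀ i j, P i j = P j i) (φ : R) :
    quantE D b l m P φ + curvR D (levi D b) b (algebraMap 𝕜 R (beta5 n l m))
        (algebraMap 𝕜 R (beta6 n l m)) P * φ =
      quantE D a l m P φ + curvR D (levi D a) a (algebraMap 𝕜 R (beta5 n l m))
        (algebraMap 𝕜 R (beta6 n l m)) P * φ := by
  have hc := confChange_hlog (D := D) hF hg hh
  obtain ⟨h1, h2, h3, h4⟩ := hres.denominators (by omega)
  have hs := hlog_symm hD hF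
  rw [quantE_conf (by omega) hres hF hg hh hP, curvR, hc.gtr_eq]
  have e : levi D b = addA a (hlog D F F') (levi D a) := hc.levi_conf
  rw [e, hc.scalR_eq (levi_compat a) (levi_symm a) hs,
    ConfChange.sum_ricc_eq (levi_compat a) (levi_symm a) hs, curvR]
  have n1 : (n : 𝕜) - 1 ≠ 0 := by
    rw [sub_ne_zero]; exact_mod_cast (show n ≠ 1 by omega)
  have n2 : (n : 𝕜) - 2 ≠ 0 := by
    rw [sub_ne_zero]; exact_mod_cast (show n ≠ 2 by omega)
  generalize hK : n ^ 2 * l * (m - 1) / (1 + n * (1 - (m - l))) = K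
  have r1 : K = beta5 n l m * (n - 2) := by
    rw [beta5, ← hK]; field_simp
  generalize hs' : 1 / (2 + n * (1 - 2 * (m - l))) = s
  have k1 := (div_eq_iff h1).1 hK
  have k2 : beta5 n l m * ((n - 2) * (1 + n * (1 - (m - l)))) =
      n ^ 2 * l * (m - 1) :=
    div_mul_cancel₀ _ (mul_ne_zero n2 h1)
  have k3 : beta6 n l m * ((n - 1) * (n - 2) * (1 + n * (1 - (m - l))) *
      (2 + n * (1 - 2 * (m - l)))) = n ^ 2 * l * (m - 1) * (n * (m - l) - 2) :=
    div_mul_cancel₀ _ (mul_ne_zero (mul_ne_zero (mul_ne_zero n1 n2) h1) h3)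
  have k4 := (div_eq_iff h3).1 hs'
  have r2 : K * s = beta5 n l m + 2 * (n - 1) * beta6 n l m := by
    refine mul_left_cancel₀ (mul_ne_zero (mul_ne_zero (mul_ne_zero n1 n2) h1) h3) ?_
    linear_combination (-(n - 1) * (n - 2) * s * (2 + n * (1 - 2 * (m - l)))) * k1
      - (n - 1) * (n - 2) * n ^ 2 * l * (m - 1) * k4
      - (n - 1) * (2 + n * (1 - 2 * (m - l))) * k2 - 2 * (n - 1) * k3
  have r3 : K * (n * (1 - (m - l)) / (2 + n * (1 - 2 * (m - l)))) =
      (n - 2) * beta5 n l m + (n - 1) * (n - 2) * beta6 n l m := by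
    rw [div_eq_mul_one_div, hs']
    refine mul_left_cancel₀ (mul_ne_zero h1 h3) ?_
    linear_combination (- n * (1 - (m - l)) * s * (2 + n * (1 - 2 * (m - l)))) * k1
      - n * (1 - (m - l)) * n ^ 2 * l * (m - 1) * k4
      - (2 + n * (1 - 2 * (m - l))) * k2 - k3
  have t1 := congrArg (algebraMap 𝕜 R) r1
  have t2 := congrArg (algebraMap 𝕜 R) r2
  have t3 := congrArg (algebraMap 𝕜 R) r3
  generalize n * (1 - (m - l)) / (2 + n * (1 - 2 * (m - l))) = c1 at t3 ⊢
  simp only [map_sub, map_add, map_mul, map_natCast, map_ofNat, map_one] at t1 t2 t3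
  generalize ∑ j, (∑ i, hlog D F F' i * P i j) * hlog D F F' j = A4
  generalize ∑ i, ∑ j, P i j * covC D (levi D a) (hlog D F F') i j = A2
  generalize ∑ p, ∑ q, a.h p q * covC D (levi D a) (hlog D F F') p q = A13
  generalize ∑ k, a.raise (hlog D F F') k * hlog D F F' k = v
  linear_combination (A2 - A4) * φ * t1 + gtr a P * A13 * φ * t2 + v * gtr a P * φ * t3
    + algebraMap 𝕜 R (beta6 n l m) * gtr a P * φ * (scalR D (levi D a) a
      - 2 * (n - 1) * A13 - (n - 1) * (n - 2) * v) * hF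

/-- For `n = 2` the Ricci tensor changes only by a multiple of the metric and cannot absorb `Pⁱʲ
∇ᵢΥⱼ`. The Schwarzian tensor can: if the model metric is `H a`, it is `H F'` times `b`, and by the
cocycle property the two tensors differ by that of `F`, whose contraction with `P` has the shape of
the defect. The scalar curvature absorbs the remaining `tr P · div Υ`. -/
lemma conf_two (hn : n = 2) (hD : ∀ i j f, D i (D j f) = D j (D i f))
    (hres : NonResonant n (m - l))
    (hF : F * F' = 1) (hg : ∀ i j, b.g i j = F * a.g i j)
    (hh : ∀ i j, b.h i j = F' * a.h i j) {P : Fin n → Fin n → R}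
    (hP : ∀ i j, P i j = P j i) (φ : R) {H H' : R} (hH : H * H' = 1) :
    quantE D b l m P φ + schwTermR D (levi D b) b (H * F') (H' * F)
        (algebraMap 𝕜 R (4 * l * (m - 1) / (2 * (m - l) - 3)))
        (algebraMap 𝕜 R (1 / (8 * ((m - l) - 1)))) P * φ =
      quantE D a l m P φ + schwTermR D (levi D a) a H H'
        (algebraMap 𝕜 R (4 * l * (m - 1) / (2 * (m - l) - 3)))
        (algebraMap 𝕜 R (1 / (8 * ((m - l) - 1)))) P * φ := by
  have hc := confChange_hlog (D := D) hF hg hh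
  obtain ⟨h1, h2, h3, h4⟩ := hres.denominators (by omega)
  have hs := hlog_symm hD hF
  have hHF : (H * F') * (H' * F) = 1 := by linear_combination H * H' * hF + hH
  rw [quantE_conf (by omega) hres hF hg hh hP, schwTermR, hc.gtr_eq]
  have e : levi D b = addA a (hlog D F F') (levi D a) := hc.levi_conf
  -- Additivity of the logarithmic differential for the factorization `H = F · (H F')`.
  have hadd : (fun k => hlog D F F' k + hlog D (H * F') (H' * F) k) = hlog D H H' := by
    have h : ∀ i, D i F' = - F' ^ 2 * D i F := fun i => by
      have := (D i).leibniz_of_mul_eq_one (show F' * F = 1 by rw [mul_comm]; exact hF)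
      simpa using this
    funext k
    simp only [hlog, Derivation.leibniz, smul_eq_mul, h]
    linear_combination (algebraMap 𝕜 R (1 / 2) * H' * D k H - H' * algebraMap 𝕜 R (1 / 2) * H * D k F * F') * hF
      - algebraMap 𝕜 R (1 / 2) * F' * D k F * hH
  have es : ∀ i j, schwR D (addA a (hlog D F F') (levi D a)) b (H * F') (H' * F) i j =
      schwR D (levi D a) a H H' i j - schwU D (levi D a) a (hlog D F F') i j := fun i j => by
    rw [schwR_eq_schwU hHF (der_eq_hlog hHF), hc.schwU_eq, hadd,
      schwR_eq_schwU hH (der_eq_hlog hH)]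
  rw [e, hc.scalR_eq (levi_compat a) (levi_symm a) hs, schwTermR]
  simp only [es, sub_mul, Finset.sum_sub_distrib, sum_schwU]
  subst hn
  simp only [Nat.cast_ofNat] at *
  generalize hK : 2 ^ 2 * l * (m - 1) / (1 + 2 * (1 - (m - l))) = K
  have h5 : 2 * (m - l) - 3 ≠ 0 := fun h => h1 (by linear_combination -h)
  have h6 : (m - l) - 1 ≠ 0 := sub_ne_zero.2 hres.2.2.1
  have r1 : 4 * l * (m - 1) / (2 * (m - l) - 3) = - K := by
    rw [← hK]; field_simp; ring
  generalize hs' : 1 / (2 + 2 * (1 - 2 * (m - l))) = s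
  generalize hc3 : 1 / (8 * ((m - l) - 1)) = c3
  have k4 := (div_eq_iff h3).1 hs'
  have k5 := (div_eq_iff (mul_ne_zero (by norm_num) h6)).1 hc3
  have r2 : K * s = -2 * K * c3 := by
    refine mul_left_cancel₀ h6 ?_
    linear_combination K / 4 * k4 - K / 4 * k5
  have r3 : K * (2 * (1 - (m - l)) / (2 + 2 * (1 - 2 * (m - l)))) = K * (1 / 2) := by
    rw [div_eq_mul_one_div, hs']
    linear_combination -K / 2 * k4
  have t2 := congrArg (algebraMap 𝕜 R) r2
  have t3 := congrArg (algebraMap 𝕜 R) r3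
  rw [r1]
  generalize 2 * (1 - (m - l)) / (2 + 2 * (1 - 2 * (m - l))) = c1 at t3 ⊢
  simp only [map_mul, map_neg, map_ofNat] at t2 t3 ⊢
  generalize ∑ j, (∑ i, hlog D F F' i * P i j) * hlog D F F' j = A4
  generalize ∑ i, ∑ j, P i j * covC D (levi D a) (hlog D F F') i j = A2
  generalize ∑ p, ∑ q, a.h p q * covC D (levi D a) (hlog D F F') p q = A13
  generalize ∑ k, a.raise (hlog D F F') k * hlog D F F' k = v
  linear_combination gtr a P * A13 * φ * t2 + v * gtr a P * φ * t3
    - algebraMap 𝕜 R K * algebraMap 𝕜 R c3 * gtr a P * φ * (scalR D (levi D a) a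
      - 2 * A13) * hF

variable (D a) in
/-- The quantization formula in dimension one, without the Schwarzian derivative. -/
def quantEOne (l m : 𝕜) (P : Fin n → Fin n → R) (φ : R) : R :=
  quantR D (levi D a) a (algebraMap 𝕜 R l) (algebraMap 𝕜 R (m - l))
    (algebraMap 𝕜 R ((2 * l + 1) / (2 - (m - l)))) 0
    (algebraMap 𝕜 R (l * (2 * l + 1) / ((3 - 2 * (m - l)) * (2 - (m - l))))) 0 P φ

variable (D) in
/-- The classical Schwarzian derivative, in terms of `u = φ'` and its inverse. -/
def schwOneR (u u' : R) (i j : Fin n) : R :=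
  D i (D j u) * u' - algebraMap 𝕜 R (3 / 2) * (D i u * u' * (D j u * u'))

variable (D a) in
/-- The quantization formula in dimension one. -/
def quantOneR (l m : 𝕜) (u u' : R) (P : Fin n → Fin n → R) (φ : R) : R :=
  quantEOne D a l m P φ - algebraMap 𝕜 R (2 * l * (m - 1) / (3 - 2 * (m - l))) *
    (∑ i, ∑ j, schwOneR D u u' i j * P i j) * φ

lemma schwOneR_eq {u u' : R} (hu : u * u' = 1) (i j : Fin n) :
    schwOneR D u u' i j =
      D i (D j u * u') - algebraMap 𝕜 R (1 / 2) * ((D i u * u') * (D j u * u')) := by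
  have h : D i u' = - u' ^ 2 * D i u := by
    have := (D i).leibniz_of_mul_eq_one (show u' * u = 1 by rw [mul_comm]; exact hu)
    simpa using this
  have h2 : algebraMap 𝕜 R (3 / 2) = 1 + algebraMap 𝕜 R (1 / 2) := by
    rw [← map_one (algebraMap 𝕜 R), ← map_add]; norm_num
  simp only [schwOneR, Derivation.leibniz, smul_eq_mul, h, h2]
  ring

/-- In dimension one every `Γ` is symmetric, so compatibility with `σ u²` alone determines it, with
value `u'/u`. -/
lemma levi_one {D : Fin 1 → Derivation 𝕜 R R} {a : MetricPair 1 R} {u u' σ : R}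
    (hσ : ∀ i, D i σ = 0) (hu : u * u' = 1)
    (ha : ∀ i j, a.g i j = σ * u ^ 2) : levi D a = fun _ i _ => D i u * u' := by
  symm
  refine levi_unique a (fun k i j => by rw [Subsingleton.elim i j]) fun i k l => ?_
  simp only [ha, Derivation.leibniz, Derivation.leibniz_pow, smul_eq_mul, hσ, Finset.univ_unique,
    Finset.sum_singleton, nsmul_eq_mul, Nat.cast_ofNat]
  linear_combination (-2 * σ * u * D i u) * hu

/-- With `x = Du/u` and `y = Ds/s` the Schwarzian is `Dx - x²/2`; replacing `u` by `s u` adds `Dy -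
x y - y²/2`, that is `∇Υ - Υ²/2` for `Υ = y`. The general defect formula, used with `n = 1` and `b2
= b4 = 0`, is a multiple of this. -/
lemma conf_one {D : Fin 1 → Derivation 𝕜 R R} {a b : MetricPair 1 R}
    (hres : NonResonant 1 (m - l)) {u u' s s' σ : R}
    (hσ : ∀ i, D i σ = 0) (hu : u * u' = 1) (hs : s * s' = 1) (ha : ∀ i j, a.g i j = σ * u ^ 2)
    (hg : ∀ i j, b.g i j = s ^ 2 * a.g i j)
    (hh : ∀ i j, b.h i j = s' ^ 2 * a.h i j) (P : Fin 1 → Fin 1 → R) (φ : R) :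
    quantOneR D b l m (s * u) (s' * u') P φ = quantOneR D a l m u u' P φ := by
  have hF : s ^ 2 * s' ^ 2 = 1 := by rw [← mul_pow, hs, one_pow]
  have hc : ConfChange D a b (s ^ 2) (s' ^ 2) (fun i => D i s * s') := by
    refine ⟨hF, hg, hh, fun i => ?_⟩
    simp only [Derivation.leibniz_pow, nsmul_eq_mul, smul_eq_mul, Nat.cast_ofNat]
    linear_combination (-2 * s * D i s) * hs
  have hP : ∀ i j, P i j = P j i := fun i j => by rw [Subsingleton.elim i j]
  have e := hc.quantR_eq (b1 := algebraMap 𝕜 R ((2 * l + 1) / (2 - (m - l)))) (b2 := 0) (b4 := 0)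
    (b3 := algebraMap 𝕜 R (l * (2 * l + 1) / ((3 - 2 * (m - l)) * (2 - (m - l)))))
    (l := algebraMap 𝕜 R l) (δ := algebraMap 𝕜 R (m - l))
    (fun i => (D i).map_algebraMap _) (fun i => (D i).map_algebraMap _)
    (levi_compat a) (levi_symm a) hP φ
  have hsu : (s * u) * (s' * u') = 1 := by linear_combination u * u' * hs + hu
  have hy : ∀ i, D i (s * u) * (s' * u') = D i s * s' + D i u * u' := fun i => by
    simp only [Derivation.leibniz, smul_eq_mul]
    linear_combination D i s * s' * hu + D i u * u' * hs
  -- A tensor on a line is determined by its trace, so gradients of the trace are multiples of the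
  -- divergence. The eight scalars of the defect therefore merge, and fewer coefficients suffice.
  have ht : ∀ j, covD D (levi D a) (algebraMap 𝕜 R (m - l)) (gtr a P) j =
      a.g 0 0 * divT D (levi D a) (algebraMap 𝕜 R (m - l)) P j := fun j => by
    rw [gtr, ← sum_g_covT (levi_compat a), ← sum_covT (levi_symm a)]
    simp only [Finset.univ_unique, Finset.sum_singleton, Fin.default_eq_zero, Subsingleton.elim j 0]
  have hgh : a.g 0 0 * a.h 0 0 = 1 := by
    have := a.g_mul_h 0 0
    simpa using this
  rw [quantOneR, quantEOne, hc.levi_conf, e, quantOneR, quantEOne]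
  simp only [ht]
  simp only [schwOneR_eq hsu, schwOneR_eq hu, hy, gtr, MetricPair.raise, covC,
    Finset.univ_unique, Finset.sum_singleton, Fin.default_eq_zero]
  have hle : levi D a 0 0 0 = D 0 u * u' := by rw [levi_one hσ hu ha]
  rw [hle]
  generalize divT D (levi D a) (algebraMap 𝕜 R (m - l)) P 0 = V
  generalize covD D (levi D a) (algebraMap 𝕜 R l) φ 0 = W
  have d1 : 2 - (m - l) ≠ 0 := fun h => hres.2.2.2.1 (by push_cast; linear_combination -h)
  have d2 : 3 - 2 * (m - l) ≠ 0 := fun h => hres.2.1 (by push_cast; linear_combination -h / 2)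
  generalize hb1 : (2 * l + 1) / (2 - (m - l)) = b1
  generalize hb3 : l * (2 * l + 1) / ((3 - 2 * (m - l)) * (2 - (m - l))) = b3
  generalize hk : 2 * l * (m - 1) / (3 - 2 * (m - l)) = k
  have k1 := (div_eq_iff d1).1 hb1
  have k2 := (div_eq_iff (mul_ne_zero d2 d1)).1 hb3
  have k3 := (div_eq_iff d2).1 hk
  have r1 : b3 * (2 - (m - l)) - l = k := by
    refine mul_left_cancel₀ d2 ?_
    linear_combination k3 - k2
  have r2 : -(l * b1) + b3 * (3 - 2 * (m - l)) = 0 := by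
    refine mul_left_cancel₀ d1 ?_
    linear_combination l * k1 - k2
  have t0 := congrArg (algebraMap 𝕜 R) k1
  have t1 := congrArg (algebraMap 𝕜 R) r1
  have t2 := congrArg (algebraMap 𝕜 R) r2
  have t3 := congrArg (algebraMap 𝕜 R) k3
  have h2 : algebraMap 𝕜 R (1 / 2) * 2 = 1 := by
    rw [← map_ofNat (algebraMap 𝕜 R) 2, ← map_mul]; norm_num
  simp only [map_sub, map_add, map_mul, map_neg, map_ofNat, map_one, map_zero, Nat.cast_one] at t0 t1 t2 t3 ⊢
  generalize algebraMap 𝕜 R b1 = c1 at *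
  generalize algebraMap 𝕜 R b3 = c3 at *
  generalize algebraMap 𝕜 R k = κ at *
  generalize algebraMap 𝕜 R (1 / 2) = ι at *
  generalize algebraMap 𝕜 R l = L at *
  generalize algebraMap 𝕜 R m = M at *
  generalize D 0 s * s' = y at *
  generalize D 0 u * u' = x at *
  generalize a.g 0 0 = g at *
  generalize a.h 0 0 = h at *
  generalize P 0 0 = p at *
  generalize D 0 y = y' at *
  linear_combination ((1 - c1) * p * y * W + (-L + L * c1 - c3 * (1 - (M - L))) * p * y ^ 2 * φ
      - c3 * y * V * φ - c3 * p * (y' - x * y) * φ) * hgh + (p * (y' - x * y) * φ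
      + (1 - (M - L)) * p * y ^ 2 * φ) * t1 + (L * p * y ^ 2 * φ - y * p * W) * t0
    + y * V * φ * t2 - ι * p * y ^ 2 * φ * t3
    + (κ * x * y * p * φ - (-L ^ 2 + (1 - (M - L)) * (κ + L)) * p * y ^ 2 * φ) * h2

end ConformalTotal

/-! ### Changes of coordinates: connections, densities, divergences -/

section CoordinateChange

variable {𝕜 : Type*} [Field 𝕜] [CharZero 𝕜] {R R' : Type*} [CommRing R] [Algebra 𝕜 R]
  [CommRing R'] [Algebra 𝕜 R'] {n : ℕ}

/-- A change of coordinates: a homomorphism `τ` of rings of functions, its Jacobian matrix `J` and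
the inverse `K` of this matrix. -/
structure CoordChange (D : Fin n → Derivation 𝕜 R R) (D' : Fin n → Derivation 𝕜 R' R') where
  τ : R' →ₐ[𝕜] R
  J : Fin n → Fin n → R
  K : Fin n → Fin n → R
  J_mul_K : ∀ a b, ∑ i, J a i * K i b = if a = b then 1 else 0
  K_mul_J : ∀ i j, ∑ a, K i a * J a j = if i = j then 1 else 0
  chain : ∀ i f, D i (τ f) = ∑ a, J a i * τ (D' a f)
  symm : ∀ i j a, D i (J a j) = D j (J a i)

lemma sum_comm_pairs {A : Type*} [AddCommMonoid A] (f : Fin n → Fin n → Fin n → Fin n → A) :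
    ∑ k, ∑ m, ∑ p, ∑ q, f k m p q = ∑ p, ∑ q, ∑ k, ∑ m, f k m p q := by
  have h1 : ∀ k, ∑ m, ∑ p, ∑ q, f k m p q = ∑ p, ∑ q, ∑ m, f k m p q := fun k =>
    (sum_rot (fun p q m => f k m p q)).symm
  simp only [h1]
  exact (sum_rot (fun p q k => ∑ m, f k m p q)).symm

namespace CoordChange

variable {D : Fin n → Derivation 𝕜 R R} {D' : Fin n → Derivation 𝕜 R' R'} (T : CoordChange D D')
  {Γ : Fin n → Fin n → Fin n → R} {Γ' : Fin n → Fin n → Fin n → R'} {w' : R'} {lam mu : R}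

lemma K_J_cancel (X : Fin n → R) (i : Fin n) : ∑ a, T.K i a * ∑ j, T.J a j * X j = X i := by
  simp only [Finset.mul_sum, ← mul_assoc]
  rw [Finset.sum_comm]
  simp only [← Finset.sum_mul, K_mul_J]
  exact MetricPair.sum_delta X i

lemma J_K_cancel (X : Fin n → R) (a : Fin n) : ∑ i, T.J a i * ∑ b, T.K i b * X b = X a := by
  simp only [Finset.mul_sum, ← mul_assoc]
  rw [Finset.sum_comm]
  simp only [← Finset.sum_mul, J_mul_K]
  exact MetricPair.sum_delta X a

lemma K_J_cancel' (X : Fin n → R) (b : Fin n) : ∑ i, T.K i b * ∑ a, T.J a i * X a = X b := by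
  simp only [Finset.mul_sum, ← mul_assoc]
  rw [Finset.sum_comm]
  have : ∀ a, ∑ i, T.K i b * T.J a i = if b = a then 1 else 0 := fun a => by
    simp only [eq_comm (a := b), ← T.J_mul_K a b]
    exact Finset.sum_congr rfl fun i _ => mul_comm _ _
  simp only [← Finset.sum_mul, this]
  exact MetricPair.sum_delta X b

/-- The logarithmic derivative of the Jacobian determinant. -/
def theta (i : Fin n) : R := ∑ j, ∑ k, T.K j k * D i (T.J k j)

/-- `Γ` is the pullback of the connection `Γ'`. -/
def ConnRel (Γ : Fin n → Fin n → Fin n → R) (Γ' : Fin n → Fin n → Fin n → R') : Prop :=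
  ∀ k i j, ∑ m, T.J k m * Γ m i j =
    ∑ a, ∑ b, T.J a i * T.J b j * T.τ (Γ' k a b) + D i (T.J k j)

/-- The right-hand side of `ConnRel`, multiplied by the inverse Jacobian, is symmetric and
compatible with the pulled-back metric, hence is the Levi-Civita connection by uniqueness. Symmetry
of the second derivatives of the coordinates makes it torsion-free. -/
lemma levi_rel {a : MetricPair n R} {a' : MetricPair n R'}
    (ha : ∀ i j, a.g i j = ∑ k, ∑ l, T.J k i * T.J l j * T.τ (a'.g k l)) :
    T.ConnRel (levi D a) (levi D' a') := by
  set B : Fin n → Fin n → Fin n → R := fun k i j =>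
    ∑ a, ∑ b, T.J a i * T.J b j * T.τ (levi D' a' k a b) + D i (T.J k j) with hB
  have hBs : ∀ k i j, B k i j = B k j i := fun k i j => by
    simp only [hB, T.symm i j k]
    rw [Finset.sum_comm]
    congr 1
    refine Finset.sum_congr rfl fun p _ => Finset.sum_congr rfl fun q _ => ?_
    rw [levi_symm a' k q p]; ring
  have e : levi D a = fun m i j => ∑ k, T.K m k * B k i j := by
    symm
    refine levi_unique a (fun k i j => by simp only [hBs _ i j]) fun i k l => ?_
    have h1 : ∀ k l, ∑ m, (∑ p, T.K m p * B p i k) * a.g m l =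
        ∑ p, B p i k * ∑ q, T.J q l * T.τ (a'.g p q) := fun k l => by
      have h2 : ∀ m, a.g m l = ∑ p, T.J p m * ∑ q, T.J q l * T.τ (a'.g p q) := fun m => by
        simp only [ha, Finset.mul_sum, mul_assoc]
      have h3 : ∀ p, ∑ q, T.J q l * T.τ (a'.g p q) = ∑ m, T.K m p * a.g m l := fun p => by
        simp only [h2]
        exact (T.K_J_cancel' (fun p => ∑ q, T.J q l * T.τ (a'.g p q)) p).symm
      simp only [h3, Finset.sum_mul, Finset.mul_sum]
      rw [Finset.sum_comm]
      exact Finset.sum_congr rfl fun p _ => Finset.sum_congr rfl fun m _ => by ring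
    have h1' : ∑ m, (∑ p, T.K m p * B p i l) * a.g k m =
        ∑ p, B p i l * ∑ q, T.J q k * T.τ (a'.g p q) := by
      rw [← h1]; simp only [a.g_symm k]
    -- `M` is the connection matrix of the target metric in the fixed direction `i`; naming it turns
    -- compatibility into a relation between matrices.
    obtain ⟨M, hM⟩ : ∃ M : Fin n → Fin n → R,
        ∀ m p, M m p = ∑ c, T.J c i * T.τ (levi D' a' m c p) := ⟨_, fun _ _ => rfl⟩
    have hg : ∀ p q, D i (T.τ (a'.g p q)) =
        ∑ m, M m p * T.τ (a'.g m q) + ∑ m, M m q * T.τ (a'.g p m) := fun p q => by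
      simp only [T.chain, levi_compat a' _, map_add, map_sum, map_mul, mul_add,
        Finset.sum_add_distrib, hM, Finset.sum_mul, Finset.mul_sum, mul_assoc]
      congr 1 <;> exact Finset.sum_comm
    have hBM : ∀ p k, B p i k = ∑ b, T.J b k * M p b + D i (T.J p k) := fun p k => by
      simp only [hB, hM, Finset.mul_sum]
      rw [Finset.sum_comm]
      congr 1
      exact Finset.sum_congr rfl fun p _ => Finset.sum_congr rfl fun q _ => by ring
    have s1 : ∀ k l, ∑ p, B p i k * ∑ q, T.J q l * T.τ (a'.g p q) =
        ∑ p, ∑ q, D i (T.J p k) * (T.J q l * T.τ (a'.g p q)) +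
        ∑ p, ∑ q, ∑ m, T.J p k * T.J q l * (M m p * T.τ (a'.g m q)) := fun k l => by
      simp only [hBM, add_mul, Finset.sum_add_distrib, Finset.mul_sum]
      rw [add_comm]
      congr 1
      rw [sum_swap13]
      refine Finset.sum_congr rfl fun p _ => Finset.sum_congr rfl fun q _ => ?_
      rw [Finset.sum_mul]
      exact Finset.sum_congr rfl fun m _ => by ring
    rw [h1, h1', s1, s1, ha, map_sum]
    simp only [map_sum, Derivation.leibniz, smul_eq_mul, hg, mul_add, Finset.sum_add_distrib,
      Finset.mul_sum]
    have s2 : ∑ p, ∑ q, D i (T.J p l) * (T.J q k * T.τ (a'.g p q)) =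
        ∑ p, ∑ q, T.τ (a'.g p q) * (T.J p k * D i (T.J q l)) := by
      rw [Finset.sum_comm]
      exact Finset.sum_congr rfl fun p _ => Finset.sum_congr rfl fun q _ => by
        rw [a'.g_symm]; ring
    have s3 : ∑ p, ∑ q, ∑ m, T.J p l * T.J q k * (M m p * T.τ (a'.g m q)) =
        ∑ p, ∑ q, ∑ m, T.J p k * T.J q l * (M m q * T.τ (a'.g p m)) := by
      rw [Finset.sum_comm]
      exact Finset.sum_congr rfl fun p _ => Finset.sum_congr rfl fun q _ =>
        Finset.sum_congr rfl fun m _ => by rw [a'.g_symm]; ring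
    have s4 : ∑ p, ∑ q, T.τ (a'.g p q) * (T.J q l * D i (T.J p k)) =
        ∑ p, ∑ q, D i (T.J p k) * (T.J q l * T.τ (a'.g p q)) :=
      Finset.sum_congr rfl fun p _ => Finset.sum_congr rfl fun q _ => by ring
    rw [s2, s3, s4]
    ring
  intro k i j
  rw [e]
  exact T.J_K_cancel (fun k => B k i j) k

variable {T}

/-- Contracting the inhomogeneous term `D i (J k j)` with the inverse Jacobian leaves `theta`. -/
lemma ConnRel.ctr_eq (h : T.ConnRel Γ Γ') (i : Fin n) :
    ctr Γ i = ∑ a, T.J a i * T.τ (ctr Γ' a) + T.theta i := by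
  have e : ∀ j, Γ j i j = ∑ k, T.K j k * (∑ a, ∑ b, T.J a i * T.J b j * T.τ (Γ' k a b)
      + D i (T.J k j)) := fun j => by
    have : ∀ k, ∑ a, ∑ b, T.J a i * T.J b j * T.τ (Γ' k a b) + D i (T.J k j) =
        ∑ m, T.J k m * Γ m i j := fun k => (h k i j).symm
    simp only [this]
    exact (T.K_J_cancel (fun m => Γ m i j) j).symm
  have e2 : ctr Γ i = ∑ j, ∑ k, T.K j k * ∑ a, ∑ b, T.J a i * T.J b j * T.τ (Γ' k a b)
      + T.theta i := by
    simp only [ctr, e, mul_add, Finset.sum_add_distrib, theta]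
  rw [e2]
  congr 1
  have : ∀ k, ∑ j, T.K j k * ∑ a, ∑ b, T.J a i * T.J b j * T.τ (Γ' k a b) =
      ∑ a, T.J a i * T.τ (Γ' k a k) := fun k => by
    rw [← T.K_J_cancel' (fun b => ∑ a, T.J a i * T.τ (Γ' k a b)) k]
    refine Finset.sum_congr rfl fun j _ => ?_
    rw [Finset.sum_comm]
    simp only [Finset.mul_sum]
    exact Finset.sum_congr rfl fun p _ => Finset.sum_congr rfl fun q _ => by ring
  rw [Finset.sum_comm]
  simp only [this]
  simp only [ctr, map_sum, Finset.mul_sum]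
  exact Finset.sum_comm

/-- `lam` transforms like a density of degree `w`. -/
def IsWeight (T : CoordChange D D') (lam w : R) : Prop := ∀ i, D i lam = w * T.theta i * lam

/-- The term `w θ` from differentiating `lam` cancels the inhomogeneous term of the contracted
Christoffel symbol; this is the reason for the weight term in the covariant derivative. -/
lemma ConnRel.covD_eq (h : T.ConnRel Γ Γ') (hl : T.IsWeight lam (T.τ w'))
    {φ : R} {φ' : R'} (hφ : φ = lam * T.τ φ') (j : Fin n) :
    covD D Γ (T.τ w') φ j = lam * ∑ b, T.J b j * T.τ (covD D' Γ' w' φ' b) := by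
  have e : ∑ b, T.J b j * T.τ (covD D' Γ' w' φ' b) = ∑ a, T.J a j * T.τ (D' a φ')
      - T.τ w' * (∑ a, T.J a j * T.τ (ctr Γ' a)) * T.τ φ' := by
    simp only [covD, map_sub, map_mul, mul_sub, Finset.sum_sub_distrib, Finset.mul_sum,
      Finset.sum_mul]
    congr 1
    exact Finset.sum_congr rfl fun b _ => by ring
  rw [covD, e, hφ, h.ctr_eq, Derivation.leibniz, hl, T.chain]
  simp only [smul_eq_mul]
  ring

lemma ConnRel.covH_eq (h : T.ConnRel Γ Γ') (hl : T.IsWeight lam (T.τ w'))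
    {φ : R} {φ' : R'} (hφ : φ = lam * T.τ φ') (i j : Fin n) :
    covH D Γ (T.τ w') φ i j =
      lam * ∑ a, ∑ b, T.J a i * T.J b j * T.τ (covH D' Γ' w' φ' a b) := by
  set ψ := covD D' Γ' w' φ' with hψ
  have e1 : ∑ a, ∑ b, T.J a i * T.J b j * T.τ (covH D' Γ' w' φ' a b) =
      ∑ b, T.J b j * D i (T.τ (ψ b))
      - ∑ m, (∑ a, ∑ b, T.J a i * T.J b j * T.τ (Γ' m a b)) * T.τ (ψ m)
      - T.τ w' * (∑ a, T.J a i * T.τ (ctr Γ' a)) * ∑ b, T.J b j * T.τ (ψ b) := by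
    have s1 : ∑ a, ∑ b, T.J a i * T.J b j * T.τ (D' a (ψ b)) =
        ∑ b, T.J b j * D i (T.τ (ψ b)) := by
      rw [Finset.sum_comm]
      simp only [T.chain, Finset.mul_sum]
      exact Finset.sum_congr rfl fun b _ => Finset.sum_congr rfl fun a _ => by ring
    have s2 : ∑ a, ∑ b, T.J a i * T.J b j * ∑ m, T.τ (Γ' m a b) * T.τ (ψ m) =
        ∑ m, (∑ a, ∑ b, T.J a i * T.J b j * T.τ (Γ' m a b)) * T.τ (ψ m) := by
      simp only [Finset.mul_sum, Finset.sum_mul]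
      rw [sum_rot]
      exact Finset.sum_congr rfl fun m _ => Finset.sum_congr rfl fun a _ =>
        Finset.sum_congr rfl fun b _ => by ring
    have s3 : ∑ a, ∑ b, T.J a i * T.J b j * (T.τ w' * T.τ (ctr Γ' a) * T.τ (ψ b)) =
        T.τ w' * (∑ a, T.J a i * T.τ (ctr Γ' a)) * ∑ b, T.J b j * T.τ (ψ b) := by
      rw [mul_assoc, Finset.sum_mul_sum, Finset.mul_sum]
      refine Finset.sum_congr rfl fun a _ => ?_
      rw [Finset.mul_sum]
      exact Finset.sum_congr rfl fun b _ => by ring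
    simp only [covH, ← hψ, map_sub, map_mul, map_sum, mul_sub, Finset.sum_sub_distrib, s1, s2, s3]
  have e2 : ∑ m, Γ m i j * covD D Γ (T.τ w') φ m = lam * (∑ m, (∑ a, ∑ b, T.J a i * T.J b j *
      T.τ (Γ' m a b)) * T.τ (ψ m) + ∑ m, D i (T.J m j) * T.τ (ψ m)) := by
    have : ∀ m, ∑ a, ∑ b, T.J a i * T.J b j * T.τ (Γ' m a b) + D i (T.J m j) =
        ∑ k, T.J m k * Γ k i j := fun m => (h m i j).symm
    simp only [h.covD_eq hl hφ, ← hψ, ← Finset.sum_add_distrib, ← add_mul, this]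
    simp only [Finset.mul_sum, Finset.sum_mul]
    rw [Finset.sum_comm]
    exact Finset.sum_congr rfl fun m _ => Finset.sum_congr rfl fun a _ => by ring
  rw [covH, e2, e1]
  simp only [h.covD_eq hl hφ, ← hψ, Derivation.leibniz, smul_eq_mul, hl i, map_sum,
    Finset.sum_add_distrib, h.ctr_eq i]
  have e3 : ∑ x, T.τ (ψ x) * D i (T.J x j) = ∑ m, D i (T.J m j) * T.τ (ψ m) :=
    Finset.sum_congr rfl fun m _ => mul_comm _ _
  rw [e3]
  ring

/-- The `theta` terms cancel. Differentiating the Jacobian gives `θ`, by symmetry of second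
derivatives, and the weight gives `-w θ` (`e2`); the contracted symbol contributes `-(1 - w) θ`
(`e3`). -/
lemma ConnRel.divV_eq (h : T.ConnRel Γ Γ') (hl : T.IsWeight lam (T.τ w'))
    {V : Fin n → R} {V' : Fin n → R'} (hV : ∀ k, ∑ i, T.J k i * V i = lam * T.τ (V' k)) :
    divV D Γ (T.τ w') V = lam * T.τ (divV D' Γ' w' V') := by
  have inv : ∀ a f, T.τ (D' a f) = ∑ i, T.K i a * D i (T.τ f) := fun a f => by
    simp only [T.chain]
    exact (T.K_J_cancel' (fun a => T.τ (D' a f)) a).symm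
  have e1 : ∀ i k, lam * D i (T.τ (V' k)) = ∑ p, (D i (T.J k p) * V p + T.J k p * D i (V p))
      - T.τ w' * T.theta i * ∑ p, T.J k p * V p := fun i k => by
    have := congrArg (D i) (hV k)
    simp only [map_sum, Derivation.leibniz, smul_eq_mul, hl i] at this
    have e : ∑ p, (D i (T.J k p) * V p + T.J k p * D i (V p)) =
      ∑ p, (T.J k p * D i (V p) + V p * D i (T.J k p)) :=
      Finset.sum_congr rfl fun p _ => by ring
    rw [hV, e, this]
    ring
  have e2 : lam * ∑ k, T.τ (D' k (V' k)) = ∑ p, T.theta p * V p + ∑ i, D i (V i)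
      - T.τ w' * ∑ i, T.theta i * V i := by
    have s1 : ∑ k, ∑ i, ∑ p, T.K i k * (D i (T.J k p) * V p) = ∑ p, T.theta p * V p := by
      simp only [theta, Finset.sum_mul]
      rw [sum_rot]
      refine Finset.sum_congr rfl fun p _ => ?_
      rw [Finset.sum_comm]
      exact Finset.sum_congr rfl fun i _ => Finset.sum_congr rfl fun k _ => by
        rw [T.symm i p k]; ring
    have s2 : ∑ k, ∑ i, T.K i k * ∑ p, T.J k p * D i (V p) = ∑ i, D i (V i) := by
      rw [Finset.sum_comm]
      exact Finset.sum_congr rfl fun i _ => T.K_J_cancel (fun p => D i (V p)) i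
    have s3 : ∑ k, ∑ i, T.K i k * (T.τ w' * T.theta i * ∑ p, T.J k p * V p) =
        T.τ w' * ∑ i, T.theta i * V i := by
      rw [Finset.sum_comm, Finset.mul_sum]
      refine Finset.sum_congr rfl fun i _ => ?_
      rw [← T.K_J_cancel V i, Finset.mul_sum, Finset.mul_sum]
      exact Finset.sum_congr rfl fun k _ => by ring
    have : ∀ k, lam * T.τ (D' k (V' k)) = ∑ i, ∑ p, T.K i k * (D i (T.J k p) * V p)
        + ∑ i, T.K i k * ∑ p, T.J k p * D i (V p)
        - ∑ i, T.K i k * (T.τ w' * T.theta i * ∑ p, T.J k p * V p) := fun k => by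
      rw [inv, Finset.mul_sum, ← Finset.sum_add_distrib, ← Finset.sum_sub_distrib]
      refine Finset.sum_congr rfl fun i _ => ?_
      rw [← Finset.mul_sum, mul_left_comm, e1, Finset.sum_add_distrib]
      ring
    rw [Finset.mul_sum]
    simp only [this, Finset.sum_add_distrib, Finset.sum_sub_distrib, s1, s2, s3]
  have e3 : lam * ∑ k, T.τ (ctr Γ' k) * T.τ (V' k) =
      ∑ i, ctr Γ i * V i - ∑ i, T.theta i * V i := by
    simp only [h.ctr_eq, add_mul, Finset.sum_add_distrib, Finset.mul_sum, mul_left_comm lam,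
      ← hV, Finset.sum_mul]
    rw [Finset.sum_comm]
    rw [add_sub_cancel_right]
    exact Finset.sum_congr rfl fun i _ => Finset.sum_congr rfl fun k _ => by ring
  simp only [divV, map_add, map_sum, map_mul, map_sub, map_one]
  linear_combination -e2 - (1 - T.τ w') * e3

/-- For fixed `l`, contracting the second index with `J l` produces a vector density, to which
`divV_eq` applies. The second derivatives of the coordinates that appear are the inhomogeneous part
of the Christoffel term. -/
lemma ConnRel.divT_eq (h : T.ConnRel Γ Γ') (hl : T.IsWeight lam (T.τ w'))
    {P : Fin n → Fin n → R} {P' : Fin n → Fin n → R'}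
    (hP : ∀ k l, ∑ i, ∑ j, T.J k i * T.J l j * P i j = lam * T.τ (P' k l)) (l : Fin n) :
    ∑ j, T.J l j * divT D Γ (T.τ w') P j = lam * T.τ (divT D' Γ' w' P' l) := by
  have e1 := h.divV_eq hl (V := fun i => ∑ j, T.J l j * P i j) (V' := fun k => P' k l)
    (fun k => by
      rw [← hP]
      simp only [Finset.mul_sum, mul_assoc])
  have e2 : lam * ∑ k, ∑ m, T.τ (Γ' l k m) * T.τ (P' k m) =
      ∑ p, ∑ q, P p q * (∑ m, T.J l m * Γ m p q - D p (T.J l q)) := by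
    have : ∀ p q, ∑ m, T.J l m * Γ m p q - D p (T.J l q) =
        ∑ a, ∑ b, T.J a p * T.J b q * T.τ (Γ' l a b) := fun p q => by
      rw [h]; ring
    simp only [this, Finset.mul_sum, mul_left_comm lam, ← hP]
    rw [sum_comm_pairs]
    exact Finset.sum_congr rfl fun p _ => Finset.sum_congr rfl fun q _ =>
      Finset.sum_congr rfl fun k _ => Finset.sum_congr rfl fun m _ => by ring
  have e3 : ∑ j, T.J l j * divT D Γ (T.τ w') P j =
      divV D Γ (T.τ w') (fun i => ∑ j, T.J l j * P i j)
      + ∑ p, ∑ q, P p q * (∑ m, T.J l m * Γ m p q - D p (T.J l q)) := by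
    have s1 : ∑ j, T.J l j * ∑ i, D i (P i j) = ∑ i, ∑ j, T.J l j * D i (P i j) := by
      simp only [Finset.mul_sum]
      exact Finset.sum_comm
    have s2 : ∑ j, T.J l j * ((1 - T.τ w') * ∑ i, ctr Γ i * P i j) =
        (1 - T.τ w') * ∑ i, ctr Γ i * ∑ j, T.J l j * P i j := by
      simp only [Finset.mul_sum]
      rw [Finset.sum_comm]
      exact Finset.sum_congr rfl fun p _ => Finset.sum_congr rfl fun q _ => by ring
    have s3 : ∑ j, T.J l j * ∑ i, ∑ m, Γ j i m * P i m =
        ∑ p, ∑ q, P p q * ∑ m, T.J l m * Γ m p q := by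
      simp only [Finset.mul_sum]
      rw [← sum_rot (fun i m j => T.J l j * (Γ j i m * P i m))]
      exact Finset.sum_congr rfl fun p _ => Finset.sum_congr rfl fun q _ =>
        Finset.sum_congr rfl fun k _ => by ring
    simp only [divT, divV, mul_add, mul_sub, Finset.sum_add_distrib, Finset.sum_sub_distrib, s1, s2,
      s3, map_sum, Derivation.leibniz, smul_eq_mul]
    ring
  have e4 : T.τ (divT D' Γ' w' P' l) = T.τ (divV D' Γ' w' (fun k => P' k l))
      + ∑ k, ∑ m, T.τ (Γ' l k m) * T.τ (P' k m) := by
    simp only [divT, divV, map_add, map_sum, map_mul]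
  rw [e4, mul_add, e2, ← e1, e3]

end CoordChange
end CoordinateChange

/-! ### Naturality of contractions, curvature and Schwarzian tensor -/

section CoordinateInvariance

variable {𝕜 : Type*} [Field 𝕜] [CharZero 𝕜] {R R' : Type*} [CommRing R] [Algebra 𝕜 R]
  [CommRing R'] [Algebra 𝕜 R'] {n : ℕ}

namespace CoordChange

variable {D : Fin n → Derivation 𝕜 R R} {D' : Fin n → Derivation 𝕜 R' R'} {T : CoordChange D D'}
  {Γ : Fin n → Fin n → Fin n → R} {Γ' : Fin n → Fin n → Fin n → R'} {w' : R'} {lam mu : R}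
  {a : MetricPair n R} {a' : MetricPair n R'}

/-- The metric `a` is the pullback of the metric `a'`. -/
def MetricRel (T : CoordChange D D') (a : MetricPair n R) (a' : MetricPair n R') : Prop :=
  ∀ i j, a.g i j = ∑ k, ∑ l, T.J k i * T.J l j * T.τ (a'.g k l)

/-- The push-forward of `a.h` is an inverse of the transported matrix `a'.g` (claim `e3`), and
inverses are unique. -/
lemma MetricRel.h_rel (ha : T.MetricRel a a') (k l : Fin n) :
    ∑ i, ∑ j, T.J k i * T.J l j * a.h i j = T.τ (a'.h k l) := by
  have lower : ∀ (X : Fin n → R) q, ∑ p, T.τ (a'.h q p) * ∑ r, T.τ (a'.g p r) * X r = X q := by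
    intro X q
    have h1 : ∀ r, ∑ p, T.τ (a'.h q p) * T.τ (a'.g p r) = if q = r then 1 else 0 := fun r => by
      have := congrArg T.τ (a'.h_mul_g q r)
      simp only [map_sum, map_mul] at this
      rw [this]; split_ifs <;> simp
    simp only [Finset.mul_sum, ← mul_assoc]
    rw [Finset.sum_comm]
    simp only [← Finset.sum_mul, h1]
    exact MetricPair.sum_delta X q
  have e2 : ∀ i, ∑ p, T.J p i * ∑ r, T.τ (a'.g p r) * (∑ i, ∑ j, T.J r i * T.J l j * a.h i j) =
      T.J l i := fun i => by
    have h1 : ∀ r, ∑ i, ∑ j, T.J r i * T.J l j * a.h i j =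
        ∑ i, T.J r i * a.raise (T.J l) i := fun r => by
      simp only [MetricPair.raise, Finset.mul_sum]
      exact Finset.sum_congr rfl fun i _ => Finset.sum_congr rfl fun j _ => by ring
    rw [← a.lower_raise (T.J l) i]
    simp only [h1, ha i, Finset.mul_sum, Finset.sum_mul]
    refine Eq.trans ?_ (sum_rot (fun p r j =>
      T.J p i * T.J r j * T.τ (a'.g p r) * a.raise (T.J l) j))
    exact Finset.sum_congr rfl fun p _ => Finset.sum_congr rfl fun r _ =>
      Finset.sum_congr rfl fun j _ => by ring
  have e3 : ∀ p, ∑ r, T.τ (a'.g p r) * (∑ i, ∑ j, T.J r i * T.J l j * a.h i j) =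
      if p = l then 1 else 0 := fun p => by
    have h1 := T.K_J_cancel' (fun p => ∑ r, T.τ (a'.g p r) *
      (∑ i, ∑ j, T.J r i * T.J l j * a.h i j)) p
    simp only [e2] at h1
    rw [← h1]
    simp only [eq_comm (a := p), ← T.J_mul_K l p]
    exact Finset.sum_congr rfl fun i _ => mul_comm _ _
  rw [← lower (fun r => ∑ i, ∑ j, T.J r i * T.J l j * a.h i j) k]
  simp only [e3]
  simp

/-- Contraction of a twice contravariant and a twice covariant tensor. -/
lemma contract_two {P X : Fin n → Fin n → R} {P' X' : Fin n → Fin n → R'}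
    (hP : ∀ k l, ∑ i, ∑ j, T.J k i * T.J l j * P i j = lam * T.τ (P' k l))
    (hX : ∀ i j, X i j = mu * ∑ a, ∑ b, T.J a i * T.J b j * T.τ (X' a b)) :
    ∑ i, ∑ j, P i j * X i j = lam * mu * T.τ (∑ k, ∑ l, P' k l * X' k l) := by
  have : ∀ k l, lam * mu * (T.τ (P' k l) * T.τ (X' k l)) =
      ∑ i, ∑ j, P i j * (mu * (T.J k i * T.J l j * T.τ (X' k l))) := fun k l => by
    rw [show lam * mu * (T.τ (P' k l) * T.τ (X' k l)) =
      (lam * T.τ (P' k l)) * (mu * T.τ (X' k l)) by ring, ← hP, Finset.sum_mul]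
    refine Finset.sum_congr rfl fun i _ => ?_
    rw [Finset.sum_mul]
    exact Finset.sum_congr rfl fun j _ => by ring
  simp only [map_sum, map_mul, Finset.mul_sum, this]
  rw [sum_comm_pairs]
  simp only [hX, Finset.mul_sum]

/-- Contraction of a vector and a covector. -/
lemma contract_one {V X : Fin n → R} {V' X' : Fin n → R'}
    (hV : ∀ k, ∑ i, T.J k i * V i = lam * T.τ (V' k))
    (hX : ∀ i, X i = mu * ∑ a, T.J a i * T.τ (X' a)) :
    ∑ i, V i * X i = lam * mu * T.τ (∑ k, V' k * X' k) := by
  have : ∀ k, lam * mu * (T.τ (V' k) * T.τ (X' k)) =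
      ∑ i, V i * (mu * (T.J k i * T.τ (X' k))) := fun k => by
    rw [show lam * mu * (T.τ (V' k) * T.τ (X' k)) =
      (lam * T.τ (V' k)) * (mu * T.τ (X' k)) by ring, ← hV, Finset.sum_mul]
    exact Finset.sum_congr rfl fun j _ => by ring
  simp only [map_sum, map_mul, Finset.mul_sum, this]
  rw [Finset.sum_comm]
  simp only [hX, Finset.mul_sum]

variable {P : Fin n → Fin n → R} {P' : Fin n → Fin n → R'}

lemma MetricRel.gtr_eq (ha : T.MetricRel a a')
    (hP : ∀ k l, ∑ i, ∑ j, T.J k i * T.J l j * P i j = lam * T.τ (P' k l)) :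
    gtr a P = lam * T.τ (gtr a' P') := by
  have := contract_two hP (mu := 1) (X := a.g) (X' := a'.g) (fun i j => by rw [ha, one_mul])
  simp only [mul_one] at this
  simp only [gtr, mul_comm (a.g _ _), mul_comm (a'.g _ _), this]

lemma MetricRel.grad_eq (ha : T.MetricRel a a') (h : T.ConnRel Γ Γ')
    (hl : T.IsWeight lam (T.τ w')) {t : R} {t' : R'} (ht : t = lam * T.τ t') (k : Fin n) :
    ∑ j, T.J k j * grad D Γ a (T.τ w') t j = lam * T.τ (grad D' Γ' a' w' t' k) := by
  have := contract_one (lam := 1) (V := fun i => ∑ j, T.J k j * a.h i j)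
    (V' := fun l => a'.h l k) (fun l => by
      rw [one_mul, ← ha.h_rel]
      simp only [Finset.mul_sum, mul_assoc]) (h.covD_eq hl ht)
  rw [one_mul] at this
  rw [grad, ← this]
  simp only [grad, Finset.mul_sum, Finset.sum_mul, mul_assoc]
  exact Finset.sum_comm

lemma MetricRel.lapl_eq (ha : T.MetricRel a a') (h : T.ConnRel Γ Γ')
    (hl : T.IsWeight lam (T.τ w')) {t : R} {t' : R'} (ht : t = lam * T.τ t') :
    lapl D Γ a (T.τ w') t = lam * T.τ (lapl D' Γ' a' w' t') := by
  have := contract_two (lam := 1) (P := a.h) (P' := a'.h) (fun k l => by rw [ha.h_rel, one_mul])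
    (h.covH_eq hl ht)
  rw [one_mul] at this
  exact this

/-- The quantization formula without curvature does not depend on the coordinates. -/
lemma MetricRel.quantR_eq (ha : T.MetricRel a a') {l' δ' b1 b2 b3 b4 : R'}
    (hl : T.IsWeight lam (T.τ δ')) (hm : T.IsWeight mu (T.τ l'))
    (hP : ∀ k l, ∑ i, ∑ j, T.J k i * T.J l j * P i j = lam * T.τ (P' k l))
    {φ : R} {φ' : R'} (hφ : φ = mu * T.τ φ') :
    quantR D (levi D a) a (T.τ l') (T.τ δ') (T.τ b1) (T.τ b2) (T.τ b3) (T.τ b4) P φ =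
      lam * mu * T.τ (quantR D' (levi D' a') a' l' δ' b1 b2 b3 b4 P' φ') := by
  have h : T.ConnRel (levi D a) (levi D' a') := T.levi_rel ha
  have e1 := contract_two hP (h.covH_eq hm hφ)
  have e2 := contract_one (V := fun j => T.τ b1 * divT D (levi D a) (T.τ δ') P j
      + T.τ b2 * grad D (levi D a) a (T.τ δ') (gtr a P) j)
    (V' := fun j => b1 * divT D' (levi D' a') δ' P' j
      + b2 * grad D' (levi D' a') a' δ' (gtr a' P') j) (lam := lam)
    (fun k => by
      simp only [mul_add, Finset.sum_add_distrib, mul_left_comm _ (T.τ _), ← Finset.mul_sum,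
        h.divT_eq hl hP, ha.grad_eq h hl (ha.gtr_eq hP), map_add, map_mul])
    (h.covD_eq hm hφ)
  have e3 := h.divV_eq hl (h.divT_eq hl hP)
  have e4 := ha.lapl_eq h hl (ha.gtr_eq hP)
  rw [quantR, e1, e2, e3, e4, hφ]
  simp only [quantR, map_add, map_mul]
  ring

/-- The curvature tensor of a connection. -/
def riem (D : Fin n → Derivation 𝕜 R R) (Γ : Fin n → Fin n → Fin n → R) (p q b c : Fin n) : R :=
  D b (Γ p c q) - D c (Γ p b q) + ∑ m, (Γ p b m * Γ m c q - Γ p c m * Γ m b q)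

lemma ricc_eq_riem (hΓ : ∀ k i j, Γ k i j = Γ k j i) (i j : Fin n) :
    ricc D Γ i j = ∑ k, riem D Γ k i k j := by
  simp only [ricc, riem]
  refine Finset.sum_congr rfl fun k _ => ?_
  rw [hΓ k i j, hΓ k i k]
  congr 1
  exact Finset.sum_congr rfl fun m _ => by rw [hΓ m i j, hΓ m i k]

/-- `ConnRel` is the gauge relation `J Gᵢ = Mᵢ J + ∂ᵢJ` between matrix-valued connection forms. The
curvature `∂_b G_c - ∂_c G_b + [G_b, G_c]` of such forms is conjugated by `J`. Working with matrices
keeps the products in order and avoids index sums. -/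
lemma ConnRel.riem_eq (h : T.ConnRel Γ Γ') (hD : ∀ i j f, D i (D j f) = D j (D i f))
    (p i b c : Fin n) : ∑ m, T.J p m * riem D Γ m i b c =
      ∑ q, (∑ d, T.J d b * ∑ e, T.J e c * T.τ (riem D' Γ' p q d e)) * T.J q i := by
  set G : Fin n → Matrix (Fin n) (Fin n) R := fun i => Matrix.of fun k j => Γ k i j with hG
  set M : Fin n → Matrix (Fin n) (Fin n) R :=
    fun i => Matrix.of fun p q => ∑ a, T.J a i * T.τ (Γ' p a q) with hM
  set J : Matrix (Fin n) (Fin n) R := Matrix.of T.J with hJ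
  have dmul : ∀ k (A B : Matrix (Fin n) (Fin n) R),
      (A * B).map (D k) = A.map (D k) * B + A * B.map (D k) := fun k A B => by
    ext x y
    simp only [Matrix.map_apply, Matrix.mul_apply, Matrix.add_apply, map_sum, Derivation.leibniz,
      smul_eq_mul, ← Finset.sum_add_distrib]
    exact Finset.sum_congr rfl fun m _ => by ring
  have dadd : ∀ k (A B : Matrix (Fin n) (Fin n) R),
      (A + B).map (D k) = A.map (D k) + B.map (D k) := fun k A B => by
    ext x y; simp
  have rel : ∀ i, J * G i = M i * J + J.map (D i) := fun i => by
    ext k j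
    simp only [hJ, hG, hM, Matrix.mul_apply, Matrix.add_apply, Matrix.map_apply, Matrix.of_apply,
      h k i j, Finset.sum_mul]
    rw [Finset.sum_comm]
    congr 1
    exact Finset.sum_congr rfl fun p _ => Finset.sum_congr rfl fun q _ => by ring
  have rel' : ∀ i, J.map (D i) = J * G i - M i * J := fun i => by rw [rel]; abel
  have dd : (J.map (D c)).map (D b) = (J.map (D b)).map (D c) := by
    ext x y; simp only [Matrix.map_apply, hD b c]
  -- The relations for `b` and `c` are differentiated in the other direction and subtracted. The
  -- second derivatives of `J` drop out by `dd`, and its first derivatives are eliminated by `rel'`.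
  have key : J * ((G c).map (D b) - (G b).map (D c) + G b * G c - G c * G b) =
      ((M c).map (D b) - (M b).map (D c) + M b * M c - M c * M b) * J := by
    have h1 := congrArg (fun A => A.map (D b)) (rel c)
    have h2 := congrArg (fun A => A.map (D c)) (rel b)
    simp only [dmul, dadd, rel' b, rel' c] at h1 h2
    rw [← rel' b, ← rel' c, dd] at h1
    rw [← rel' b, ← rel' c] at h2
    simp only [rel'] at h1 h2
    have h3 := congrArg₂ (· - ·) h1 h2
    simp only [mul_add, mul_sub, add_mul, sub_mul, mul_assoc] at h3 ⊢
    rw [← sub_eq_zero] at h3 ⊢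
    rw [← h3]
    abel
  have hN : ∀ p q, ((M c).map (D b) - (M b).map (D c) + M b * M c - M c * M b) p q =
      ∑ d, T.J d b * ∑ e, T.J e c * T.τ (riem D' Γ' p q d e) := fun p q => by
    have s1 : ∀ b c, D b (∑ a, T.J a c * T.τ (Γ' p a q)) =
        ∑ a, T.τ (Γ' p a q) * D b (T.J a c)
        + ∑ d, ∑ e, T.J d b * (T.J e c * T.τ (D' d (Γ' p e q))) := fun b c => by
      simp only [map_sum, Derivation.leibniz, smul_eq_mul, T.chain, Finset.sum_add_distrib,
        Finset.mul_sum]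
      rw [add_comm]
      congr 1
      rw [Finset.sum_comm]
      exact Finset.sum_congr rfl fun p _ => Finset.sum_congr rfl fun q _ => by ring
    have s2 : ∀ b c, ∑ m, (∑ a, T.J a b * T.τ (Γ' p a m)) * (∑ a, T.J a c * T.τ (Γ' m a q)) =
        ∑ d, ∑ e, T.J d b * (T.J e c * ∑ m, T.τ (Γ' p d m) * T.τ (Γ' m e q)) := fun b c => by
      simp only [Finset.sum_mul_sum]
      simp only [Finset.mul_sum]
      rw [← sum_rot (fun d e m => T.J d b * T.τ (Γ' p d m) * (T.J e c * T.τ (Γ' m e q)))]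
      exact Finset.sum_congr rfl fun p _ => Finset.sum_congr rfl fun q _ =>
        Finset.sum_congr rfl fun m _ => by ring
    have s3 : ∑ a, T.τ (Γ' p a q) * D b (T.J a c) = ∑ a, T.τ (Γ' p a q) * D c (T.J a b) := by
      simp only [T.symm b c]
    simp only [hM, Matrix.sub_apply, Matrix.add_apply, Matrix.map_apply, Matrix.mul_apply,
      Matrix.of_apply, s1, s2, s3]
    rw [Finset.sum_comm (f := fun d e => T.J d c * (T.J e b * T.τ (D' d (Γ' p e q)))),
      Finset.sum_comm (f := fun d e => T.J d c * (T.J e b * ∑ m, T.τ (Γ' p d m) * T.τ (Γ' m e q)))]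
    have s4 : ∑ d, T.J d b * ∑ e, T.J e c * T.τ (riem D' Γ' p q d e) =
        ∑ d, ∑ e, T.J d b * (T.J e c * T.τ (riem D' Γ' p q d e)) := by
      simp only [Finset.mul_sum]
    rw [add_sub_add_left_eq_sub, s4]
    simp only [← Finset.sum_sub_distrib, ← Finset.sum_add_distrib]
    refine Finset.sum_congr rfl fun d _ => Finset.sum_congr rfl fun e _ => ?_
    simp only [riem, map_add, map_sub, map_sum, map_mul, Finset.sum_sub_distrib]
    ring
  have := congrFun (congrFun key p) i
  rw [Matrix.mul_apply, Matrix.mul_apply] at this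
  simp only [hN] at this
  rw [hJ] at this
  simp only [Matrix.of_apply] at this
  rw [← this]
  refine Finset.sum_congr rfl fun m _ => ?_
  simp only [riem, hG, Matrix.sub_apply, Matrix.add_apply, Matrix.map_apply, Matrix.mul_apply,
    Matrix.of_apply, Finset.sum_sub_distrib]
  ring

/-- Contracting the first upper index with the derivative index `b` makes `K` and `J` cancel in
`riem_eq`, leaving two Jacobians. -/
lemma ConnRel.ricc_eq (h : T.ConnRel Γ Γ') (hD : ∀ i j f, D i (D j f) = D j (D i f))
    (hΓ : ∀ k i j, Γ k i j = Γ k j i) (hΓ' : ∀ k i j, Γ' k i j = Γ' k j i) (i j : Fin n) :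
    ricc D Γ i j = ∑ a, ∑ b, T.J a i * T.J b j * T.τ (ricc D' Γ' a b) := by
  have e1 : ∀ k, riem D Γ k i k j = ∑ p, ∑ q, T.K k p *
      (∑ d, T.J d k * ∑ e, T.J e j * T.τ (riem D' Γ' p q d e)) * T.J q i := fun k => by
    rw [← T.K_J_cancel (fun m => riem D Γ m i k j) k]
    simp only [h.riem_eq hD]
    refine Finset.sum_congr rfl fun p _ => ?_
    rw [Finset.mul_sum]
    exact Finset.sum_congr rfl fun q _ => by ring
  have e2 : ∀ p q, ∑ k, T.K k p * (∑ d, T.J d k * ∑ e, T.J e j * T.τ (riem D' Γ' p q d e)) =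
      ∑ e, T.J e j * T.τ (riem D' Γ' p q p e) := fun p q =>
    T.K_J_cancel' (fun d => ∑ e, T.J e j * T.τ (riem D' Γ' p q d e)) p
  rw [ricc_eq_riem hΓ]
  simp only [e1]
  rw [← sum_rot (fun p q k => T.K k p *
      (∑ d, T.J d k * ∑ e, T.J e j * T.τ (riem D' Γ' p q d e)) * T.J q i)]
  simp only [← Finset.sum_mul, e2]
  simp only [ricc_eq_riem hΓ', map_sum, Finset.mul_sum]
  simp only [Finset.sum_mul]
  rw [sum_rot (fun q e p => T.J q i * T.J e j * T.τ (riem D' Γ' p q p e))]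
  exact Finset.sum_congr rfl fun p _ => Finset.sum_congr rfl fun q _ =>
        Finset.sum_congr rfl fun m _ => by ring

lemma MetricRel.scalR_eq (ha : T.MetricRel a a') (hD : ∀ i j f, D i (D j f) = D j (D i f)) :
    scalR D (levi D a) a = T.τ (scalR D' (levi D' a') a') := by
  have h : T.ConnRel (levi D a) (levi D' a') := T.levi_rel ha
  have := contract_two (lam := 1) (mu := 1) (P := a.h) (P' := a'.h)
    (X := ricc D (levi D a)) (X' := ricc D' (levi D' a'))
    (fun k l => by rw [ha.h_rel, one_mul])
    (fun i j => by rw [h.ricc_eq hD (levi_symm a) (levi_symm a') i j, one_mul])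
  rw [one_mul, one_mul] at this
  exact this

lemma ConnRel.schwR_eq (h : T.ConnRel Γ Γ') (ha : T.MetricRel a a') (F F' : R') (i j : Fin n) :
    schwR D Γ a (T.τ F) (T.τ F') i j =
      ∑ p, ∑ q, T.J p i * T.J q j * T.τ (schwR D' Γ' a' F F' p q) := by
  have e1 : covH D Γ 0 (T.τ F) i j =
      ∑ p, ∑ q, T.J p i * T.J q j * T.τ (covH D' Γ' 0 F p q) := by
    have := h.covH_eq (w' := 0) (lam := 1) (φ := T.τ F) (φ' := F) (fun i => by simp) (by simp) i j
    simpa using this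
  have e2 : ∑ k, ∑ q, a.h k q * (D k (T.τ F) * D q (T.τ F)) =
      T.τ (∑ k, ∑ q, a'.h k q * (D' k F * D' q F)) := by
    have := contract_two (lam := 1) (mu := 1) (P := a.h) (P' := a'.h)
      (X := fun k q => D k (T.τ F) * D q (T.τ F)) (X' := fun k q => D' k F * D' q F)
      (fun k l => by rw [ha.h_rel, one_mul])
      (fun i j => by
        simp only [T.chain, one_mul, map_mul]
        rw [Finset.sum_mul_sum]
        exact Finset.sum_congr rfl fun p _ => Finset.sum_congr rfl fun q _ => by ring)
    simpa using this
  have e3 : D i (T.τ F) * D j (T.τ F) =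
      ∑ p, ∑ q, T.J p i * T.J q j * T.τ (D' p F * D' q F) := by
    simp only [T.chain, map_mul]
    rw [Finset.sum_mul_sum]
    exact Finset.sum_congr rfl fun p _ => Finset.sum_congr rfl fun q _ => by ring
  rw [schwR, e1, e2, e3, ha]
  simp only [Finset.mul_sum, ← Finset.sum_add_distrib, ← Finset.sum_sub_distrib,
    ← Finset.sum_neg_distrib]
  refine Finset.sum_congr rfl fun p _ => Finset.sum_congr rfl fun q _ => ?_
  simp only [schwR, map_add, map_neg, map_sub, map_mul, map_pow, AlgHom.commutes]
  ring

end CoordChange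
end CoordinateInvariance

/-! ### First order symbols, linearity and commutators of the full formula -/

section Total

variable {𝕜 : Type*} [RCLike 𝕜] {R R' : Type*} [CommRing R] [Algebra 𝕜 R]
  [CommRing R'] [Algebra 𝕜 R'] {n : ℕ}
variable (D : Fin n → Derivation 𝕜 R R) (a : MetricPair n R)

/-- The quantization formula for first order symbols. -/
def quant1R (l m : 𝕜) (V : Fin n → R) (ρ φ : R) : R :=
  ∑ i, V i * covD D (levi D a) (algebraMap 𝕜 R l) φ i
    + algebraMap 𝕜 R (l / (1 - (m - l))) *
      divV D (levi D a) (algebraMap 𝕜 R (m - l)) V * φ + ρ * φ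

/-- The quantization formula with arbitrary coefficients and curvature term. -/
def totR (l m b1 b2 b3 b4 : 𝕜) (X : Fin n → Fin n → R) (P : Fin n → Fin n → R) (V : Fin n → R)
    (ρ φ : R) : R :=
  quantR D (levi D a) a (algebraMap 𝕜 R l) (algebraMap 𝕜 R (m - l)) (algebraMap 𝕜 R b1)
    (algebraMap 𝕜 R b2) (algebraMap 𝕜 R b3) (algebraMap 𝕜 R b4) P φ
  + (∑ i, ∑ j, X i j * P i j) * φ + quant1R D a l m V ρ φ

variable {D a} {b : MetricPair n R} {F F' : R} {Γ : Fin n → Fin n → Fin n → R} {w : R}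
  {l m b1 b2 b3 b4 : 𝕜} {X P Q : Fin n → Fin n → R} {V W : Fin n → R} {ρ σ φ ψ f f' : R}

lemma covD_add (j : Fin n) : covD D Γ w (φ + ψ) j = covD D Γ w φ j + covD D Γ w ψ j := by
  simp only [covD, map_add]; ring

lemma covH_add (i j : Fin n) : covH D Γ w (φ + ψ) i j = covH D Γ w φ i j + covH D Γ w ψ i j := by
  simp only [covH, covD_add, map_add, mul_add, Finset.sum_add_distrib]; ring

lemma divV_add : divV D Γ w (fun i => V i + W i) = divV D Γ w V + divV D Γ w W := by
  simp only [divV, map_add, mul_add, Finset.sum_add_distrib]; ring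

lemma divT_add (j : Fin n) :
    divT D Γ w (fun i k => P i k + Q i k) j = divT D Γ w P j + divT D Γ w Q j := by
  simp only [divT, map_add, mul_add, Finset.sum_add_distrib]; ring

lemma gtr_add : gtr a (fun i k => P i k + Q i k) = gtr a P + gtr a Q := by
  simp only [gtr, mul_add, Finset.sum_add_distrib]

lemma grad_add (j : Fin n) : grad D Γ a w (φ + ψ) j = grad D Γ a w φ j + grad D Γ a w ψ j := by
  simp only [grad, covD_add, mul_add, Finset.sum_add_distrib]

lemma lapl_add : lapl D Γ a w (φ + ψ) = lapl D Γ a w φ + lapl D Γ a w ψ := by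
  simp only [lapl, covH_add, mul_add, Finset.sum_add_distrib]

lemma totR_add_right : totR D a l m b1 b2 b3 b4 X P V ρ (φ + ψ) =
    totR D a l m b1 b2 b3 b4 X P V ρ φ + totR D a l m b1 b2 b3 b4 X P V ρ ψ := by
  simp only [totR, quantR, quant1R, covD_add, covH_add, mul_add, Finset.sum_add_distrib]; ring

lemma totR_add_left : totR D a l m b1 b2 b3 b4 X (fun i j => P i j + Q i j) (fun i => V i + W i)
      (ρ + σ) φ =
    totR D a l m b1 b2 b3 b4 X P V ρ φ + totR D a l m b1 b2 b3 b4 X Q W σ φ := by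
  have e : divT D (levi D a) (algebraMap 𝕜 R (m - l)) (fun i k => P i k + Q i k) =
      fun j => divT D (levi D a) (algebraMap 𝕜 R (m - l)) P j +
        divT D (levi D a) (algebraMap 𝕜 R (m - l)) Q j := funext divT_add
  simp only [totR, quantR, quant1R, gtr_add, grad_add, lapl_add, e, divV_add, mul_add, add_mul,
    Finset.sum_add_distrib]
  ring

lemma const_covD {c : R} (hc : ∀ i, D i c = 0) (j : Fin n) :
    covD D Γ w (c * φ) j = c * covD D Γ w φ j := by
  rw [covD_mul, hc]; ring

lemma const_covH {c : R} (hc : ∀ i, D i c = 0) (i j : Fin n) :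
    covH D Γ w (c * φ) i j = c * covH D Γ w φ i j := by
  rw [covH_mul]; simp [hc, covC]

lemma const_divV {c : R} (hc : ∀ i, D i c = 0) :
    divV D Γ w (fun i => c * V i) = c * divV D Γ w V := by
  simp only [divV, Derivation.leibniz, hc, smul_eq_mul, mul_zero, add_zero, mul_left_comm _ c,
    ← Finset.mul_sum]
  ring

lemma const_divT {c : R} (hc : ∀ i, D i c = 0) (j : Fin n) :
    divT D Γ w (fun i k => c * P i k) j = c * divT D Γ w P j := by
  simp only [divT, Derivation.leibniz, hc, smul_eq_mul, mul_zero, add_zero, mul_left_comm _ c,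
    ← Finset.mul_sum]
  ring

lemma totR_const_right {c : R} (hc : ∀ i, D i c = 0) : totR D a l m b1 b2 b3 b4 X P V ρ (c * φ) =
    c * totR D a l m b1 b2 b3 b4 X P V ρ φ := by
  simp only [totR, quantR, quant1R, const_covD hc, const_covH hc, mul_left_comm _ c,
    ← Finset.mul_sum]
  ring

lemma totR_const_left {c : R} (hc : ∀ i, D i c = 0) :
    totR D a l m b1 b2 b3 b4 X (fun i j => c * P i j) (fun i => c * V i) (c * ρ) φ =
    c * totR D a l m b1 b2 b3 b4 X P V ρ φ := by
  have e : divT D (levi D a) (algebraMap 𝕜 R (m - l)) (fun i k => c * P i k) =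
      fun j => c * divT D (levi D a) (algebraMap 𝕜 R (m - l)) P j := funext (const_divT hc)
  have e2 : gtr a (fun i k => c * P i k) = c * gtr a P := by
    simp only [gtr, mul_left_comm _ c, ← Finset.mul_sum]
  have e3 : ∀ j, grad D (levi D a) a (algebraMap 𝕜 R (m - l)) (c * gtr a P) j =
      c * grad D (levi D a) a (algebraMap 𝕜 R (m - l)) (gtr a P) j := fun j => by
    simp only [grad, const_covD hc, mul_left_comm _ c, ← Finset.mul_sum]
  have e4 : lapl D (levi D a) a (algebraMap 𝕜 R (m - l)) (c * gtr a P) =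
      c * lapl D (levi D a) a (algebraMap 𝕜 R (m - l)) (gtr a P) := by
    simp only [lapl, const_covH hc, mul_left_comm _ c, ← Finset.mul_sum]
  simp only [totR, quantR, quant1R, e, e2, e3, e4, const_divV hc, mul_left_comm _ c, mul_assoc c,
    ← mul_add c, ← Finset.mul_sum]

/-- By the Leibniz rule. All terms that merely multiply `φ` commute with `f`, so the curvature term
and those with `b3` and `b4` leave no trace. -/
lemma totR_comm : totR D a l m b1 b2 b3 b4 X P V ρ (f * φ) =
    f * totR D a l m b1 b2 b3 b4 X P V ρ φ
    + (∑ i, ∑ j, (P i j + P j i) * (D i f * covD D (levi D a) (algebraMap 𝕜 R l) φ j)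
      + ((∑ i, ∑ j, P i j * covC D (levi D a) (fun m => D m f) i j)
        + ∑ j, (algebraMap 𝕜 R b1 * divT D (levi D a) (algebraMap 𝕜 R (m - l)) P j
          + algebraMap 𝕜 R b2 * grad D (levi D a) a (algebraMap 𝕜 R (m - l)) (gtr a P) j) * D j f
        + ∑ i, V i * D i f) * φ) := by
  have e : ∑ i, ∑ j, P j i * (D i f * covD D (levi D a) (algebraMap 𝕜 R l) φ j) =
      ∑ i, ∑ j, P i j * (D j f * covD D (levi D a) (algebraMap 𝕜 R l) φ i) := Finset.sum_comm
  simp only [totR, quantR, quant1R, covD_mul, covH_mul, add_mul (P _ _), Finset.sum_add_distrib, e,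
    mul_add, mul_left_comm _ f, ← Finset.mul_sum, ← mul_assoc _ _ φ, ← Finset.sum_mul]
  simp only [mul_assoc]
  ring

/-- The double commutator of the quantization formula with two functions. -/
lemma totR_comm_comm (hP : ∀ i j, P i j = P j i) :
    totR D a l m b1 b2 b3 b4 X P V ρ (f * (f' * φ)) - f * totR D a l m b1 b2 b3 b4 X P V ρ (f' * φ)
      - f' * (totR D a l m b1 b2 b3 b4 X P V ρ (f * φ) - f * totR D a l m b1 b2 b3 b4 X P V ρ φ) =
    2 * (∑ i, ∑ j, P i j * (D i f * D j f')) * φ := by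
  have e : ∑ i, ∑ j, (P i j + P j i) * (D i f *
      covD D (levi D a) (algebraMap 𝕜 R l) (f' * φ) j) = f' * ∑ i, ∑ j, (P i j + P j i) * (D i f *
      covD D (levi D a) (algebraMap 𝕜 R l) φ j) + 2 * (∑ i, ∑ j, P i j * (D i f * D j f')) * φ := by
    simp only [Finset.mul_sum, Finset.sum_mul, ← Finset.sum_add_distrib]
    refine Finset.sum_congr rfl fun i _ => Finset.sum_congr rfl fun j _ => ?_
    rw [covD_mul, hP j i]; ring
  rw [totR_comm (f := f), totR_comm (f := f), e]
  ring

/-- The change of `∇φ` contributes `-l n Υ`, that of the divergence `α n (1 - δ) Υ`; they cancel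
because `α (1 - δ) = l`. -/
lemma quant1_conf (h1 : m - l ≠ 1) (hF : F * F' = 1) (hg : ∀ i j, b.g i j = F * a.g i j)
    (hh : ∀ i j, b.h i j = F' * a.h i j) : quant1R D b l m V ρ φ = quant1R D a l m V ρ φ := by
  have hc := confChange_hlog (D := D) hF hg hh
  have r : l / (1 - (m - l)) * (1 - (m - l)) = l :=
    div_mul_cancel₀ _ (sub_ne_zero.2 (Ne.symm h1))
  have t := congrArg (algebraMap 𝕜 R) r
  rw [quant1R, hc.levi_conf]
  have e := divV_addA (D := D) (a := a) (Υ := hlog D F F') (Γ := levi D a)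
    (w := algebraMap 𝕜 R (m - l)) V
  rw [e, quant1R]
  have e2 : ∑ i, V i * covD D (addA a (hlog D F F') (levi D a)) (algebraMap 𝕜 R l) φ i =
      ∑ i, V i * covD D (levi D a) (algebraMap 𝕜 R l) φ i
      - algebraMap 𝕜 R l * n * φ * ∑ i, hlog D F F' i * V i := by
    rw [Finset.mul_sum, ← Finset.sum_sub_distrib]
    exact Finset.sum_congr rfl fun i _ => by rw [covD_addA]; ring
  rw [e2]
  rw [map_mul, map_sub (algebraMap 𝕜 R) 1, map_one] at t
  linear_combination (n * φ * ∑ i, hlog D F F' i * V i) * t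

namespace CoordChange

variable {D' : Fin n → Derivation 𝕜 R' R'} {T : CoordChange D D'} {a' : MetricPair n R'}
  {lam mu : R} {P' : Fin n → Fin n → R'} {V' : Fin n → R'}

lemma MetricRel.quant1R_eq (ha : T.MetricRel a a')
    (hl : T.IsWeight lam (algebraMap 𝕜 R (m - l))) (hm : T.IsWeight mu (algebraMap 𝕜 R l))
    (hV : ∀ k, ∑ i, T.J k i * V i = lam * T.τ (V' k)) {ρ' φ' : R'} (hρ : ρ = lam * T.τ ρ')
    (hφ : φ = mu * T.τ φ') :
    quant1R D a l m V ρ φ = lam * mu * T.τ (quant1R D' a' l m V' ρ' φ') := by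
  have h : T.ConnRel (levi D a) (levi D' a') := T.levi_rel ha
  have c : ∀ x : 𝕜, algebraMap 𝕜 R x = T.τ (algebraMap 𝕜 R' x) := fun x => (T.τ.commutes x).symm
  rw [c] at hl hm
  have e1 := contract_one hV (h.covD_eq hm hφ)
  have e2 := h.divV_eq hl hV
  rw [quant1R, c, c, c, e1, e2, hρ, hφ, quant1R]
  simp only [map_add, map_mul]
  ring

/-- The correction `X` enters only through its contraction with `P`, so `hX` concerns only this
contraction. -/
lemma MetricRel.totR_eq (ha : T.MetricRel a a')
    (hl : T.IsWeight lam (algebraMap 𝕜 R (m - l))) (hm : T.IsWeight mu (algebraMap 𝕜 R l))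
    (hP : ∀ k l, ∑ i, ∑ j, T.J k i * T.J l j * P i j = lam * T.τ (P' k l))
    (hV : ∀ k, ∑ i, T.J k i * V i = lam * T.τ (V' k)) {ρ' φ' : R'} (hρ : ρ = lam * T.τ ρ')
    (hφ : φ = mu * T.τ φ') {X' : Fin n → Fin n → R'}
    (hX : ∑ i, ∑ j, X i j * P i j = lam * T.τ (∑ i, ∑ j, X' i j * P' i j)) :
    totR D a l m b1 b2 b3 b4 X P V ρ φ =
      lam * mu * T.τ (totR D' a' l m b1 b2 b3 b4 X' P' V' ρ' φ') := by
  have c : ∀ x : 𝕜, algebraMap 𝕜 R x = T.τ (algebraMap 𝕜 R' x) := fun x => (T.τ.commutes x).symm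
  rw [totR, ha.quant1R_eq hl hm hV hρ hφ, hX]
  simp only [c] at hl hm ⊢
  rw [ha.quantR_eq hl hm hP hφ, totR, hφ]
  simp only [map_add, map_mul]
  ring

end CoordChange

end Total

/-! ### The Schwarzian derivative under projective changes of the coordinate -/

section OneDimensional

variable {𝕜 : Type*} [RCLike 𝕜] {R R' : Type*} [CommRing R] [Algebra 𝕜 R]
  [CommRing R'] [Algebra 𝕜 R'] {D : Fin 1 → Derivation 𝕜 R R} {D' : Fin 1 → Derivation 𝕜 R' R'}

/-- The Schwarzian derivative is invariant under projective changes of the coordinate. -/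
lemma CoordChange.schwOneR_eq (T : CoordChange D D') {v v' r : R} {u u' : R'} (hu : u * u' = 1)
    (hv : v * v' = 1) (hvJ : v * v = T.J 0 0 * T.J 0 0) (hr : (r * v) * (r * v) = 1)
    (hrr : 2 * r * D 0 (D 0 r) = D 0 r * D 0 r) (i j : Fin 1) :
    schwOneR D (v * T.τ u) (v' * T.τ u') i j =
      ∑ p, ∑ q, T.J p i * T.J q j * T.τ (schwOneR D' u u' p q) := by
  rw [Subsingleton.elim i 0, Subsingleton.elim j 0]
  have hτ : T.τ u * T.τ u' = 1 := by rw [← map_mul, hu, map_one]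
  have hvu : (v * T.τ u) * (v' * T.τ u') = 1 := by linear_combination hτ * v * v' + hv
  have h2 : algebraMap 𝕜 R (1 / 2) * 2 = 1 := by
    rw [← map_ofNat (algebraMap 𝕜 R) 2, ← map_mul]; norm_num
  have hJK : T.J 0 0 * T.K 0 0 = 1 := by simpa using T.J_mul_K 0 0
  set J := T.J 0 0 with hJ
  set K := T.K 0 0 with hK
  have half : ∀ x : R, 2 * x = 0 → x = 0 := fun x hx => by
    linear_combination (-x) * h2 + algebraMap 𝕜 R (1 / 2) * hx
  -- `r * v` squares to `1`, so its derivative vanishes: `v` is, up to a constant sign, the inverse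
  -- of `r`.
  have d0 : D 0 (r * v) = 0 := by
    have h1 := congrArg (D 0) hr
    simp only [Derivation.leibniz _ (r * v) (r * v), Derivation.map_one_eq_zero, smul_eq_mul] at h1
    have h3 : r * v * D 0 (r * v) = 0 := half _ (by linear_combination h1)
    linear_combination (r * v) * h3 - D 0 (r * v) * hr
  have d1 : r * D 0 v + v * D 0 r = 0 := by
    simpa [Derivation.leibniz] using d0
  have d2 : J * D 0 J = v * D 0 v := by
    have h1 := congrArg (D 0) hvJ
    simp only [Derivation.leibniz, smul_eq_mul] at h1
    rw [← sub_eq_zero]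
    exact half _ (by linear_combination -h1)
  -- `z` is the common logarithmic derivative of `v` and of the Jacobian `J`, whose squares agree.
  obtain ⟨z, hz⟩ : ∃ z, z = D 0 v * v' := ⟨_, rfl⟩
  have hzJ : D 0 J = z * J := by
    rw [hz]
    linear_combination (-D 0 J) * hJK + K * d2 + (-K * v * D 0 v) * hv
      + K * D 0 v * v' * hvJ + D 0 v * v' * J * hJK
  have hvz : D 0 v = z * v := by rw [hz]; linear_combination (-D 0 v) * hv
  have hrz : D 0 r = - z * r := by
    linear_combination v' * d1 - D 0 r * hv + r * hz
  -- This is the vanishing of the Schwarzian derivative of the coordinate change, a reformulation of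
  -- `2 r r'' = r'²` for `r = ± 1/v`.
  have hDz : D 0 z = algebraMap 𝕜 R (1 / 2) * (z * z) := by
    have h3 : D 0 (D 0 r) = - D 0 z * r + z * z * r := by
      have := congrArg (D 0) hrz
      simp only [Derivation.leibniz, smul_eq_mul, map_neg] at this
      rw [this, hrz]; ring
    rw [h3, hrz] at hrr
    have h4 : 2 * D 0 z = z * z := by
      have hrv2 : (r * r) * (v * v) = 1 := by linear_combination hr
      have h5 : (r * r) * (2 * D 0 z - z * z) = 0 := by linear_combination -hrr
      linear_combination v * v * h5 - (2 * D 0 z - z * z) * hrv2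
    linear_combination algebraMap 𝕜 R (1 / 2) * h4 - D 0 z * h2
  have hch : ∀ f, D 0 (T.τ f) = J * T.τ (D' 0 f) := fun f => by
    rw [T.chain]; simp [hJ]
  obtain ⟨x, hx⟩ : ∃ x, x = D' 0 u * u' := ⟨_, rfl⟩
  have hτx : T.τ x = T.τ (D' 0 u) * T.τ u' := by rw [hx, map_mul]
  have hy : D 0 (v * T.τ u) * (v' * T.τ u') = z + J * T.τ x := by
    rw [hτx, (D 0).leibniz, hch, hvz, smul_eq_mul, smul_eq_mul]
    linear_combination (J * T.τ (D' 0 u) * T.τ u' + z * (T.τ u * T.τ u')) * hv + z * hτ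
  have hDx : D 0 (J * T.τ x) = z * J * T.τ x + J * (J * T.τ (D' 0 x)) := by
    rw [(D 0).leibniz, hch, hzJ, smul_eq_mul, smul_eq_mul]; ring
  have hτs : T.τ (schwOneR D' u u' 0 0) =
      T.τ (D' 0 x) - algebraMap 𝕜 R (1 / 2) * (T.τ x * T.τ x) := by
    rw [ConfQuant.schwOneR_eq hu, ← hx, map_sub, map_mul, AlgHom.commutes]
    congr 2
    exact T.τ.map_mul x x
  rw [ConfQuant.schwOneR_eq hvu, hy, map_add, hDx, hDz]
  simp only [Finset.univ_unique, Finset.sum_singleton, Fin.default_eq_zero, hτs, ← hJ]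
  linear_combination (-z * J * T.τ x) * h2

end OneDimensional

/-! ### Smooth functions on an open set as a ring with derivations -/

section SmoothRing

variable {𝕜 : Type*} [RCLike 𝕜] {n : ℕ}

lemma pd_congr {V : Type*} [NormedAddCommGroup V] [NormedSpace ℝ V] {F F' : E n → V} {y : E n}
    (h : F =ᶠ[𝓝 y] F') (i : Fin n) : pd i F y = pd i F' y := by
  simp only [pd, h.fderiv_eq]

lemma contDiffOn_pd {V : Type*} [NormedAddCommGroup V] [NormedSpace ℝ V] {F : E n → V}
    {s : Set (E n)} (hs : IsOpen s) (hF : ContDiffOn ℝ ∞ F s) (i : Fin n) :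
    ContDiffOn ℝ ∞ (pd i F) s :=
  (hF.fderiv_of_isOpen hs (by simp)).clm_apply contDiffOn_const

lemma pd_comm {V : Type*} [NormedAddCommGroup V] [NormedSpace ℝ V] {F : E n → V}
    {y : E n} (hF : ContDiffAt ℝ ∞ F y) (i j : Fin n) :
    pd i (pd j F) y = pd j (pd i F) y := by
  have h1 : DifferentiableAt ℝ (fderiv ℝ F) y :=
    (hF.fderiv_right (m := ∞) le_rfl).differentiableAt (by simp)
  have e : ∀ i j : Fin n, pd i (pd j F) y = fderiv ℝ (fderiv ℝ F) y (e i) (e j) := fun i j => by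
    simp only [pd]
    change fderiv ℝ (fun x => fderiv ℝ F x (e j)) y (e i) = _
    rw [fderiv_clm_apply h1 (differentiableAt_const _)]
    simp
  rw [e, e]
  exact (hF.isSymmSndFDerivAt (by rw [minSmoothness_of_isRCLikeNormedField]; exact ENat.LEInfty.out)).eq _ _

variable (𝕜) in
/-- The ring of smooth functions on an open subset of the model space. -/
def smoothAlg (s : TopologicalSpace.Opens (E n)) : Subalgebra 𝕜 (s → 𝕜) where
  carrier := {f | ∃ F : E n → 𝕜, ContDiffOn ℝ ∞ F s ∧ ∀ y : s, f y = F y}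
  mul_mem' := by
    rintro f f' ⟨F, hF, h⟩ ⟨F', hF', h'⟩
    exact ⟨fun y => F y * F' y, hF.mul hF', fun y => by simp [h, h']⟩
  add_mem' := by
    rintro f f' ⟨F, hF, h⟩ ⟨F', hF', h'⟩
    exact ⟨fun y => F y + F' y, hF.add hF', fun y => by simp [h, h']⟩
  algebraMap_mem' c := ⟨fun _ => c, contDiffOn_const, fun y => rfl⟩

variable {s : TopologicalSpace.Opens (E n)}

/-- Evaluation at a point. -/
def ev (y : s) : smoothAlg 𝕜 s →ₐ[𝕜] 𝕜 := (Pi.evalAlgHom 𝕜 (fun _ => 𝕜) y).comp (smoothAlg 𝕜 s).val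

lemma smoothAlg_ext {f f' : smoothAlg 𝕜 s} (h : ∀ y, ev y f = ev y f') : f = f' :=
  Subtype.ext (funext h)

/-- `f` is the restriction of `F`. -/
def Rep (F : E n → 𝕜) (f : smoothAlg 𝕜 s) : Prop := ∀ y (hy : y ∈ s), F y = ev ⟨y, hy⟩ f

lemma exists_rep (f : smoothAlg 𝕜 s) : ∃ F : E n → 𝕜, ContDiffOn ℝ ∞ F s ∧ Rep F f := by
  obtain ⟨F, hF, h⟩ := f.2
  exact ⟨F, hF, fun y hy => (h ⟨y, hy⟩).symm⟩

/-- The restriction of a function that is smooth on `s`. -/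
def restr (F : E n → 𝕜) (hF : ContDiffOn ℝ ∞ F s) : smoothAlg 𝕜 s := ⟨fun y => F y, F, hF, fun _ => rfl⟩

lemma rep_restr {F : E n → 𝕜} (hF : ContDiffOn ℝ ∞ F s) : Rep F (restr F hF) := fun _ _ => rfl

lemma Rep.unique {F : E n → 𝕜} {f f' : smoothAlg 𝕜 s} (h : Rep F f) (h' : Rep F f') : f = f' :=
  smoothAlg_ext fun y => (h y y.2).symm.trans (h' y y.2)

lemma Rep.eqOn {F F' : E n → 𝕜} {f : smoothAlg 𝕜 s} (h : Rep F f) (h' : Rep F' f) :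
    Set.EqOn F F' s := fun y hy => (h y hy).trans (h' y hy).symm

lemma Rep.congr {F F' : E n → 𝕜} {f : smoothAlg 𝕜 s} (h : Rep F f) (h' : ∀ y ∈ s, F' y = F y) :
    Rep F' f := fun y hy => (h' y hy).trans (h y hy)

lemma Rep.contDiffOn {F : E n → 𝕜} {f : smoothAlg 𝕜 s} (h : Rep F f) : ContDiffOn ℝ ∞ F s := by
  obtain ⟨F', hF', h'⟩ := exists_rep f
  exact hF'.congr (h.eqOn h')

lemma pd_eqOn {F F' : E n → 𝕜} (h : Set.EqOn F F' s) (i : Fin n) {y : E n} (hy : y ∈ s) :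
    pd i F y = pd i F' y :=
  pd_congr (Filter.eventuallyEq_of_mem (s.isOpen.mem_nhds hy) h) i

lemma Rep.differentiableAt {F : E n → 𝕜} {f : smoothAlg 𝕜 s} (h : Rep F f) {y : E n} (hy : y ∈ s) :
    DifferentiableAt ℝ F y :=
  (h.contDiffOn.contDiffAt (s.isOpen.mem_nhds hy)).differentiableAt (by simp)

/-- The partial derivative of a smooth function on an open set. -/
def derFun (i : Fin n) (f : smoothAlg 𝕜 s) : smoothAlg 𝕜 s :=
  restr (pd i (exists_rep f).choose) (contDiffOn_pd s.isOpen (exists_rep f).choose_spec.1 i)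

/-- `derFun` differentiates a chosen extension. Since `s` is open, any two functions agreeing on `s`
have the same derivatives there. -/
lemma Rep.derFun {F : E n → 𝕜} {f : smoothAlg 𝕜 s} (h : Rep F f) (i : Fin n) :
    Rep (ConfQuant.pd i F) (derFun i f) := by
  intro y hy
  obtain ⟨-, h'⟩ := (exists_rep f).choose_spec
  exact pd_eqOn (h.eqOn h') i hy

lemma Rep.add {F F' : E n → 𝕜} {f f' : smoothAlg 𝕜 s} (h : Rep F f) (h' : Rep F' f') :
    Rep (fun y => F y + F' y) (f + f') := fun y hy => by simp only [map_add, h y hy, h' y hy]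

lemma Rep.mul {F F' : E n → 𝕜} {f f' : smoothAlg 𝕜 s} (h : Rep F f) (h' : Rep F' f') :
    Rep (fun y => F y * F' y) (f * f') := fun y hy => by simp only [map_mul, h y hy, h' y hy]

lemma rep_const (c : 𝕜) : Rep (s := s) (fun _ => c) (algebraMap 𝕜 _ c) := fun y hy => by
  simp

lemma derFun_mul (i : Fin n) (f f' : smoothAlg 𝕜 s) :
    derFun i (f * f') = f * derFun i f' + f' * derFun i f := by
  obtain ⟨F, hF, h⟩ := exists_rep f
  obtain ⟨F', hF', h'⟩ := exists_rep f'
  refine smoothAlg_ext fun y => ?_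
  rw [← ((h.mul h').derFun i) y y.2]
  simp only [map_add, map_mul, ← h y y.2, ← h' y y.2, ← h.derFun i y y.2, ← h'.derFun i y y.2, pd,
    fderiv_fun_mul (h.differentiableAt y.2) (h'.differentiableAt y.2), add_apply, smul_apply,
    smul_eq_mul]

lemma derFun_const (i : Fin n) (c : 𝕜) : derFun i (algebraMap 𝕜 (smoothAlg 𝕜 s) c) = 0 :=
  smoothAlg_ext fun y => by
    rw [← (rep_const c).derFun i y y.2, map_zero]
    simp [pd]

variable (𝕜 s) in
/-- The partial derivatives on the ring of smooth functions. -/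
def der (i : Fin n) : Derivation 𝕜 (smoothAlg 𝕜 s) (smoothAlg 𝕜 s) :=
  Derivation.mk'
    { toFun := derFun i
      map_add' := fun f f' => by
        obtain ⟨F, hF, h⟩ := exists_rep f
        obtain ⟨F', hF', h'⟩ := exists_rep f'
        refine smoothAlg_ext fun y => ?_
        rw [← ((h.add h').derFun i) y y.2]
        simp only [map_add, ← h.derFun i y y.2, ← h'.derFun i y y.2, pd,
          fderiv_fun_add (h.differentiableAt y.2) (h'.differentiableAt y.2), add_apply]
      map_smul' := fun c f => by
        rw [Algebra.smul_def, derFun_mul, derFun_const, mul_zero, add_zero, RingHom.id_apply,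
          Algebra.smul_def] }
    fun f f' => derFun_mul i f f'

lemma Rep.pd {F : E n → 𝕜} {f : smoothAlg 𝕜 s} (h : Rep F f) (i : Fin n) :
    Rep (pd i F) (der 𝕜 s i f) := h.derFun i

lemma der_comm (i j : Fin n) (f : smoothAlg 𝕜 s) : der 𝕜 s i (der 𝕜 s j f) = der 𝕜 s j (der 𝕜 s i f) := by
  obtain ⟨F, hF, h⟩ := exists_rep f
  refine smoothAlg_ext fun y => ?_
  rw [← ((h.pd j).pd i) y y.2, ← ((h.pd i).pd j) y y.2]
  exact pd_comm (hF.contDiffAt (s.isOpen.mem_nhds y.2)) i j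

lemma Rep.inv_mul {F F' : E n → 𝕜} {f f' : smoothAlg 𝕜 s} (h : Rep F f) (h' : Rep F' f')
    (hF : ∀ y ∈ s, F y * F' y = 1) : f * f' = 1 :=
  smoothAlg_ext fun y => by rw [map_mul, map_one, ← h y y.2, ← h' y y.2, hF y y.2]

lemma contDiffOn_det {G : E n → Matrix (Fin n) (Fin n) 𝕜} {t : Set (E n)}
    (hG : ∀ i j, ContDiffOn ℝ ∞ (fun y => G y i j) t) : ContDiffOn ℝ ∞ (fun y => (G y).det) t := by
  simp only [Matrix.det_apply']
  exact ContDiffOn.sum fun σ _ => contDiffOn_const.mul (contDiffOn_prod fun i _ => hG _ _)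

/-- Cramer's rule: an entry of the inverse is a quotient of determinants, which are polynomials in
the entries. -/
lemma contDiffOn_inv {G : E n → Matrix (Fin n) (Fin n) 𝕜} {t : Set (E n)}
    (hG : ∀ i j, ContDiffOn ℝ ∞ (fun y => G y i j) t) (hd : ∀ y ∈ t, (G y).det ≠ 0) (i j : Fin n) :
    ContDiffOn ℝ ∞ (fun y => (G y)⁻¹ i j) t := by
  have h : ∀ y, (G y)⁻¹ i j = ((G y).det)⁻¹ * ((G y).updateRow j (Pi.single i 1)).det := fun y => by
    rw [Matrix.inv_def, Matrix.smul_apply, Matrix.adjugate_apply, Ring.inverse_eq_inv', smul_eq_mul]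
  simp only [h]
  refine ((contDiffOn_det hG).inv hd).mul (contDiffOn_det fun p q => ?_)
  by_cases hp : p = j
  · subst hp
    simp only [Matrix.updateRow_self]
    exact contDiffOn_const
  · simp only [Matrix.updateRow_ne hp]
    exact hG p q

/-- The metric with the components `G`. -/
def pair (G : E n → Matrix (Fin n) (Fin n) 𝕜) (hG : ∀ i j, ContDiffOn ℝ ∞ (fun y => G y i j) s)
    (hs : ∀ y ∈ s, (G y).IsSymm) (hd : ∀ y ∈ s, (G y).det ≠ 0) : MetricPair n (smoothAlg 𝕜 s) where
  g i j := restr (fun y => G y i j) (hG i j)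
  h i j := restr (fun y => (G y)⁻¹ i j) (contDiffOn_inv hG hd i j)
  g_symm i j := smoothAlg_ext fun y => (hs y y.2).apply j i
  h_symm i j := smoothAlg_ext fun y => ((hs y y.2).inv).apply j i
  g_mul_h i j := smoothAlg_ext fun y => by
    have := congrFun (congrFun (Matrix.mul_nonsing_inv (G y) (isUnit_iff_ne_zero.2 (hd y y.2))) i) j
    rw [Matrix.mul_apply, Matrix.one_apply] at this
    simp only [map_sum, map_mul, apply_ite (ev y), map_one, map_zero]
    exact this

/-- The metric `a` has the components `G`. -/
structure RepMetric (G : E n → Matrix (Fin n) (Fin n) 𝕜) (a : MetricPair n (smoothAlg 𝕜 s)) :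
    Prop where
  g : ∀ i j, Rep (fun y => G y i j) (a.g i j)
  h : ∀ i j, Rep (fun y => (G y)⁻¹ i j) (a.h i j)

variable {G : E n → Matrix (Fin n) (Fin n) 𝕜} {a : MetricPair n (smoothAlg 𝕜 s)}

lemma repMetric_pair (hG : ∀ i j, ContDiffOn ℝ ∞ (fun y => G y i j) s)
    (hs : ∀ y ∈ s, (G y).IsSymm) (hd : ∀ y ∈ s, (G y).det ≠ 0) : RepMetric G (pair G hG hs hd) :=
  ⟨fun i j => rep_restr (hG i j), fun i j => rep_restr (contDiffOn_inv hG hd i j)⟩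

lemma Rep.chris (ha : RepMetric G a) (k i j : Fin n) :
    Rep (chris G k i j) (levi (der 𝕜 s) a k i j) := fun y hy => by
  simp only [ConfQuant.chris, levi, map_mul, map_sum, map_add, map_sub, AlgHom.commutes,
    Algebra.algebraMap_self, RingHom.id_apply, ha.h _ _ y hy, ((ha.g _ _).pd _) y hy]

lemma Rep.chris1 (ha : RepMetric G a) (i : Fin n) :
    Rep (chris1 G i) (ctr (levi (der 𝕜 s) a) i) := fun y hy => by
  simp only [ConfQuant.chris1, ctr, map_sum, Rep.chris ha _ _ _ y hy]

lemma Rep.ricci (ha : RepMetric G a) (i j : Fin n) :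
    Rep (ricci G i j) (ricc (der 𝕜 s) (levi (der 𝕜 s) a) i j) := fun y hy => by
  simp only [ConfQuant.ricci, ricc, map_mul, map_sum, map_add, map_sub,
    Rep.chris ha _ _ _ y hy, ((Rep.chris ha _ _ _).pd _) y hy]

lemma Rep.scal (ha : RepMetric G a) :
    Rep (scal G) (scalR (der 𝕜 s) (levi (der 𝕜 s) a) a) := fun y hy => by
  simp only [ConfQuant.scal, scalR, map_mul, map_sum, Rep.ricci ha _ _ y hy, ha.h _ _ y hy]

variable {φ : E n → 𝕜} {f : smoothAlg 𝕜 s} {w : 𝕜}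

lemma Rep.nablaD (ha : RepMetric G a) (hφ : Rep φ f) (j : Fin n) :
    Rep (nablaD G w φ j) (covD (der 𝕜 s) (levi (der 𝕜 s) a) (algebraMap 𝕜 _ w) f j) :=
  fun y hy => by
  simp only [ConfQuant.nablaD, covD, map_mul, map_sub, AlgHom.commutes, Algebra.algebraMap_self,
    RingHom.id_apply, Rep.chris1 ha _ y hy, hφ y hy, (hφ.pd _) y hy]

lemma Rep.nabla2D (ha : RepMetric G a) (hφ : Rep φ f) (i j : Fin n) :
    Rep (nabla2D G w φ i j) (covH (der 𝕜 s) (levi (der 𝕜 s) a) (algebraMap 𝕜 _ w) f i j) :=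
  fun y hy => by
  simp only [ConfQuant.nabla2D, covH, map_mul, map_sub, map_sum, AlgHom.commutes,
    Algebra.algebraMap_self, RingHom.id_apply, Rep.chris1 ha _ y hy, Rep.chris ha _ _ _ y hy,
    Rep.nablaD ha hφ _ y hy, ((Rep.nablaD ha hφ _).pd _) y hy]

variable {V : E n → Fin n → 𝕜} {v : Fin n → smoothAlg 𝕜 s} {P : E n → Fin n → Fin n → 𝕜}
  {p : Fin n → Fin n → smoothAlg 𝕜 s} {ρ : E n → 𝕜} {r : smoothAlg 𝕜 s} {l m : 𝕜}

lemma Rep.sum_nablaV (ha : RepMetric G a) (hV : ∀ i, Rep (fun y => V y i) (v i)) :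
    Rep (fun y => ∑ i, nablaV G w V i i y)
      (divV (der 𝕜 s) (levi (der 𝕜 s) a) (algebraMap 𝕜 _ w) v) := fun y hy => by
  rw [← sum_covV (levi_symm a)]
  simp only [ConfQuant.nablaV, map_mul, map_sub, map_add, map_sum, AlgHom.commutes,
    Algebra.algebraMap_self, RingHom.id_apply, Rep.chris1 ha _ y hy, Rep.chris ha _ _ _ y hy,
    hV _ y hy, ((hV _).pd _) y hy]

lemma Rep.nablaT (ha : RepMetric G a) (hP : ∀ i j, Rep (fun y => P y i j) (p i j)) (j k q : Fin n) :
    Rep (nablaT G w P j k q)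
      (covT (der 𝕜 s) (levi (der 𝕜 s) a) (algebraMap 𝕜 _ w) p j k q) := fun y hy => by
  simp only [ConfQuant.nablaT, covT, map_mul, map_sub, map_add, map_sum, AlgHom.commutes,
    Algebra.algebraMap_self, RingHom.id_apply, Rep.chris1 ha _ y hy, Rep.chris ha _ _ _ y hy,
    hP _ _ y hy, ((hP _ _).pd _) y hy]

lemma Rep.nabla2T (ha : RepMetric G a) (hP : ∀ i j, Rep (fun y => P y i j) (p i j))
    (i j k q : Fin n) :
    Rep (nabla2T G w P i j k q)
      (covT2 (der 𝕜 s) (levi (der 𝕜 s) a) (algebraMap 𝕜 _ w) p i j k q) := fun y hy => by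
  simp only [ConfQuant.nabla2T, covT2, map_mul, map_sub, map_add, map_sum, AlgHom.commutes,
    Algebra.algebraMap_self, RingHom.id_apply, Rep.chris1 ha _ y hy, Rep.chris ha _ _ _ y hy,
    Rep.nablaT ha hP _ _ _ y hy, ((Rep.nablaT ha hP _ _ _).pd _) y hy]

lemma Rep.quant1 (ha : RepMetric G a) (hV : ∀ i, Rep (fun y => V y i) (v i)) (hρ : Rep ρ r)
    (hφ : Rep φ f) :
    Rep (quant1 G l m V ρ φ) (quant1R (der 𝕜 s) a l m v r f) := fun y hy => by
  simp only [ConfQuant.quant1, quant1R, map_mul, map_add, map_sum, AlgHom.commutes,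
    Algebra.algebraMap_self, RingHom.id_apply, ← Rep.sum_nablaV ha hV y hy,
    Rep.nablaD ha hφ _ y hy, hV _ y hy, hρ y hy, hφ y hy]

/-- The formula for second order symbols without the curvature terms, for arbitrary coefficients. -/
def quantGen (G : E n → Matrix (Fin n) (Fin n) 𝕜) (l m b1 b2 b3 b4 : 𝕜)
    (P : E n → Fin n → Fin n → 𝕜) (φ : E n → 𝕜) (x : E n) : 𝕜 :=
  ∑ i, ∑ j, P x i j * ConfQuant.nabla2D G l φ i j x
    + ∑ j, (b1 * ∑ i, ConfQuant.nablaT G (m - l) P i i j x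
        + b2 * ∑ i, ∑ k, ∑ q, (G x)⁻¹ i j * G x k q * ConfQuant.nablaT G (m - l) P i k q x)
      * ConfQuant.nablaD G l φ j x
    + (b3 * ∑ i, ∑ j, ConfQuant.nabla2T G (m - l) P i j i j x
        + b4 * ∑ i, ∑ j, ∑ k, ∑ q,
            (G x)⁻¹ i j * G x k q * ConfQuant.nabla2T G (m - l) P i j k q x) * φ x

variable {b1 b2 b3 b4 : 𝕜}

/-- The bridge from the coordinate formula, with its sums of covariant derivatives, to `quantR`,
which uses divergences and derivatives of the trace. The symmetry `hp` is needed for the double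
divergence. -/
lemma Rep.quantGen (ha : RepMetric G a) (hP : ∀ i j, Rep (fun y => P y i j) (p i j))
    (hp : ∀ i j, p i j = p j i) (hφ : Rep φ f) :
    Rep (quantGen G l m b1 b2 b3 b4 P φ) (quantR (der 𝕜 s) (levi (der 𝕜 s) a) a (algebraMap 𝕜 _ l)
      (algebraMap 𝕜 _ (m - l)) (algebraMap 𝕜 _ b1) (algebraMap 𝕜 _ b2) (algebraMap 𝕜 _ b3)
      (algebraMap 𝕜 _ b4) p f) := fun y hy => by
  have h1 : ∀ j, ∑ i, ConfQuant.nablaT G (m - l) P i i j y = ev ⟨y, hy⟩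
      (divT (der 𝕜 s) (levi (der 𝕜 s) a) (algebraMap 𝕜 _ (m - l)) p j) := fun j => by
    simp only [← sum_covT (levi_symm a), map_sum, Rep.nablaT ha hP _ _ _ y hy]
  have h2 : ∑ i, ∑ j, ConfQuant.nabla2T G (m - l) P i j i j y = ev ⟨y, hy⟩
      (divV (der 𝕜 s) (levi (der 𝕜 s) a) (algebraMap 𝕜 _ (m - l))
        (divT (der 𝕜 s) (levi (der 𝕜 s) a) (algebraMap 𝕜 _ (m - l)) p)) := by
    simp only [← sum_covT2 (levi_symm a) hp, map_sum, Rep.nabla2T ha hP _ _ _ _ y hy]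
  have h3 : ∀ j, ∑ i, ∑ k, ∑ q, (G y)⁻¹ i j * G y k q * ConfQuant.nablaT G (m - l) P i k q y =
      ev ⟨y, hy⟩ (grad (der 𝕜 s) (levi (der 𝕜 s) a) a (algebraMap 𝕜 _ (m - l)) (gtr a p) j) :=
    fun j => by
    simp only [grad, gtr, ← sum_g_covT (levi_compat a), map_mul, map_sum, Rep.nablaT ha hP _ _ _ y hy,
      ha.g _ _ y hy, ha.h _ _ y hy, Finset.mul_sum, mul_assoc]
  have h4 : ∑ i, ∑ j, ∑ k, ∑ q, (G y)⁻¹ i j * G y k q * ConfQuant.nabla2T G (m - l) P i j k q y =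
      ev ⟨y, hy⟩ (lapl (der 𝕜 s) (levi (der 𝕜 s) a) a (algebraMap 𝕜 _ (m - l)) (gtr a p)) := by
    simp only [lapl, gtr, ← sum_g_covT2 (levi_compat a), map_mul, map_sum,
      Rep.nabla2T ha hP _ _ _ _ y hy, ha.g _ _ y hy, ha.h _ _ y hy, Finset.mul_sum, mul_assoc]
  simp only [ConfQuant.quantGen, quantR, h1, h2, h3, h4, map_mul, map_add, map_sum,
    AlgHom.commutes, Algebra.algebraMap_self, RingHom.id_apply, Rep.nablaD ha hφ _ y hy,
    Rep.nabla2D ha hφ _ _ y hy, hP _ _ y hy, hφ y hy]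

lemma Rep.quant2 (ha : RepMetric G a) (hP : ∀ i j, Rep (fun y => P y i j) (p i j))
    (hp : ∀ i j, p i j = p j i) (hφ : Rep φ f) :
    Rep (quant2 G l m P φ) (quantE (der 𝕜 s) a l m p f) := Rep.quantGen ha hP hp hφ

/-- The quantization formula with arbitrary coefficients and curvature term. -/
def total (G : E n → Matrix (Fin n) (Fin n) 𝕜) (l m b1 b2 b3 b4 : 𝕜) (X P : E n → Fin n → Fin n → 𝕜)
    (V : E n → Fin n → 𝕜) (ρ φ : E n → 𝕜) (x : E n) : 𝕜 :=
  quantGen G l m b1 b2 b3 b4 P φ x + (∑ i, ∑ j, X x i j * P x i j) * φ x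
    + ConfQuant.quant1 G l m V ρ φ x

lemma Rep.total {X : E n → Fin n → Fin n → 𝕜} {x : Fin n → Fin n → smoothAlg 𝕜 s}
    (ha : RepMetric G a) (hX : ∀ i j, Rep (fun y => X y i j) (x i j))
    (hP : ∀ i j, Rep (fun y => P y i j) (p i j))
    (hp : ∀ i j, p i j = p j i) (hV : ∀ i, Rep (fun y => V y i) (v i)) (hρ : Rep ρ r)
    (hφ : Rep φ f) :
    Rep (total G l m b1 b2 b3 b4 X P V ρ φ) (totR (der 𝕜 s) a l m b1 b2 b3 b4 x p v r f) :=
  fun y hy => by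
  simp only [ConfQuant.total, totR, map_add, map_mul, map_sum, ← Rep.quantGen ha hP hp hφ y hy,
    ← Rep.quant1 ha hV hρ hφ y hy, hX _ _ y hy, hP _ _ y hy, hφ y hy]

lemma Rep.curvTerm (ha : RepMetric G a) (hP : ∀ i j, Rep (fun y => P y i j) (p i j)) :
    Rep (curvTerm G l m P) (curvR (der 𝕜 s) (levi (der 𝕜 s) a) a (algebraMap 𝕜 _ (beta5 n l m))
      (algebraMap 𝕜 _ (beta6 n l m)) p) := fun y hy => by
  simp only [ConfQuant.curvTerm, curvR, gtr, map_mul, map_add, map_sum, AlgHom.commutes,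
    Algebra.algebraMap_self, RingHom.id_apply, Rep.ricci ha _ _ y hy, Rep.scal ha y hy,
    hP _ _ y hy, ha.g _ _ y hy]

/-- At a point the formal inverse `x'` takes the value `(F y)⁻¹`, so the divisions of the coordinate
formula become products in the ring. -/
lemma Rep.schwarz {F : E n → 𝕜} {x x' : smoothAlg 𝕜 s} (ha : RepMetric G a) (hx : Rep F x)
    (hxx : x * x' = 1) (i j : Fin n) :
    Rep (schwarz G F i j) (schwR (der 𝕜 s) (levi (der 𝕜 s) a) a x x' i j) := fun y hy => by
  have e : ev ⟨y, hy⟩ x' = (F y)⁻¹ := by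
    refine eq_inv_of_mul_eq_one_right ?_
    rw [hx y hy, ← map_mul, hxx, map_one]
  have hh : ConfQuant.hess G F i j y =
      ev ⟨y, hy⟩ (covH (der 𝕜 s) (levi (der 𝕜 s) a) 0 x i j) := by
    simp only [ConfQuant.hess, covH, covD, zero_mul, sub_zero, map_mul, map_sub, map_sum,
      Rep.chris ha _ _ _ y hy, (hx.pd _) y hy, ((hx.pd _).pd _) y hy]
  simp only [ConfQuant.schwarz, schwR, hh, map_mul, map_add, map_sub, map_neg, map_sum, map_pow,
    AlgHom.commutes, Algebra.algebraMap_self, RingHom.id_apply, (hx.pd _) y hy, e, ha.g _ _ y hy,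
    ha.h _ _ y hy, mul_assoc]
  ring

lemma Rep.schwarzTerm {H : E n → Matrix (Fin n) (Fin n) 𝕜} {x x' : smoothAlg 𝕜 s}
    (ha : RepMetric G a) (hx : Rep (confFactor G H) x)
    (hxx : x * x' = 1) (hP : ∀ i j, Rep (fun y => P y i j) (p i j)) :
    Rep (schwarzTerm G H l m P) (schwTermR (der 𝕜 s) (levi (der 𝕜 s) a) a x x'
      (algebraMap 𝕜 _ (4 * l * (m - 1) / (2 * (m - l) - 3)))
      (algebraMap 𝕜 _ (1 / (8 * ((m - l) - 1)))) p) := fun y hy => by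
  simp only [ConfQuant.schwarzTerm, schwTermR, gtr, map_mul, map_add, map_sum, AlgHom.commutes,
    Algebra.algebraMap_self, RingHom.id_apply, Rep.schwarz ha hx hxx _ _ y hy, Rep.scal ha y hy,
    hP _ _ y hy, ha.g _ _ y hy]

lemma Rep.quantOne {G : E 1 → Matrix (Fin 1) (Fin 1) 𝕜} {s : TopologicalSpace.Opens (E 1)}
    {a : MetricPair 1 (smoothAlg 𝕜 s)} {u φ : E 1 → 𝕜} {P : E 1 → Fin 1 → Fin 1 → 𝕜}
    {x x' f : smoothAlg 𝕜 s} {p : Fin 1 → Fin 1 → smoothAlg 𝕜 s}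
    (ha : RepMetric G a) (hx : Rep u x) (hxx : x * x' = 1)
    (hP : ∀ i j, Rep (fun y => P y i j) (p i j)) (hφ : Rep φ f) :
    Rep (quantOne G u l m P φ) (quantOneR (der 𝕜 s) a l m x x' p f) := fun y hy => by
  have e : ev ⟨y, hy⟩ x' = (u y)⁻¹ := by
    refine eq_inv_of_mul_eq_one_right ?_
    rw [hx y hy, ← map_mul, hxx, map_one]
  have hp : ∀ i j, p i j = p j i := fun i j => by rw [Subsingleton.elim i j]
  have h1 : ∀ j, ∑ i, ConfQuant.nablaT G (m - l) P i i j y = ev ⟨y, hy⟩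
      (divT (der 𝕜 s) (levi (der 𝕜 s) a) (algebraMap 𝕜 _ (m - l)) p j) := fun j => by
    simp only [← sum_covT (levi_symm a), map_sum, Rep.nablaT ha hP _ _ _ y hy]
  have h2 : ∑ i, ∑ j, ConfQuant.nabla2T G (m - l) P i j i j y = ev ⟨y, hy⟩
      (divV (der 𝕜 s) (levi (der 𝕜 s) a) (algebraMap 𝕜 _ (m - l))
        (divT (der 𝕜 s) (levi (der 𝕜 s) a) (algebraMap 𝕜 _ (m - l)) p)) := by
    simp only [← sum_covT2 (levi_symm a) hp, map_sum, Rep.nabla2T ha hP _ _ _ _ y hy]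
  simp only [ConfQuant.quantOne, h2]
  rw [Finset.sum_comm (f := fun i j => ConfQuant.nablaT G (m - l) P i i j y *
    ConfQuant.nablaD G l φ j y)]
  simp only [← Finset.sum_mul, h1]
  simp only [quantOneR, quantEOne, quantR, schwarz1, schwOneR, map_mul, map_add, map_sub, map_sum,
    AlgHom.commutes, Algebra.algebraMap_self, RingHom.id_apply, Rep.nablaD ha hφ _ y hy,
    Rep.nabla2D ha hφ _ _ y hy, hP _ _ y hy, hφ y hy, e, (hx.pd _) y hy, ((hx.pd _).pd _) y hy,
    div_eq_mul_inv, zero_mul, add_zero, mul_assoc, ← Finset.mul_sum]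

end SmoothRing

/-! ### Jacobi's formula for the derivative of a determinant -/

section Jacobi

variable {𝕜 : Type*} [CommRing 𝕜] {R : Type*} [CommRing R] [Algebra 𝕜 R]

/-- A derivation, as a ring homomorphism to the dual numbers. -/
def dualHom (d : Derivation 𝕜 R R) : R →+* DualNumber R where
  toFun r := TrivSqZeroExt.inl r + TrivSqZeroExt.inr (d r)
  map_one' := by ext <;> simp
  map_zero' := by ext <;> simp
  map_add' x y := by ext <;> simp
  map_mul' x y := by ext <;> simp [mul_comm]

/-- Jacobi's formula. -/
lemma der_det {n : ℕ} (d : Derivation 𝕜 R R) (M N : Matrix (Fin n) (Fin n) R) (h : M * N = 1) :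
    d M.det = M.det * (N * M.map d).trace := by
  -- Over the dual numbers `M + ε dM = M (1 + ε N dM)`, and `det (1 + ε A) = 1 + ε tr A` because `ε²
  -- = 0`. Comparing the `ε`-parts of the determinants gives the formula.
  have e : M.map (dualHom d) = (M.map (TrivSqZeroExt.inlHom R R)) *
      (1 + (DualNumber.eps : DualNumber R) • ((N * M.map d).map (TrivSqZeroExt.inlHom R R))) := by
    rw [mul_add, mul_one, Matrix.mul_smul, ← Matrix.map_mul, ← mul_assoc, h, one_mul]
    ext i j
    · simp [dualHom]
    · simp [dualHom]
  have h1 : (M.map (dualHom d)).det = dualHom d M.det := (RingHom.map_det _ _).symm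
  have h2 : (M.map (TrivSqZeroExt.inlHom R R)).det = TrivSqZeroExt.inlHom R R M.det :=
    (RingHom.map_det _ _).symm
  have h3 : ((N * M.map d).map (TrivSqZeroExt.inlHom R R)).trace =
      TrivSqZeroExt.inlHom R R (N * M.map d).trace := (AddMonoidHom.map_trace
        (TrivSqZeroExt.inlHom R R) _).symm
  have h4 := congrArg TrivSqZeroExt.snd (congrArg Matrix.det e)
  rw [Matrix.det_mul, Matrix.det_one_add_smul, h1, h2, h3, pow_two, DualNumber.eps_mul_eps] at h4
  simpa [dualHom] using h4

end Jacobi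

/-! ### Smoothness and derivative of `|d|^w` -/

section AbsPow

variable {𝕜 : Type*} [RCLike 𝕜] {n : ℕ}

lemma absPow_add (d : ℝ) (w w' : 𝕜) : absPow d (w + w') = absPow d w * absPow d w' := by
  rw [absPow, absPow, absPow, ← NormedSpace.exp_add, mul_add]

lemma contDiffOn_ofReal {V : Type*} [NormedAddCommGroup V] [NormedSpace ℝ V] {F : V → ℝ} {t : Set V}
    (h : ContDiffOn ℝ ∞ F t) : ContDiffOn ℝ ∞ (fun y => (F y : 𝕜)) t :=
  (RCLike.ofRealCLM (K := 𝕜)).contDiff.comp_contDiffOn h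

lemma pd_ofReal {F : E n → ℝ} {y : E n} (h : DifferentiableAt ℝ F y) (i : Fin n) :
    pd i (fun z => (F z : 𝕜)) y = ((pd i F y : ℝ) : 𝕜) := by
  have := ((RCLike.ofRealCLM (K := 𝕜)).hasFDerivAt.comp y h.hasFDerivAt).fderiv
  simp only [pd]
  change fderiv ℝ (RCLike.ofRealCLM (K := 𝕜) ∘ F) y _ = _
  rw [this]
  simp

lemma contDiffOn_absPow {F : E n → ℝ} {t : Set (E n)} (h : ContDiffOn ℝ ∞ F t)
    (h0 : ∀ y ∈ t, F y ≠ 0) (w : 𝕜) : ContDiffOn ℝ ∞ (fun y => absPow (F y) w) t := by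
  have e : ContDiff ℝ ∞ (NormedSpace.exp : 𝕜 → 𝕜) :=
    contDiff_iff_contDiffAt.2 fun x => (NormedSpace.exp_analytic (𝕂 := ℝ) x).contDiffAt
  exact e.comp_contDiffOn ((contDiffOn_ofReal (h.log h0)).mul contDiffOn_const)

lemma pd_absPow {F : E n → ℝ} {y : E n} (h : DifferentiableAt ℝ F y) (h0 : F y ≠ 0) (w : 𝕜)
    (i : Fin n) :
    pd i (fun z => absPow (F z) w) y = w * ((pd i F y / F y : ℝ) : 𝕜) * absPow (F y) w := by
  have h1 : HasFDerivAt (fun z => Real.log (F z)) ((F y)⁻¹ • fderiv ℝ F y) y :=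
    h.hasFDerivAt.log h0
  have h2 := ((RCLike.ofRealCLM (K := 𝕜)).hasFDerivAt.comp y h1).mul_const w
  have h3 := (hasFDerivAt_exp (𝕂 := ℝ)).comp y h2
  have h4 := h3.fderiv
  simp only [pd]
  change fderiv ℝ (NormedSpace.exp ∘ fun z => (RCLike.ofRealCLM (K := 𝕜) ∘
    fun z => Real.log (F z)) z * w) y _ = _
  rw [h4]
  simp [absPow, RCLike.real_smul_eq_coe_mul, div_eq_inv_mul]
  ring

end AbsPow

/-! ### Transition maps as changes of coordinates between smooth rings -/

section Charts

variable {𝕜 : Type*} [RCLike 𝕜] {n : ℕ} {M : Type*} [TopologicalSpace M] [ChartedSpace (E n) M]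
  [IsManifold (𝓡 n) ∞ M]

lemma isOpen_overlap (c d : Chart n M) : IsOpen (overlap c d) :=
  (c.1.symm.trans d.1).open_source

lemma trans_mem {c d : Chart n M} {y : E n} (hy : y ∈ overlap c d) : trans c d y ∈ overlap d c := by
  refine ⟨d.1.map_source hy.2, ?_⟩
  simp only [trans, d.1.left_inv hy.2]
  exact c.1.map_target hy.1

lemma symm_trans {c d : Chart n M} {y : E n} (hy : y ∈ overlap c d) :
    d.1.symm (trans c d y) = c.1.symm y := d.1.left_inv hy.2

lemma trans_trans {c d f : Chart n M} {y : E n} (hy : y ∈ overlap c d) :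
    trans d f (trans c d y) = trans c f y := by
  simp only [trans, d.1.left_inv hy.2]

lemma trans_self {c : Chart n M} {y : E n} (hy : y ∈ c.1.target) : trans c c y = y :=
  c.1.right_inv hy

lemma overlap_self {c : Chart n M} {y : E n} (hy : y ∈ c.1.target) : y ∈ overlap c c :=
  ⟨hy, c.1.map_target hy⟩

lemma trans_mem_overlap {c d f : Chart n M} {y : E n} (hy : y ∈ overlap c d)
    (hf : y ∈ overlap c f) : trans c d y ∈ overlap d f :=
  ⟨(trans_mem hy).1, by rw [symm_trans hy]; exact hf.2⟩

lemma contDiffOn_trans (c d : Chart n M) : ContDiffOn ℝ ∞ (trans c d) (overlap c d) := by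
  have h := (contMDiffOn_of_mem_maximalAtlas d.2).comp
    ((contMDiffOn_symm_of_mem_maximalAtlas c.2).mono (fun y (hy : y ∈ overlap c d) => hy.1))
    (fun y hy => hy.2)
  exact h.contDiffOn

lemma contDiffAt_trans {c d : Chart n M} {y : E n} (hy : y ∈ overlap c d) :
    ContDiffAt ℝ ∞ (trans c d) y :=
  (contDiffOn_trans c d).contDiffAt ((isOpen_overlap c d).mem_nhds hy)

lemma differentiableAt_trans {c d : Chart n M} {y : E n} (hy : y ∈ overlap c d) :
    DifferentiableAt ℝ (trans c d) y := (contDiffAt_trans hy).differentiableAt (by simp)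

lemma sum_e (v : E n) : v = ∑ i, v i • e i := by
  ext j
  simp [e, Pi.single_apply]

lemma pd_comp {V : Type*} [NormedAddCommGroup V] [NormedSpace ℝ V] {T : E n → E n} {F : E n → V}
    {y : E n} (hT : DifferentiableAt ℝ T y) (hF : DifferentiableAt ℝ F (T y)) (i : Fin n) :
    pd i (fun z => F (T z)) y = ∑ k, pd i T y k • pd k F (T y) := by
  have h := (hF.hasFDerivAt.comp y hT.hasFDerivAt).fderiv
  simp only [pd]
  change fderiv ℝ (F ∘ T) y _ = _
  rw [h]
  conv_lhs => rw [ContinuousLinearMap.comp_apply, sum_e (fderiv ℝ T y (e i))]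
  simp only [map_sum, map_smul]

lemma pd_apply {T : E n → E n} {y : E n} (hT : DifferentiableAt ℝ T y) (i k : Fin n) :
    pd i (fun z => T z k) y = pd i T y k := by
  have h := ((EuclideanSpace.proj (𝕜 := ℝ) k).hasFDerivAt.comp y hT.hasFDerivAt).fderiv
  simp only [pd]
  change fderiv ℝ ((EuclideanSpace.proj (𝕜 := ℝ) k) ∘ T) y _ = _
  rw [h]
  rfl

lemma contDiffOn_jac (c d : Chart n M) (k i : Fin n) :
    ContDiffOn ℝ ∞ (fun y => jac c d y k i) (overlap c d) :=
  (EuclideanSpace.proj (𝕜 := ℝ) k).contDiff.comp_contDiffOn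
    (contDiffOn_pd (isOpen_overlap c d) (contDiffOn_trans c d) i)

lemma jac_mul {c d f : Chart n M} {y : E n} (hd : y ∈ overlap c d) (hf : y ∈ overlap c f) :
    jac d f (trans c d y) * jac c d y = jac c f y := by
  ext k i
  have h1 : pd i (trans c f) y = pd i (fun z => trans d f (trans c d z)) y :=
    pd_congr (Filter.eventuallyEq_of_mem ((isOpen_overlap c d).mem_nhds hd)
      fun z hz => (trans_trans hz).symm) i
  have hdf := differentiableAt_trans (trans_mem_overlap hd hf)
  have h2 : jac c f y k i = pd i (trans c f) y k := rfl
  rw [Matrix.mul_apply, h2, h1, pd_comp (differentiableAt_trans hd) hdf]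
  simp [jac, mul_comm]

lemma jac_self {c : Chart n M} {y : E n} (hy : y ∈ c.1.target) : jac c c y = 1 := by
  ext k i
  have h1 : pd i (trans c c) y = pd i (fun z => z) y :=
    pd_congr (Filter.eventuallyEq_of_mem (c.1.open_target.mem_nhds hy) fun z hz => trans_self hz) i
  rw [jac, Matrix.of_apply, h1]
  simp [pd, e, Matrix.one_apply, PiLp.single_apply]

lemma jac_mul_jac {c d : Chart n M} {y : E n} (hy : y ∈ overlap c d) :
    jac d c (trans c d y) * jac c d y = 1 := by
  rw [jac_mul hy (overlap_self hy.1), jac_self hy.1]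

lemma det_jac_ne_zero {c d : Chart n M} {y : E n} (hy : y ∈ overlap c d) : (jac c d y).det ≠ 0 := by
  have h := congrArg Matrix.det (jac_mul_jac hy)
  rw [Matrix.det_mul, Matrix.det_one] at h
  exact right_ne_zero_of_mul_eq_one h

lemma contDiffOn_det_jac (c d : Chart n M) :
    ContDiffOn ℝ ∞ (fun y => (jac c d y).det) (overlap c d) :=
  contDiffOn_det (contDiffOn_jac c d)

lemma contDiffOn_absPow_jac (c d : Chart n M) (w : 𝕜) :
    ContDiffOn ℝ ∞ (fun y => absPow (jac c d y).det w) (overlap c d) :=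
  contDiffOn_absPow (contDiffOn_det_jac c d) (fun _ hy => det_jac_ne_zero hy) w

variable {c d : Chart n M} {s t : TopologicalSpace.Opens (E n)}

lemma contDiffOn_comp_trans {F : E n → 𝕜} (hF : ContDiffOn ℝ ∞ F t)
    (h : ∀ y ∈ s, y ∈ overlap c d ∧ trans c d y ∈ t) :
    ContDiffOn ℝ ∞ (fun y => F (trans c d y)) s :=
  hF.comp ((contDiffOn_trans c d).mono fun y hy => (h y hy).1) fun y hy => (h y hy).2

variable (𝕜) in
/-- The pullback of functions by a change of coordinates. -/
def pullHom (h : ∀ y ∈ s, y ∈ overlap c d ∧ trans c d y ∈ t) : smoothAlg 𝕜 t →ₐ[𝕜] smoothAlg 𝕜 s where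
  toFun f := ⟨fun y => ev ⟨trans c d y, (h y y.2).2⟩ f, by
    obtain ⟨F, hF, hf⟩ := exists_rep f
    exact ⟨fun y => F (trans c d y), contDiffOn_comp_trans hF h, fun y => (hf _ _).symm⟩⟩
  map_one' := rfl
  map_mul' _ _ := rfl
  map_zero' := rfl
  map_add' _ _ := rfl
  commutes' _ := rfl

lemma ev_pullHom (h : ∀ y ∈ s, y ∈ overlap c d ∧ trans c d y ∈ t) (f : smoothAlg 𝕜 t) (y : s) :
    ev y (pullHom 𝕜 h f) = ev ⟨trans c d y, (h y y.2).2⟩ f := rfl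

lemma Rep.pull (h : ∀ y ∈ s, y ∈ overlap c d ∧ trans c d y ∈ t) {F : E n → 𝕜} {f : smoothAlg 𝕜 t}
    (hf : Rep F f) : Rep (fun y => F (trans c d y)) (pullHom 𝕜 h f) := fun y hy =>
  hf _ (h y hy).2

lemma contDiffOn_jac_coe (h : ∀ y ∈ s, y ∈ overlap c d) (k i : Fin n) :
    ContDiffOn ℝ ∞ (fun y => ((jac c d y).map (fun x => (x : 𝕜))) k i) s :=
  contDiffOn_ofReal ((contDiffOn_jac c d k i).mono h)

lemma det_jac_coe (y : E n) : ((jac c d y).map (fun x => (x : 𝕜))).det = ((jac c d y).det : 𝕜) :=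
  (RingHom.map_det (algebraMap ℝ 𝕜) (jac c d y)).symm

lemma det_jac_coe_ne_zero {y : E n} (hy : y ∈ overlap c d) :
    ((jac c d y).map (fun x => (x : 𝕜))).det ≠ 0 := by
  rw [det_jac_coe]
  exact_mod_cast det_jac_ne_zero hy

variable (𝕜) in
/-- The change of coordinates, in terms of rings of smooth functions. -/
def coordChange (h : ∀ y ∈ s, y ∈ overlap c d ∧ trans c d y ∈ t) :
    CoordChange (der 𝕜 s) (der 𝕜 t) where
  τ := pullHom 𝕜 h
  J k i := restr _ (contDiffOn_jac_coe (fun y hy => (h y hy).1) k i)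
  K i k := restr _ (contDiffOn_inv (contDiffOn_jac_coe (fun y hy => (h y hy).1))
    (fun y hy => det_jac_coe_ne_zero (h y hy).1) i k)
  J_mul_K a b := smoothAlg_ext fun y => by
    have := congrFun (congrFun (Matrix.mul_nonsing_inv ((jac c d y).map (fun x => (x : 𝕜)))
      (isUnit_iff_ne_zero.2 (det_jac_coe_ne_zero (h y y.2).1))) a) b
    rw [Matrix.mul_apply, Matrix.one_apply] at this
    simp only [map_sum, map_mul, apply_ite (ev y), map_one, map_zero]
    exact this
  K_mul_J a b := smoothAlg_ext fun y => by
    have := congrFun (congrFun (Matrix.nonsing_inv_mul ((jac c d y).map (fun x => (x : 𝕜)))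
      (isUnit_iff_ne_zero.2 (det_jac_coe_ne_zero (h y y.2).1))) a) b
    rw [Matrix.mul_apply, Matrix.one_apply] at this
    simp only [map_sum, map_mul, apply_ite (ev y), map_one, map_zero]
    exact this
  chain i f := smoothAlg_ext fun y => by
    obtain ⟨F, hF, hf⟩ := exists_rep f
    rw [← ((hf.pull h).pd i) y y.2, pd_comp (differentiableAt_trans (h y y.2).1)
      (hf.differentiableAt (h y y.2).2), map_sum]
    refine Finset.sum_congr rfl fun k _ => ?_
    rw [RCLike.real_smul_eq_coe_mul, map_mul, ev_pullHom, ← hf.pd k _ (h y y.2).2]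
    rfl
  -- The Jacobian entries are partial derivatives of one coordinate function, so the symmetry is the
  -- commutation of second derivatives.
  symm i j a := by
    have hs : ContDiffOn ℝ ∞ (fun z => ((trans c d z a : ℝ) : 𝕜)) s :=
      contDiffOn_ofReal ((EuclideanSpace.proj (𝕜 := ℝ) a).contDiff.comp_contDiffOn
        ((contDiffOn_trans c d).mono fun y hy => (h y hy).1))
    have e : ∀ i, restr _ (contDiffOn_jac_coe (𝕜 := 𝕜) (fun y hy => (h y hy).1) a i) =
        der 𝕜 s i (restr _ hs) := fun i => by
      refine (rep_restr _).unique (((rep_restr hs).pd i).congr fun y hy => ?_)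
      have hT := differentiableAt_trans (h y hy).1
      have hTa : DifferentiableAt ℝ (fun z => trans c d z a) y :=
        (EuclideanSpace.proj (𝕜 := ℝ) a).differentiableAt.comp y hT
      rw [pd_ofReal hTa, pd_apply hT]
      rfl
    rw [e, e, der_comm]

/-- By Jacobi's formula the logarithmic derivative of `det J` is `theta`; the power `w` multiplies
it by `w`, and the absolute value does not affect it. -/
lemma isWeight_absPow (h : ∀ y ∈ s, y ∈ overlap c d ∧ trans c d y ∈ t) (w : 𝕜) :
    (coordChange 𝕜 h).IsWeight
      (restr _ ((contDiffOn_absPow_jac c d w).mono fun y hy => (h y hy).1)) (algebraMap 𝕜 _ w) := by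
  intro i
  set T := coordChange 𝕜 h
  have hJK : Matrix.of T.J * Matrix.of T.K = 1 := by
    ext1 a b
    simpa [Matrix.mul_apply, Matrix.one_apply] using T.J_mul_K a b
  have h1 := der_det (der 𝕜 s i) _ _ hJK
  have h2 : (Matrix.of T.K * (Matrix.of T.J).map (der 𝕜 s i)).trace = T.theta i := by
    simp [Matrix.trace, Matrix.mul_apply, CoordChange.theta]
  have hr : Rep (fun y => ((jac c d y).det : 𝕜)) (Matrix.of T.J).det := fun y hy => by
    refine (det_jac_coe (𝕜 := 𝕜) (c := c) (d := d) y).symm.trans ?_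
    exact (RingHom.map_det ((ev ⟨y, hy⟩ : smoothAlg 𝕜 s →ₐ[𝕜] 𝕜) : smoothAlg 𝕜 s →+* 𝕜)
      (Matrix.of T.J)).symm
  refine smoothAlg_ext fun y => ?_
  have hy := (h y y.2).1
  have hd : DifferentiableAt ℝ (fun y => (jac c d y).det) y :=
    ((contDiffOn_det_jac c d).contDiffAt ((isOpen_overlap c d).mem_nhds hy)).differentiableAt
      (by simp)
  have h3 := congrArg (ev y) h1
  rw [h2, map_mul, ← hr.pd i y y.2, ← hr y y.2, pd_ofReal hd] at h3
  have h0 : ((jac c d y).det : 𝕜) ≠ 0 := by exact_mod_cast det_jac_ne_zero hy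
  rw [← (rep_restr _).pd i y y.2, pd_absPow hd (det_jac_ne_zero hy), map_mul, map_mul,
    AlgHom.commutes, RCLike.ofReal_div, h3, mul_div_cancel_left₀ _ h0]
  rfl

end Charts

/-! ### Gluing the local formulas into global operators -/

section Gluing

variable {𝕜 : Type*} [RCLike 𝕜] {n : ℕ} {M : Type*} [TopologicalSpace M] [ChartedSpace (E n) M]
  [IsManifold (𝓡 n) ∞ M]

lemma toField_det (G : E n → Matrix (Fin n) (Fin n) ℝ) (y : E n) :
    (toField (𝕜 := 𝕜) G y).det = ((G y).det : 𝕜) :=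
  (RingHom.map_det (algebraMap ℝ 𝕜) (G y)).symm

variable {c d : Chart n M} {s t : TopologicalSpace.Opens (E n)} (g : Metric n M)

variable (𝕜) in
/-- The components of a metric as elements of a ring of smooth functions. -/
def Metric.on (h : ∀ y ∈ s, y ∈ c.1.target) : MetricPair n (smoothAlg 𝕜 s) :=
  pair (toField (g.coeff c)) (fun i j => contDiffOn_ofReal ((g.smooth c i j).mono h))
    (fun y hy => (g.symm c y (h y hy)).map _) (fun y hy => by
      rw [toField_det]; exact_mod_cast g.nondeg c y (h y hy))

lemma Metric.rep_on (h : ∀ y ∈ s, y ∈ c.1.target) :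
    RepMetric (toField (g.coeff c)) (g.on 𝕜 h) := repMetric_pair _ _ _

lemma Metric.on_rel (h : ∀ y ∈ s, y ∈ overlap c d ∧ trans c d y ∈ t) (ht : ∀ y ∈ t, y ∈ d.1.target) :
    (coordChange 𝕜 h).MetricRel (g.on 𝕜 fun y hy => (h y hy).1.1) (g.on 𝕜 ht) := by
  intro i j
  refine smoothAlg_ext fun y => ?_
  have := congrArg (fun x : ℝ => (x : 𝕜)) (g.compat c d y (h y y.2).1 i j)
  simp only [RCLike.ofReal_sum, RCLike.ofReal_mul] at this
  simp only [map_sum, map_mul]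
  exact this

/-- The open subset of the model space onto which a chart maps. -/
def tgt (c : Chart n M) : TopologicalSpace.Opens (E n) := ⟨c.1.target, c.1.open_target⟩

/-- The range of a chart, restricted to the domain of another chart. -/
def ovl (c d : Chart n M) : TopologicalSpace.Opens (E n) := ⟨overlap c d, isOpen_overlap c d⟩

lemma ovl_to (c d : Chart n M) : ∀ y ∈ ovl c d, y ∈ overlap c d ∧ trans c d y ∈ tgt d :=
  fun _ hy => ⟨hy, (trans_mem hy).1⟩

/-- Covariant tensor fields of degree two, given in the charts of some family. -/
structure IsTensorOn (𝒜 : Set (Chart n M)) (X : Chart n M → E n → Fin n → Fin n → 𝕜) : Prop where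
  smooth : ∀ c ∈ 𝒜, ∀ i j, ContDiffOn ℝ ∞ (fun y => X c y i j) c.1.target
  cov : ∀ c ∈ 𝒜, ∀ d ∈ 𝒜, ∀ y ∈ overlap c d, ∀ i j, X c y i j =
    ∑ k, ∑ q, (jac c d y k i : 𝕜) * (jac c d y q j : 𝕜) * X d (trans c d y) k q

variable {X : Chart n M → E n → Fin n → Fin n → 𝕜} {l m b1 b2 b3 b4 : 𝕜}

/-- The quantization formula in a chart. -/
def totalIn (l m b1 b2 b3 b4 : 𝕜) (g : Metric n M) (X : Chart n M → E n → Fin n → Fin n → 𝕜)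
    (P : Symbol n M (m - l)) (φ : Density n M l) (c : Chart n M) (y : E n) : 𝕜 :=
  total (toField (g.coeff c)) l m b1 b2 b3 b4 (X c) (P.1.1 c) (P.2.1.1 c) (P.2.2.1 c) (φ.1 c) y

variable (hX : IsTensorOn Set.univ X)

/-- The restriction of a symbol of degree two. -/
def symOn2 {w : 𝕜} (P : Symbol2 n M w) (h : ∀ y ∈ s, y ∈ c.1.target) (i j : Fin n) :
    smoothAlg 𝕜 s := restr (fun y => P.1 c y i j) ((P.2.2.1 c i j).mono h)

/-- The restriction of a symbol of degree one. -/
def symOn1 {w : 𝕜} (P : Symbol1 n M w) (h : ∀ y ∈ s, y ∈ c.1.target) (i : Fin n) :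
    smoothAlg 𝕜 s := restr (fun y => P.1 c y i) ((P.2.2.1 c i).mono h)

/-- The restriction of a density. -/
def denOn {w : 𝕜} (φ : Density n M w) (h : ∀ y ∈ s, y ∈ c.1.target) :
    smoothAlg 𝕜 s := restr (φ.1 c) ((φ.2.2.1 c).mono h)

/-- The restriction of a tensor field. -/
def IsTensorOn.on {𝒜 : Set (Chart n M)} (hX : IsTensorOn 𝒜 X) (hc : c ∈ 𝒜)
    (h : ∀ y ∈ s, y ∈ c.1.target) (i j : Fin n) :
    smoothAlg 𝕜 s := restr (fun y => X c y i j) ((hX.smooth c hc i j).mono h)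

lemma symOn2_symm {w : 𝕜} (P : Symbol2 n M w) (h : ∀ y ∈ s, y ∈ c.1.target) (i j : Fin n) :
    symOn2 P h i j = symOn2 P h j i := smoothAlg_ext fun y => P.2.2.2.1 c y i j

lemma rep_totalIn (h : ∀ y ∈ s, y ∈ c.1.target) (P : Symbol n M (m - l)) (φ : Density n M l) :
    Rep (totalIn l m b1 b2 b3 b4 g X P φ c) (totR (der 𝕜 s) (g.on 𝕜 h) l m b1 b2 b3 b4
      (hX.on (Set.mem_univ c) h) (symOn2 P.1 h) (symOn1 P.2.1 h) (denOn P.2.2 h) (denOn φ h)) :=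
  Rep.total (g.rep_on h) (fun _ _ => rep_restr _) (fun _ _ => rep_restr _)
    (symOn2_symm P.1 h) (fun _ => rep_restr _) (rep_restr _) (rep_restr _)

lemma denOn_rel {w : 𝕜} (φ : Density n M w)
    (h : ∀ y ∈ s, y ∈ overlap c d ∧ trans c d y ∈ t) (ht : ∀ y ∈ t, y ∈ d.1.target) :
    denOn φ (fun y hy => (h y hy).1.1) =
      restr _ ((contDiffOn_absPow_jac c d w).mono fun y hy => (h y hy).1) *
        (coordChange 𝕜 h).τ (denOn φ ht) :=
  smoothAlg_ext fun y => by rw [map_mul]; exact φ.2.2.2 c d y (h y y.2).1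

lemma symOn1_rel {w : 𝕜} (P : Symbol1 n M w)
    (h : ∀ y ∈ s, y ∈ overlap c d ∧ trans c d y ∈ t) (ht : ∀ y ∈ t, y ∈ d.1.target) (k : Fin n) :
    ∑ i, (coordChange 𝕜 h).J k i * symOn1 P (fun y hy => (h y hy).1.1) i =
      restr _ ((contDiffOn_absPow_jac c d w).mono fun y hy => (h y hy).1) *
        (coordChange 𝕜 h).τ (symOn1 P ht k) :=
  smoothAlg_ext fun y => by
    simp only [map_sum, map_mul]; exact P.2.2.2 c d y (h y y.2).1 k

lemma symOn2_rel {w : 𝕜} (P : Symbol2 n M w)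
    (h : ∀ y ∈ s, y ∈ overlap c d ∧ trans c d y ∈ t) (ht : ∀ y ∈ t, y ∈ d.1.target) (k q : Fin n) :
    ∑ i, ∑ j, (coordChange 𝕜 h).J k i * (coordChange 𝕜 h).J q j *
        symOn2 P (fun y hy => (h y hy).1.1) i j =
      restr _ ((contDiffOn_absPow_jac c d w).mono fun y hy => (h y hy).1) *
        (coordChange 𝕜 h).τ (symOn2 P ht k q) :=
  smoothAlg_ext fun y => by
    simp only [map_sum, map_mul]; exact P.2.2.2.2 c d y (h y y.2).1 k q

lemma IsTensorOn.on_rel {𝒜 : Set (Chart n M)} (hX : IsTensorOn 𝒜 X) (hc : c ∈ 𝒜) (hd : d ∈ 𝒜)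
    (h : ∀ y ∈ s, y ∈ overlap c d ∧ trans c d y ∈ t) (ht : ∀ y ∈ t, y ∈ d.1.target) (i j : Fin n) :
    hX.on hc (fun y hy => (h y hy).1.1) i j =
      ∑ k, ∑ q, (coordChange 𝕜 h).J k i * (coordChange 𝕜 h).J q j *
        (coordChange 𝕜 h).τ (hX.on hd ht k q) :=
  smoothAlg_ext fun y => by
    simp only [map_sum, map_mul]; exact hX.cov c hc d hd y (h y y.2).1 i j

-- The symbol contributes `|det J|^(m - l)` and the argument `|det J|^l`; their product is the
-- factor of a density of degree `m`. The coefficients `b1, …, b4` are arbitrary constants here.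
include hX in
lemma totalIn_trans (P : Symbol n M (m - l)) (φ : Density n M l) {y : E n} (hy : y ∈ overlap c d) :
    totalIn l m b1 b2 b3 b4 g X P φ c y =
      absPow (jac c d y).det m * totalIn l m b1 b2 b3 b4 g X P φ d (trans c d y) := by
  have h := ovl_to c d
  have ht : ∀ y ∈ tgt d, y ∈ d.1.target := fun _ hy => hy
  have hX' := CoordChange.contract_two (T := coordChange 𝕜 h) (mu := 1) (symOn2_rel P.1 h ht)
    (fun i j => (hX.on_rel (Set.mem_univ c) (Set.mem_univ d) h ht i j).trans (one_mul _).symm)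
  simp only [mul_comm (symOn2 P.1 _ _ _), mul_one] at hX'
  have e := (g.on_rel h ht).totR_eq (b1 := b1) (b2 := b2) (b3 := b3) (b4 := b4)
    (isWeight_absPow h (m - l)) (isWeight_absPow h l) (symOn2_rel P.1 h ht) (symOn1_rel P.2.1 h ht)
    (denOn_rel P.2.2 h ht) (denOn_rel φ h ht) hX'
  have e2 := congrArg (ev ⟨y, hy⟩) e
  rw [← rep_totalIn g hX (s := ovl c d) (fun y hy => (h y hy).1.1) P φ y hy, map_mul, map_mul] at e2
  rw [e2, rep_totalIn g hX ht P φ _ (h y hy).2,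
    show absPow (jac c d y).det m = absPow (jac c d y).det ((m - l) + l) by rw [sub_add_cancel],
    absPow_add]
  rfl

/-- Densities that agree in a family of charts covering the manifold are equal. -/
lemma density_ext {w : 𝕜} {𝒜 : Set (Chart n M)} (hA : ∀ x : M, ∃ a ∈ 𝒜, x ∈ a.1.source)
    {φ ψ : Density n M w} (h : ∀ a ∈ 𝒜, ∀ y ∈ a.1.target, φ.1 a y = ψ.1 a y) : φ = ψ := by
  refine Subtype.ext (funext fun c => funext fun y => ?_)
  by_cases hy : y ∈ c.1.target
  · obtain ⟨a, ha, hx⟩ := hA (c.1.symm y)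
    have ho : y ∈ overlap c a := ⟨hy, hx⟩
    rw [φ.2.2.2 c a y ho, ψ.2.2.2 c a y ho, h a ha _ (trans_mem ho).1]
  · rw [φ.2.1 c y hy, ψ.2.1 c y hy]

lemma der_algebraMap (i : Fin n) (x : 𝕜) : der 𝕜 s i (algebraMap 𝕜 _ x) = 0 :=
  (der 𝕜 s i).map_algebraMap x

open Classical in
/-- The image of a density under the quantization map. -/
def opVal (l m b1 b2 b3 b4 : 𝕜) (g : Metric n M) (hX : IsTensorOn Set.univ X)
    (P : Symbol n M (m - l)) (φ : Density n M l) : Density n M m :=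
  ⟨fun c y => if y ∈ c.1.target then totalIn l m b1 b2 b3 b4 g X P φ c y else 0,
    fun c y hy => if_neg hy,
    fun c => (rep_totalIn g hX (s := tgt c) (fun y hy => hy) P φ).contDiffOn.congr
      fun y hy => if_pos hy,
    fun c d y hy => by
      simp only [hy.1, (trans_mem hy).1, if_true]
      exact totalIn_trans g hX P φ hy⟩

lemma opVal_apply (P : Symbol n M (m - l)) (φ : Density n M l) {y : E n} (hy : y ∈ c.1.target) :
    (opVal l m b1 b2 b3 b4 g hX P φ).1 c y = totalIn l m b1 b2 b3 b4 g X P φ c y := if_pos hy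

lemma opVal_eq (P : Symbol n M (m - l)) (φ : Density n M l) {y : E n} (hy : y ∈ tgt c) :
    (opVal l m b1 b2 b3 b4 g hX P φ).1 c y = ev ⟨y, hy⟩ (totR (der 𝕜 _)
      (g.on 𝕜 (fun _ h => h)) l m b1 b2 b3 b4
      (hX.on (Set.mem_univ c) (fun _ h => h)) (symOn2 P.1 (fun _ h => h))
      (symOn1 P.2.1 (fun _ h => h)) (denOn P.2.2 (fun _ h => h)) (denOn φ (fun _ h => h))) :=
  (opVal_apply g hX P φ hy).trans (rep_totalIn g hX _ P φ y hy)

lemma covering_univ (x : M) : ∃ a ∈ (Set.univ : Set (Chart n M)), x ∈ a.1.source :=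
  ⟨⟨chartAt _ x, IsManifold.chart_mem_maximalAtlas x⟩, Set.mem_univ _, mem_chart_source _ x⟩

/-- The operator that the quantization map assigns to a symbol. -/
def opLin (l m b1 b2 b3 b4 : 𝕜) (g : Metric n M) (hX : IsTensorOn Set.univ X)
    (P : Symbol n M (m - l)) : Density n M l →ₗ[𝕜] Density n M m where
  toFun := opVal l m b1 b2 b3 b4 g hX P
  map_add' φ ψ := density_ext covering_univ fun c _ y hy => by
    change _ = (opVal l m b1 b2 b3 b4 g hX P φ).1 c y + (opVal l m b1 b2 b3 b4 g hX P ψ).1 c y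
    rw [opVal_eq (c := c) g hX _ _ hy, opVal_eq (c := c) g hX _ _ hy, opVal_eq (c := c) g hX _ _ hy,
      ← map_add, ← totR_add_right]
    rfl
  map_smul' r φ := density_ext covering_univ fun c _ y hy => by
    change _ = r * (opVal l m b1 b2 b3 b4 g hX P φ).1 c y
    rw [opVal_eq (c := c) g hX _ _ hy, opVal_eq (c := c) g hX _ _ hy]
    have := congrArg (ev ⟨y, hy⟩) (totR_const_right (D := der 𝕜 (tgt c)) (a := g.on 𝕜 fun _ h => h)
      (l := l) (m := m) (b1 := b1) (b2 := b2) (b3 := b3) (b4 := b4)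
      (X := hX.on (Set.mem_univ c) (fun _ h => h)) (P := symOn2 P.1 (fun _ h => h))
      (V := symOn1 P.2.1 (fun _ h => h)) (ρ := denOn P.2.2 (fun _ h => h))
      (φ := denOn φ (fun _ h => h)) (fun i => der_algebraMap i r))
    rw [map_mul, AlgHom.commutes] at this
    exact this

/-- A smooth function in a chart. -/
def funOn (f : C^∞⟮𝓡 n, M; 𝓘(ℝ, 𝕜), 𝕜⟯) (c : Chart n M) (h : ∀ y ∈ s, y ∈ c.1.target) :
    smoothAlg 𝕜 s :=
  restr (fun y => f (c.1.symm y)) ((f.contMDiff.comp_contMDiffOn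
    (contMDiffOn_symm_of_mem_maximalAtlas c.2)).contDiffOn.mono h)

lemma funOn_rel (f : C^∞⟮𝓡 n, M; 𝓘(ℝ, 𝕜), 𝕜⟯) (h : ∀ y ∈ s, y ∈ overlap c d ∧ trans c d y ∈ t)
    (ht : ∀ y ∈ t, y ∈ d.1.target) :
    funOn f c (fun y hy => (h y hy).1.1) = (coordChange 𝕜 h).τ (funOn f d ht) :=
  smoothAlg_ext fun y => congrArg f (symm_trans (h y y.2).1).symm

/-- The contraction of a symbol of degree two with two differentials. -/
def contrIn {w : 𝕜} (P : Symbol2 n M w) (f f' : C^∞⟮𝓡 n, M; 𝓘(ℝ, 𝕜), 𝕜⟯) (c : Chart n M)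
    (y : E n) : 𝕜 :=
  2 * ∑ i, ∑ j, P.1 c y i j * (pd i (fun z => f (c.1.symm z)) y * pd j (fun z => f' (c.1.symm z)) y)

lemma rep_contrIn {w : 𝕜} (P : Symbol2 n M w) (f f' : C^∞⟮𝓡 n, M; 𝓘(ℝ, 𝕜), 𝕜⟯)
    (h : ∀ y ∈ s, y ∈ c.1.target) :
    Rep (contrIn P f f' c) (2 * ∑ i, ∑ j, symOn2 P h i j *
      (der 𝕜 s i (funOn f c h) * der 𝕜 s j (funOn f' c h))) := fun y hy => by
  have e : ∀ (f : C^∞⟮𝓡 n, M; 𝓘(ℝ, 𝕜), 𝕜⟯) i, pd i (fun z => f (c.1.symm z)) y =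
      ev ⟨y, hy⟩ (der 𝕜 s i (funOn f c h)) := fun f i => (rep_restr _).pd i y hy
  have e2 : ∀ i j, P.1 c y i j = ev ⟨y, hy⟩ (symOn2 P h i j) := fun i j => rfl
  simp only [contrIn, e, e2, map_mul, map_sum, map_ofNat]

/-- The principal symbol of a double commutator, as a density. -/
def contr {w : 𝕜} (P : Symbol2 n M w) (f f' : C^∞⟮𝓡 n, M; 𝓘(ℝ, 𝕜), 𝕜⟯) : Density n M w :=
  ⟨contrIn P f f', fun c y hy => by simp [contrIn, P.2.1 c y hy],
    fun c => (rep_contrIn P f f' (s := tgt c) fun _ h => h).contDiffOn,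
    fun c d y hy => by
      have h := ovl_to c d
      have ht : ∀ y ∈ tgt d, y ∈ d.1.target := fun _ hy => hy
      have e : ∀ f i, der 𝕜 (ovl c d) i (funOn f c (fun y hy => (h y hy).1.1)) =
          ∑ a, (coordChange 𝕜 h).J a i *
            (coordChange 𝕜 h).τ (der 𝕜 _ a (funOn f d ht)) := fun f i => by
        rw [funOn_rel f h ht, CoordChange.chain]
      have := congrArg (fun x => ev ⟨y, hy⟩ (2 * x))
        (CoordChange.contract_two (T := coordChange 𝕜 h) (mu := 1) (symOn2_rel P h ht)
          (X := fun i j => der 𝕜 _ i (funOn f c (fun y hy => (h y hy).1.1)) *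
            der 𝕜 _ j (funOn f' c (fun y hy => (h y hy).1.1)))
          (X' := fun i j => der 𝕜 _ i (funOn f d ht) * der 𝕜 _ j (funOn f' d ht))
          (fun i j => by
            rw [e, e, one_mul, Finset.sum_mul_sum]
            refine Finset.sum_congr rfl fun p _ => Finset.sum_congr rfl fun q _ => ?_
            rw [map_mul]; ring))
      rw [rep_contrIn P f f' (s := ovl c d) (fun y hy => (h y hy).1.1) y hy, this,
        rep_contrIn P f f' ht _ (h y hy).2, mul_one, mul_left_comm, map_mul]
      congr 1⟩

/-- Two commutators with functions leave the multiplication by `2 Pⁱʲ ∂ᵢf ∂ⱼf'`. This has to be a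
globally defined density of degree `m - l`, namely `contr`. -/
lemma isDiffOp_opLin (P : Symbol n M (m - l)) : IsDiffOp 2 (opLin l m b1 b2 b3 b4 g hX P) := by
  intro f f'
  refine ⟨contr P.1 f f', fun φ c y => ?_⟩
  by_cases hy : y ∈ tgt c
  · have h : ∀ y ∈ tgt c, y ∈ c.1.target := fun _ hy => hy
    have e := congrArg (ev ⟨y, hy⟩) (totR_comm_comm (D := der 𝕜 (tgt c)) (a := g.on 𝕜 h)
      (l := l) (m := m) (b1 := b1) (b2 := b2) (b3 := b3) (b4 := b4)
      (X := hX.on (Set.mem_univ c) h) (V := symOn1 P.2.1 h) (ρ := denOn P.2.2 h)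
      (φ := denOn φ h) (f := funOn f c h) (f' := funOn f' c h) (symOn2_symm P.1 h))
    have er := rep_contrIn P.1 f f' h y hy
    rw [map_mul, ← er] at e
    refine Eq.trans ?_ e
    simp only [map_sub, map_mul]
    change (opVal l m b1 b2 b3 b4 g hX P (mulFun f (mulFun f' φ))).1 c y
      - f (c.1.symm y) * (opVal l m b1 b2 b3 b4 g hX P (mulFun f' φ)).1 c y
      - f' (c.1.symm y) * ((opVal l m b1 b2 b3 b4 g hX P (mulFun f φ)).1 c y
        - f (c.1.symm y) * (opVal l m b1 b2 b3 b4 g hX P φ).1 c y) = _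
    simp only [opVal_eq (c := c) g hX _ _ hy]
    rfl
  · have h1 : ∀ ψ : Density n M m, ψ.1 c y = 0 := fun ψ => ψ.2.1 c y hy
    have h2 : φ.1 c y = 0 := φ.2.1 c y hy
    rw [h1, h2, mul_zero]

/-- The quantization map with given coefficients and curvature term. -/
def opMap (l m b1 b2 b3 b4 : 𝕜) (g : Metric n M) (hX : IsTensorOn Set.univ X) :
    Symbol n M (m - l) →ₗ[𝕜] DiffOp n M l m 2 where
  toFun P := ⟨opLin l m b1 b2 b3 b4 g hX P, isDiffOp_opLin g hX P⟩
  map_add' P Q := Subtype.ext (LinearMap.ext fun φ => density_ext covering_univ fun c _ y hy => by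
    change (opVal l m b1 b2 b3 b4 g hX (P + Q) φ).1 c y =
      (opVal l m b1 b2 b3 b4 g hX P φ).1 c y + (opVal l m b1 b2 b3 b4 g hX Q φ).1 c y
    rw [opVal_eq (c := c) g hX _ _ hy, opVal_eq (c := c) g hX _ _ hy, opVal_eq (c := c) g hX _ _ hy,
      ← map_add, ← totR_add_left]
    rfl)
  map_smul' r P := Subtype.ext (LinearMap.ext fun φ => density_ext covering_univ fun c _ y hy => by
    change (opVal l m b1 b2 b3 b4 g hX (r • P) φ).1 c y =
      r * (opVal l m b1 b2 b3 b4 g hX P φ).1 c y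
    rw [opVal_eq (c := c) g hX _ _ hy, opVal_eq (c := c) g hX _ _ hy]
    have := congrArg (ev ⟨y, hy⟩) (totR_const_left (D := der 𝕜 (tgt c)) (a := g.on 𝕜 fun _ h => h)
      (l := l) (m := m) (b1 := b1) (b2 := b2) (b3 := b3) (b4 := b4)
      (X := hX.on (Set.mem_univ c) (fun _ h => h)) (P := symOn2 P.1 (fun _ h => h))
      (V := symOn1 P.2.1 (fun _ h => h)) (ρ := denOn P.2.2 (fun _ h => h))
      (φ := denOn φ (fun _ h => h)) (fun i => der_algebraMap i r))
    rw [map_mul, AlgHom.commutes] at this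
    exact this)

lemma opMap_apply (P : Symbol n M (m - l)) (φ : Density n M l) {y : E n} (hy : y ∈ c.1.target) :
    ((opMap l m b1 b2 b3 b4 g hX P).1 φ).1 c y = totalIn l m b1 b2 b3 b4 g X P φ c y :=
  opVal_apply g hX P φ hy

/-- A tensor field given in a family of charts that covers the manifold extends to all charts. -/
lemma IsTensorOn.extend {𝒜 : Set (Chart n M)} (hA : ∀ x : M, ∃ a ∈ 𝒜, x ∈ a.1.source)
    (hX : IsTensorOn 𝒜 X) : ∃ X', IsTensorOn Set.univ X' ∧
      ∀ c, ∀ a ∈ 𝒜, ∀ y ∈ overlap c a, ∀ i j, X' c y i j =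
        ∑ k, ∑ q, (jac c a y k i : 𝕜) * (jac c a y q j : 𝕜) * X a (trans c a y) k q := by
  choose a ha hs using hA
  -- Chain rule: pulling back directly from `f` to `c` equals pulling back through `d`.
  have key : ∀ c d f : Chart n M, ∀ y, y ∈ overlap c d → y ∈ overlap c f → ∀ Y : Fin n → Fin n → 𝕜,
      ∀ i j, ∑ k, ∑ q, (jac c f y k i : 𝕜) * (jac c f y q j : 𝕜) * Y k q =
        ∑ p, ∑ r, (jac c d y p i : 𝕜) * (jac c d y r j : 𝕜) * ∑ k, ∑ q,
          (jac d f (trans c d y) k p : 𝕜) * (jac d f (trans c d y) q r : 𝕜) * Y k q := by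
    intro c d f y hd hf Y i j
    have hJ : ∀ k i, (jac c f y k i : 𝕜) =
        ∑ p, (jac d f (trans c d y) k p : 𝕜) * (jac c d y p i : 𝕜) := fun k i => by
      rw [← jac_mul hd hf, Matrix.mul_apply]
      push_cast
      rfl
    simp only [Finset.mul_sum (Finset.univ : Finset (Fin n))]
    rw [← sum_comm_pairs]
    refine Finset.sum_congr rfl fun k _ => Finset.sum_congr rfl fun q _ => ?_
    rw [hJ, hJ, Finset.sum_mul_sum, Finset.sum_mul]
    refine Finset.sum_congr rfl fun p _ => ?_
    rw [Finset.sum_mul]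
    exact Finset.sum_congr rfl fun r _ => by ring
  -- The components in `c` do not depend on the chart of the family used to compute them, by
  -- covariance of `X` on the family.
  have indep : ∀ c : Chart n M, ∀ b ∈ 𝒜, ∀ b' ∈ 𝒜, ∀ y, y ∈ overlap c b → y ∈ overlap c b' → ∀ i j,
      ∑ k, ∑ q, (jac c b' y k i : 𝕜) * (jac c b' y q j : 𝕜) * X b' (trans c b' y) k q =
      ∑ k, ∑ q, (jac c b y k i : 𝕜) * (jac c b y q j : 𝕜) * X b (trans c b y) k q := by
    intro c b hb b' hb' y h h' i j
    rw [key c b b' y h h']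
    refine Finset.sum_congr rfl fun p _ => Finset.sum_congr rfl fun r _ => ?_
    rw [hX.cov b hb b' hb' _ (trans_mem_overlap h h'), trans_trans h]
  -- At each point a chart of the family is chosen. The choice need not vary continuously: by
  -- `indep`, the chart chosen at one point can be used on a whole neighbourhood, which gives
  -- smoothness.
  refine ⟨fun c y i j => ∑ k, ∑ q, (jac c (a (c.1.symm y)) y k i : 𝕜) *
    (jac c (a (c.1.symm y)) y q j : 𝕜) * X (a (c.1.symm y)) (trans c (a (c.1.symm y)) y) k q,
    ⟨fun c _ i j => ?_, fun c _ d _ y hy i j => ?_⟩, fun c b hb y hy i j => ?_⟩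
  · intro y hy
    refine ContDiffAt.contDiffWithinAt ?_
    set b := a (c.1.symm y)
    have hyb : y ∈ overlap c b := ⟨hy, hs _⟩
    have hsm : ContDiffOn ℝ ∞ (fun y => ∑ k, ∑ q, (jac c b y k i : 𝕜) * (jac c b y q j : 𝕜) *
        X b (trans c b y) k q) (overlap c b) :=
      ContDiffOn.sum fun k _ => ContDiffOn.sum fun q _ =>
        ((contDiffOn_ofReal (contDiffOn_jac c b k i)).mul
          (contDiffOn_ofReal (contDiffOn_jac c b q j))).mul
          ((hX.smooth b (ha _) k q).comp (contDiffOn_trans c b) fun z hz => (trans_mem hz).1)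
    refine (hsm.contDiffAt ((isOpen_overlap c b).mem_nhds hyb)).congr_of_eventuallyEq ?_
    exact Filter.eventuallyEq_of_mem ((isOpen_overlap c b).mem_nhds hyb) fun z hz =>
      indep c b (ha _) _ (ha _) z hz ⟨hz.1, hs _⟩ i j
  · have e : c.1.symm y = d.1.symm (trans c d y) := (symm_trans hy).symm
    rw [e]
    set b := a (d.1.symm (trans c d y))
    have hb : y ∈ overlap c b := ⟨hy.1, by rw [e]; exact hs _⟩
    rw [key c d b y hy hb, trans_trans hy]
  · exact indep c b hb _ (ha _) y hy ⟨hy.1, hs _⟩ i j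

end Gluing

/-! ### Möbius transformations of the model space -/

section Moebius

variable {n : ℕ} {ε : Fin n → ℝ}

lemma flat_comm (x y : E n) : flat ε x y = flat ε y x :=
  Finset.sum_congr rfl fun i _ => by ring

lemma flat_add_left (x y z : E n) : flat ε (x + y) z = flat ε x z + flat ε y z := by
  simp only [flat, ← Finset.sum_add_distrib, PiLp.add_apply]
  exact Finset.sum_congr rfl fun i _ => by ring

lemma flat_smul_left (t : ℝ) (x y : E n) : flat ε (t • x) y = t * flat ε x y := by
  simp only [flat, Finset.mul_sum, PiLp.smul_apply, smul_eq_mul]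
  exact Finset.sum_congr rfl fun i _ => by ring

lemma flat_smul_smul (t : ℝ) (x : E n) : flat ε (t • x) (t • x) = t ^ 2 * flat ε x x := by
  rw [flat_smul_left, flat_comm, flat_smul_left]; ring

lemma flat_combination (s t : ℝ) (x y : E n) : flat ε (s • x - t • y) (s • x - t • y) =
    s ^ 2 * flat ε x x - 2 * (s * t) * flat ε x y + t ^ 2 * flat ε y y := by
  have e : s • x - t • y = s • x + (-t) • y := by rw [neg_smul, sub_eq_add_neg]
  have h : ∀ z, flat ε (s • x - t • y) z = s * flat ε x z - t * flat ε y z := fun z => by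
    rw [e, flat_add_left, flat_smul_left, flat_smul_left]; ring
  rw [h, flat_comm x, h, flat_comm y (s • x - t • y), h, flat_comm y x]
  ring

/-- Lifts are null vectors, so only their polar pairing survives, and it is the flat squared
distance. Hence an isometry of the big form controls distances on `ℝⁿ`. -/
lemma bigForm_lift_sub (s t : ℝ) (x y : E n) :
    bigForm ε (s • lift ε x - t • lift ε y) = s * t * flat ε (x - y) (x - y) := by
  have h := flat_combination (ε := ε) 1 1 x y
  rw [one_smul, one_smul] at h
  rw [h]
  simp only [bigForm, lift, Prod.smul_mk, Prod.mk_sub_mk, flat_combination, smul_eq_mul]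
  ring

/-- The polar form of the quadratic form on `ℝ × ℝⁿ × ℝ`. -/
lemma bigForm_add (v w : ℝ × E n × ℝ) : bigForm ε (v + w) = bigForm ε v + bigForm ε w
    + (2 * flat ε v.2.1 w.2.1 - v.1 * w.2.2 - w.1 * v.2.2) := by
  simp only [bigForm, Prod.fst_add, Prod.snd_add, flat_add_left]
  rw [flat_comm v.2.1 (v.2.1 + w.2.1), flat_comm w.2.1 (v.2.1 + w.2.1), flat_add_left, flat_add_left,
    flat_comm w.2.1 v.2.1]
  ring

lemma flat_single (x : E n) (i : Fin n) : flat ε x (e i) = ε i * x i := by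
  simp [flat, e]

/-- The conformal factor of a Möbius transformation is a quadratic function with null gradient. -/
lemma exists_quadratic (hε : ∀ i, ε i = 1 ∨ ε i = -1) {A : (ℝ × E n × ℝ) →ₗ[ℝ] (ℝ × E n × ℝ)}
    (hA : ∀ v, bigForm ε (A v) = bigForm ε v) : ∃ (α γ : ℝ) (w : E n), flat ε w w = α * γ ∧
      ∀ x, (A (lift ε x)).1 = α + γ * flat ε x x - 2 * flat ε x w := by
  have hpol : ∀ v w, 2 * flat ε (A v).2.1 (A w).2.1 - (A v).1 * (A w).2.2 - (A w).1 * (A v).2.2 =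
      2 * flat ε v.2.1 w.2.1 - v.1 * w.2.2 - w.1 * v.2.2 := fun v w => by
    have h := hA (v + w)
    rw [map_add, bigForm_add, bigForm_add, hA, hA] at h
    linarith
  -- A form-preserving map is injective because the polar form is nondegenerate; in finite dimension
  -- it is then onto.
  have hinj : Function.Injective A := by
    refine (injective_iff_map_eq_zero A).2 fun v hv => ?_
    have h : ∀ w : ℝ × E n × ℝ, 2 * flat ε v.2.1 w.2.1 - v.1 * w.2.2 - w.1 * v.2.2 = 0 := fun w => by
      rw [← hpol, hv]; simp [flat]
    have h1 := h (0, 0, 1)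
    have h2 := h (1, 0, 0)
    simp [flat] at h1 h2
    have h3 : v.2.1 = 0 := by
      ext i
      have h4 := h (0, e i, 0)
      simp only [flat_single, mul_zero, sub_zero, zero_mul] at h4
      rcases hε i with hi | hi <;> rw [hi] at h4 <;> simp <;> linarith
    exact Prod.ext h1 (Prod.ext h3 h2)
  -- Pairing with `(0, 0, 1)` extracts minus the first component. Its preimage `w` therefore
  -- expresses the first component of `A (lift x)` as a pairing of `w` with `lift x`; `w` is null
  -- because `(0, 0, 1)` is.
  obtain ⟨w, hw⟩ := LinearMap.injective_iff_surjective.1 hinj (0, 0, 1)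
  refine ⟨w.2.2, w.1, w.2.1, ?_, fun x => ?_⟩
  · have h := hA w
    rw [hw] at h
    simp [bigForm, flat] at h
    simp only [flat]
    linarith
  · have h := hpol (lift ε x) w
    rw [hw] at h
    simp only [lift] at h ⊢
    simp [flat] at h
    simp only [flat]
    linarith

/-- The quadratic function `α + γ ⟨x, x⟩ - 2 ⟨x, w⟩`. -/
def quadFun (ε : Fin n → ℝ) (α γ : ℝ) (w x : E n) : ℝ := α + γ * flat ε x x - 2 * flat ε x w

lemma hasFDerivAt_coord (k : Fin n) (z : E n) :
    HasFDerivAt (fun x : E n => x k) (EuclideanSpace.proj (𝕜 := ℝ) k : E n →L[ℝ] ℝ) z :=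
  (EuclideanSpace.proj (𝕜 := ℝ) k : E n →L[ℝ] ℝ).hasFDerivAt

lemma contDiff_coord (k : Fin n) : ContDiff ℝ ∞ (fun x : E n => x k) :=
  (EuclideanSpace.proj (𝕜 := ℝ) k : E n →L[ℝ] ℝ).contDiff

lemma contDiff_quadFun (α γ : ℝ) (w : E n) : ContDiff ℝ ∞ (quadFun ε α γ w) := by
  have h1 : ContDiff ℝ ∞ (fun x : E n => flat ε x x) :=
    ContDiff.sum fun k _ => (contDiff_const.mul (contDiff_coord k)).mul (contDiff_coord k)
  have h2 : ContDiff ℝ ∞ (fun x : E n => flat ε x w) :=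
    ContDiff.sum fun k _ => (contDiff_const.mul (contDiff_coord k)).mul contDiff_const
  exact (contDiff_const.add (contDiff_const.mul h1)).sub (contDiff_const.mul h2)

lemma pd_quadFun (α γ : ℝ) (w : E n) (i : Fin n) :
    pd i (quadFun ε α γ w) = fun x => 2 * ε i * (γ * x i - w i) := by
  funext x
  have h1 : HasFDerivAt (fun x : E n => flat ε x x) _ x :=
    HasFDerivAt.fun_sum (u := Finset.univ) fun k _ => ((hasFDerivAt_coord k x).const_mul (ε k)).mul (hasFDerivAt_coord k x)
  have h2 : HasFDerivAt (fun x : E n => flat ε x w) _ x :=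
    HasFDerivAt.fun_sum (u := Finset.univ) fun k _ => ((hasFDerivAt_coord k x).const_mul (ε k)).mul_const (w k)
  have h3 := (((h1.const_mul γ).const_add α).sub (h2.const_mul 2)).fderiv
  rw [pd]
  have h4 : fderiv ℝ (quadFun ε α γ w) x = _ := h3
  rw [h4]
  simp [e, Finset.sum_add_distrib]
  ring

lemma pd_pd_quadFun (α γ : ℝ) (w : E n) (i j : Fin n) (x : E n) :
    pd i (pd j (quadFun ε α γ w)) x = if i = j then 2 * ε i * γ else 0 := by
  rw [pd_quadFun, pd]
  have h := (((hasFDerivAt_coord j x).const_mul γ).sub_const (w j)).const_mul (2 * ε j)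
  rw [h.fderiv]
  by_cases hij : i = j
  · subst hij; simp [e]
  · simp [e, hij, Ne.symm hij]

/-- The squared gradient is `4 ⟨γx - w, γx - w⟩`, which equals `4 γ` times the function exactly
because of `hw`, while the Hessian is `2 γ` times the flat metric. This is the equation that makes
the Schwarzian of `r⁻²` vanish. -/
lemma quadFun_eq (hε : ∀ i, ε i = 1 ∨ ε i = -1) {α γ : ℝ} {w : E n} (hw : flat ε w w = α * γ)
    (i j : Fin n) (x : E n) :
    2 * quadFun ε α γ w x * pd i (pd j (quadFun ε α γ w)) x =
      (∑ k, ε k * pd k (quadFun ε α γ w) x ^ 2) * if i = j then ε i else 0 := by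
  have h : ∑ k, ε k * pd k (quadFun ε α γ w) x ^ 2 =
      4 * flat ε (γ • x - (1 : ℝ) • w) (γ • x - (1 : ℝ) • w) := by
    simp only [pd_quadFun, flat, Finset.mul_sum]
    refine Finset.sum_congr rfl fun k _ => ?_
    have : ε k ^ 2 = 1 := by rcases hε k with hk | hk <;> rw [hk] <;> norm_num
    simp
    linear_combination (4 * ε k * (γ * x k - w k) ^ 2) * this
  rw [h, flat_combination, pd_pd_quadFun, hw, quadFun]
  split_ifs <;> ring

/-- Möbius transformations are conformal, with a conformal factor that is the inverse square of a
quadratic function. -/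
lemma LocallyMoebius.exists_factor (hε : ∀ i, ε i = 1 ∨ ε i = -1) {T : E n → E n} {y : E n}
    (h : LocallyMoebius ε T y) (hT : ∀ᶠ z in 𝓝 y, DifferentiableAt ℝ T z) :
    ∃ r : E n → ℝ, ContDiff ℝ ∞ r ∧
      (∀ᶠ z in 𝓝 y, r z ≠ 0 ∧ ∀ i j, r z ^ 2 * ∑ k, ε k * (pd i T z k * pd j T z k) =
        if i = j then ε i else 0) ∧
      ∀ z i j, 2 * r z * pd i (pd j r) z = (∑ k, ε k * pd k r z ^ 2) * if i = j then ε i else 0 := by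
  obtain ⟨A, hA, hAT⟩ := h
  obtain ⟨α, γ, w, hw, hr⟩ := exists_quadratic hε hA
  refine ⟨quadFun ε α γ w, contDiff_quadFun α γ w, ?_, fun z i j => quadFun_eq hε hw i j z⟩
  have key : ∀ᶠ z in 𝓝 y, quadFun ε α γ w z ≠ 0 ∧
      A (lift ε z) = quadFun ε α γ w z • lift ε (T z) := by
    filter_upwards [hAT] with z hz
    obtain ⟨ρ, h0, hρ⟩ := hz
    -- The first component of a lift is `1`, so the scale factor is the first component of `A (lift
    -- z)`.
    have : ρ = quadFun ε α γ w z := by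
      rw [quadFun, ← hr, hρ]; simp [lift]
    exact ⟨this ▸ h0, this ▸ hρ⟩
  filter_upwards [key.eventually_nhds, hT] with z hz hTz
  refine ⟨hz.self_of_nhds.1, ?_⟩
  -- Isometry of the big form gives `r(z + tv) r(z) |T(z + tv) - T(z)|² = t² |v|²`, where `|·|²` is
  -- the flat form and `r` the quadratic function. Dividing by `t²` and letting `t → 0` yields the
  -- claim.
  have hq : ∀ v, quadFun ε α γ w z ^ 2 * flat ε (fderiv ℝ T z v) (fderiv ℝ T z v) = flat ε v v := by
    intro v
    have hd : HasDerivAt (fun t : ℝ => T (z + t • v)) (fderiv ℝ T z v) 0 :=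
      hTz.hasFDerivAt.hasLineDerivAt v
    have hsl := hd.tendsto_slope_zero
    simp only [zero_add, zero_smul, add_zero] at hsl
    have hflat : Continuous fun x : E n => flat ε x x := by unfold flat; fun_prop
    have h1 := ((hflat.tendsto _).comp hsl)
    have hcont : Continuous fun t : ℝ => z + t • v := by fun_prop
    have hlim : Filter.Tendsto (fun t : ℝ => z + t • v) (𝓝[≠] 0) (𝓝 z) := by
      have := hcont.tendsto 0
      simp only [zero_smul, add_zero] at this
      exact this.mono_left nhdsWithin_le_nhds
    have h2 : Filter.Tendsto (fun t : ℝ => quadFun ε α γ w (z + t • v)) (𝓝[≠] 0)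
        (𝓝 (quadFun ε α γ w z)) := ((contDiff_quadFun α γ w).continuous.tendsto z).comp hlim
    have h3 := (h2.mul_const (quadFun ε α γ w z)).mul h1
    have h4 : Filter.Tendsto (fun _ : ℝ => flat ε v v) (𝓝[≠] 0) (𝓝 (flat ε v v)) :=
      tendsto_const_nhds
    rw [pow_two]
    refine tendsto_nhds_unique (h3.congr' ?_) h4
    filter_upwards [hlim.eventually hz, self_mem_nhdsWithin] with t ht ht0
    have ht0' : t ≠ 0 := ht0
    have h5 := bigForm_lift_sub (ε := ε) (quadFun ε α γ w (z + t • v)) (quadFun ε α γ w z)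
      (T (z + t • v)) (T z)
    have h6 := bigForm_lift_sub (ε := ε) 1 1 (z + t • v) z
    rw [← ht.2, ← hz.self_of_nhds.2, ← map_sub, hA] at h5
    rw [one_smul, one_smul, h5, add_sub_cancel_left, one_mul, one_mul, flat_smul_smul] at h6
    simp only [Function.comp]
    rw [flat_smul_smul]
    field_simp
    linear_combination h6
  intro i j
  -- Polarization of `hq`.
  have hb : ∀ u v, quadFun ε α γ w z ^ 2 * flat ε (fderiv ℝ T z u) (fderiv ℝ T z v) =
      flat ε u v := by
    intro u v
    have h1 := hq ((1 : ℝ) • u - (1 : ℝ) • v)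
    rw [map_sub, map_smul, map_smul, flat_combination, flat_combination] at h1
    linear_combination (-1 / 2 : ℝ) * h1 + (1 / 2 : ℝ) * hq u + (1 / 2 : ℝ) * hq v
  have h1 := hb (e i) (e j)
  rw [flat_single] at h1
  have h2 : flat ε (fderiv ℝ T z (e i)) (fderiv ℝ T z (e j)) =
      ∑ k, ε k * (pd i T z k * pd j T z k) := Finset.sum_congr rfl fun k _ => by
    simp only [pd]; ring
  rw [← h2, h1]
  by_cases hij : i = j
  · subst hij; simp [e]
  · simp [e, hij, Ne.symm hij]

end Moebius

/-! ### Vanishing of the Schwarzian tensor between flat metrics -/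

section FlatSchwarzian

variable {𝕜 : Type*} [RCLike 𝕜] {R : Type*} [CommRing R] [Algebra 𝕜 R] {n : ℕ}
  {D : Fin n → Derivation 𝕜 R R} {a : MetricPair n R} {x x' r r' : R}

/-- Multiplication of a metric by an invertible element. -/
def MetricPair.scale (a : MetricPair n R) (hx : x * x' = 1) : MetricPair n R where
  g i j := x * a.g i j
  h i j := x' * a.h i j
  g_symm i j := by rw [a.g_symm]
  h_symm i j := by rw [a.h_symm]
  g_mul_h i j := by
    rw [← a.g_mul_h i j]
    exact Finset.sum_congr rfl fun k _ => by linear_combination (a.g i k * a.h k j) * hx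

/-- The Schwarzian tensor does not change when the conformal factor is divided by the square of a
function that relates the flat metric to another flat metric. -/
lemma schwR_flat (hx : x * x' = 1) (hb : ∀ i j k, D i (x * a.g j k) = 0) (hr : r * r' = 1)
    (hrr : ∀ i j, 2 * r * D i (D j r) =
      (∑ k, ∑ q, x' * a.h k q * (D k r * D q r)) * (x * a.g i j)) (i j : Fin n) :
    schwR D (levi D a) a (r' ^ 2 * x) (r ^ 2 * x') i j = schwR D (levi D a) a x x' i j := by
  obtain ⟨b, hbe⟩ : ∃ b, b = a.scale hx := ⟨_, rfl⟩
  have hg : ∀ i j, b.g i j = x * a.g i j := fun i j => by rw [hbe]; rfl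
  have hh : ∀ i j, b.h i j = x' * a.h i j := fun i j => by rw [hbe]; rfl
  simp only [← hg, ← hh] at hb hrr
  have h2 : algebraMap 𝕜 R (1 / 2) * 2 = 1 := by
    rw [← map_ofNat (algebraMap 𝕜 R) 2, ← map_mul]; norm_num
  have hc := confChange_hlog (D := D) hx hg hh
  have hr' : ∀ i, D i r' = - r' ^ 2 * D i r := fun i => by
    have := (D i).leibniz_of_mul_eq_one (show r' * r = 1 by rw [mul_comm]; exact hr)
    simpa using this
  have hd : ∀ i, D i (r' ^ 2 * x) = 2 * (hlog D x x' i + -(D i r * r')) * (r' ^ 2 * x) := fun i => by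
    rw [(D i).leibniz, hc.der, (D i).leibniz_pow, hr']
    simp only [smul_eq_mul, nsmul_eq_mul]
    push_cast
    ring
  have hxx : r' ^ 2 * x * (r ^ 2 * x') = 1 := by
    linear_combination (r * r' + 1) * x * x' * hr + hx
  rw [schwR_eq_schwU hxx hd, schwR_eq_schwU hx hc.der, ← sub_eq_zero]
  -- By the cocycle property the difference of the two tensors is the Schwarzian of the factor
  -- `r'^2` with respect to the metric `b = x a`, whose half logarithmic differential is `-dr / r`.
  have hco := hc.schwU_eq (Γ := levi D a) (Ψ := fun k => -(D k r * r')) i j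
  -- The components of `b` are constant, so its Christoffel symbols vanish and `∇` is `D`.
  have hl : addA a (hlog D x x') (levi D a) = fun _ _ _ => 0 := by
    refine hc.levi_conf.symm.trans ?_
    funext k i j
    simp [levi, hb]
  rw [← hco, hl]
  have hS : ∑ k, b.raise (fun k => -(D k r * r')) k * -(D k r * r') =
      r' ^ 2 * ∑ k, ∑ q, b.h k q * (D k r * D q r) := by
    simp only [MetricPair.raise, Finset.mul_sum, Finset.sum_mul]
    exact Finset.sum_congr rfl fun k _ => Finset.sum_congr rfl fun q _ => by ring
  simp only [schwU, covC, hS, zero_mul, Finset.sum_const_zero, sub_zero, map_neg,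
    Derivation.leibniz, smul_eq_mul, hr']
  linear_combination (algebraMap 𝕜 R (1 / 2) * r' ^ 2) * hrr i j
    - r' * (D i (D j r)) * (r * r') * h2 - r' * D i (D j r) * hr

end FlatSchwarzian

/-! ### Curvature and Schwarzian corrections as tensor fields -/

section Fields

variable {𝕜 : Type*} [RCLike 𝕜] {n : ℕ} {M : Type*} [TopologicalSpace M] [ChartedSpace (E n) M]
  [IsManifold (𝓡 n) ∞ M] {c d : Chart n M} {s t : TopologicalSpace.Opens (E n)} {g : Metric n M}
  {U : ModelAtlas n M}

lemma exists_inverse {f : smoothAlg 𝕜 s} (h : ∀ y, ev y f ≠ 0) : ∃ f', f * f' = 1 := by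
  obtain ⟨F, hF, hf⟩ := exists_rep f
  have h0 : ∀ y ∈ s, F y ≠ 0 := fun y hy => by rw [hf y hy]; exact h _
  refine ⟨restr (fun y => (F y)⁻¹) (hF.inv h0), hf.inv_mul (rep_restr _) fun y hy => ?_⟩
  exact mul_inv_cancel₀ (h0 y hy)

/-! ### Dimension at least three -/

/-- The tensor that is contracted with the symbol in dimension `n ≥ 3`. -/
def curvX (l m : 𝕜) (G : E n → Matrix (Fin n) (Fin n) 𝕜) (y : E n) (i j : Fin n) : 𝕜 :=
  beta5 n l m * ricci G i j y + beta6 n l m * scal G y * G y i j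

lemma rep_curvX (l m : 𝕜) {G : E n → Matrix (Fin n) (Fin n) 𝕜} {a : MetricPair n (smoothAlg 𝕜 s)}
    (ha : RepMetric G a) (i j : Fin n) : Rep (fun y => curvX l m G y i j)
      (algebraMap 𝕜 _ (beta5 n l m) * ricc (der 𝕜 s) (levi (der 𝕜 s) a) i j
        + algebraMap 𝕜 _ (beta6 n l m) * scalR (der 𝕜 s) (levi (der 𝕜 s) a) a * a.g i j) :=
  fun y hy => by
  simp only [curvX, map_add, map_mul, AlgHom.commutes, Algebra.algebraMap_self, RingHom.id_apply,
    Rep.ricci ha _ _ y hy, Rep.scal ha y hy, ha.g _ _ y hy]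

lemma curvTerm_eq_sum (l m : 𝕜) (G : E n → Matrix (Fin n) (Fin n) 𝕜) (P : E n → Fin n → Fin n → 𝕜)
    (y : E n) : curvTerm G l m P y = ∑ i, ∑ j, curvX l m G y i j * P y i j := by
  simp only [curvTerm, curvX, add_mul, Finset.sum_add_distrib, Finset.mul_sum, mul_assoc]

lemma isTensorOn_curvX (l m : 𝕜) (g : Metric n M) :
    IsTensorOn Set.univ (fun c => curvX l m (toField (g.coeff c))) where
  smooth c _ i j := (rep_curvX l m (g.rep_on (s := tgt c) fun _ h => h) i j).contDiffOn
  cov c _ d _ y hy i j := by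
    have h := ovl_to c d
    have ht : ∀ y ∈ tgt d, y ∈ d.1.target := fun _ hy => hy
    have hr := g.on_rel (𝕜 := 𝕜) h ht
    have hc : (coordChange 𝕜 h).ConnRel _ _ := (coordChange 𝕜 h).levi_rel hr
    have e := congrArg (ev ⟨y, hy⟩) (congrArg₂
      (fun u v => algebraMap 𝕜 _ (beta5 n l m) * u + algebraMap 𝕜 _ (beta6 n l m) * v)
      (hc.ricc_eq der_comm (levi_symm _) (levi_symm _) i j)
      (congrArg₂ (fun u v => u * v) (hr.scalR_eq der_comm) (hr i j)))
    have e1 := rep_curvX l m (g.rep_on (𝕜 := 𝕜) (s := ovl c d) fun y hy => (h y hy).1.1) i j y hy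
    rw [← mul_assoc] at e
    refine (e1.trans e).trans ?_
    have e2 : ∀ k q, curvX l m (toField (g.coeff d)) (trans c d y) k q = _ := fun k q =>
      rep_curvX l m (g.rep_on (𝕜 := 𝕜) ht) k q _ (h y hy).2
    simp only [e2, map_add, map_mul, map_sum, AlgHom.commutes, Finset.mul_sum, mul_add,
      Finset.sum_add_distrib]
    congr 1
    · refine Finset.sum_congr rfl fun k _ => Finset.sum_congr rfl fun q _ => ?_
      rw [mul_left_comm]
      rfl
    · refine Finset.sum_congr rfl fun k _ => Finset.sum_congr rfl fun q _ => ?_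
      rw [mul_left_comm _ (_ * _), mul_assoc]
      exact (by intros; ring : ∀ a b c d e : 𝕜, a * (b * (c * (d * e))) = b * c * (a * d * e)) _ _ _ _ _

/-! ### Dimension two -/

/-- `confFactor` is a normalized trace; as the trace of `g⁻¹ g` is `n`, it recovers the factor of
proportional metrics. -/
lemma confFactor_of_smul (hn : n ≠ 0) {G H : E n → Matrix (Fin n) (Fin n) 𝕜} {y : E n} {τ : 𝕜}
    (hs : (G y).IsSymm) (hd : (G y).det ≠ 0) (h : H y = τ • G y) : confFactor G H y = τ := by
  have e : ∑ i, ∑ j, (G y)⁻¹ i j * G y i j = n := by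
    have h1 := congrArg Matrix.trace (Matrix.nonsing_inv_mul (G y) (isUnit_iff_ne_zero.2 hd))
    simp only [Matrix.trace, Matrix.diag_apply, Matrix.mul_apply, Matrix.one_apply_eq,
      Finset.sum_const, Finset.card_univ, Fintype.card_fin, nsmul_eq_mul, mul_one] at h1
    rw [← h1]
    exact Finset.sum_congr rfl fun i _ => Finset.sum_congr rfl fun j _ => by rw [hs.apply i j]
  have hn' : (n : 𝕜) ≠ 0 := Nat.cast_ne_zero.2 hn
  simp only [confFactor, h, Matrix.smul_apply, smul_eq_mul, mul_left_comm _ τ, ← Finset.mul_sum, e]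
  exact mul_div_cancel_right₀ _ hn'

/-- The tensor that is contracted with the symbol in dimension two. -/
def schwX (l m : 𝕜) (G H : E n → Matrix (Fin n) (Fin n) 𝕜) (y : E n) (i j : Fin n) : 𝕜 :=
  4 * l * (m - 1) / (2 * (m - l) - 3) *
    (schwarz G (confFactor G H) i j y + 1 / (8 * ((m - l) - 1)) * scal G y * G y i j)

lemma schwarzTerm_eq_sum (l m : 𝕜) (G H : E n → Matrix (Fin n) (Fin n) 𝕜)
    (P : E n → Fin n → Fin n → 𝕜) (y : E n) :
    schwarzTerm G H l m P y = ∑ i, ∑ j, schwX l m G H y i j * P y i j := by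
  simp only [schwarzTerm, schwX, mul_add, add_mul, Finset.sum_add_distrib, Finset.mul_sum, mul_assoc]

/-- The tensor that is contracted with the symbol in dimension two, as an element of a ring. -/
def schwXR (l m : 𝕜) (a : MetricPair n (smoothAlg 𝕜 s)) (x x' : smoothAlg 𝕜 s) (i j : Fin n) :
    smoothAlg 𝕜 s :=
  algebraMap 𝕜 _ (4 * l * (m - 1) / (2 * (m - l) - 3)) *
    (schwR (der 𝕜 s) (levi (der 𝕜 s) a) a x x' i j
      + algebraMap 𝕜 _ (1 / (8 * ((m - l) - 1))) * scalR (der 𝕜 s) (levi (der 𝕜 s) a) a * a.g i j)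

lemma rep_schwX (l m : 𝕜) {G H : E n → Matrix (Fin n) (Fin n) 𝕜} {a : MetricPair n (smoothAlg 𝕜 s)}
    {x x' : smoothAlg 𝕜 s} (ha : RepMetric G a) (hx : Rep (confFactor G H) x) (hxx : x * x' = 1)
    (i j : Fin n) : Rep (fun y => schwX l m G H y i j) (schwXR l m a x x' i j) := fun y hy => by
  simp only [schwX, schwXR, map_add, map_mul, AlgHom.commutes, Algebra.algebraMap_self,
    RingHom.id_apply, Rep.schwarz ha hx hxx _ _ y hy, Rep.scal ha y hy, ha.g _ _ y hy]

lemma contDiffOn_confFactor {G H : E n → Matrix (Fin n) (Fin n) 𝕜} {A : Set (E n)}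
    (hG : ∀ i j, ContDiffOn ℝ ∞ (fun y => G y i j) A) (hd : ∀ y ∈ A, (G y).det ≠ 0)
    (hH : ∀ i j, ContDiffOn ℝ ∞ (fun y => H y i j) A) : ContDiffOn ℝ ∞ (confFactor G H) A := by
  have : ContDiffOn ℝ ∞ (fun y => (∑ i, ∑ j, (G y)⁻¹ i j * H y i j) * (n : 𝕜)⁻¹) A :=
    (ContDiffOn.sum fun i _ => ContDiffOn.sum fun j _ =>
      (contDiffOn_inv hG hd i j).mul (hH i j)).mul contDiffOn_const
  exact this.congr fun y _ => div_eq_mul_inv _ _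

lemma contDiffOn_model {ε : Fin n → ℝ} {K : ℝ} {A : Set (E n)}
    (h : ∀ y ∈ A, 1 + K / 4 * flat ε y y ≠ 0) (i j : Fin n) :
    ContDiffOn ℝ ∞ (fun y => model ε K y i j) A := by
  have h1 : ContDiff ℝ ∞ (fun x : E n => flat ε x x) :=
    ContDiff.sum fun k _ => (contDiff_const.mul (contDiff_coord k)).mul (contDiff_coord k)
  by_cases hij : i = j
  · subst hij
    simp only [model, Matrix.diagonal_apply_eq]
    exact contDiffOn_const.div ((contDiff_const.add (contDiff_const.mul h1)).pow 2).contDiffOn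
      fun y hy => pow_ne_zero _ (h y hy)
  · simp only [model, Matrix.diagonal_apply_ne _ hij]
    exact contDiffOn_const

lemma toField_symm (g : Metric n M) {y : E n} (hy : y ∈ c.1.target) :
    (toField (𝕜 := 𝕜) (g.coeff c) y).IsSymm := (g.symm c y hy).map _

lemma toField_det_ne_zero (g : Metric n M) {y : E n} (hy : y ∈ c.1.target) :
    (toField (𝕜 := 𝕜) (g.coeff c) y).det ≠ 0 := by
  rw [toField_det]; exact_mod_cast g.nondeg c y hy

lemma toField_smul {G H : E n → Matrix (Fin n) (Fin n) ℝ} {y : E n} {τ : ℝ} (h : H y = τ • G y) :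
    toField (𝕜 := 𝕜) H y = (τ : 𝕜) • toField G y := by
  ext i j
  simp [toField, h]

variable (hU : U.Uniformizes g)

lemma coeff_pullback (g : Metric n M) {c d : Chart n M} {y : E n} (hy : y ∈ overlap c d) :
    (jac c d y)ᵀ * g.coeff d (trans c d y) * jac c d y = g.coeff c y := by
  ext i j
  rw [g.compat c d y hy]
  simp only [Matrix.mul_apply, Matrix.transpose_apply, Finset.sum_mul]
  rw [Finset.sum_comm]
  exact Finset.sum_congr rfl fun k _ => Finset.sum_congr rfl fun q _ => by ring

include hU in
lemma exists_pullback_eq {a : Chart n M} (ha : a ∈ U.charts) {y : E n} (hy : y ∈ overlap c a) :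
    ∃ τ : ℝ, 0 < τ ∧ U.pullback a c y = τ • g.coeff c y ∧
      model U.sign U.curv (trans c a y) = τ • g.coeff a (trans c a y) := by
  obtain ⟨τ, h0, hτ⟩ := hU.conformal a ha (trans c a y) (trans_mem hy).1
  refine ⟨τ, h0, ?_, hτ.symm⟩
  rw [ModelAtlas.pullback, ← hτ, Matrix.mul_smul, Matrix.smul_mul, coeff_pullback g hy]

include hU in
lemma exists_confFactor (hn : n ≠ 0) {a : Chart n M} (ha : a ∈ U.charts) {y : E n}
    (hy : y ∈ overlap c a) : ∃ τ : ℝ, 0 < τ ∧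
      confFactor (toField (𝕜 := 𝕜) (g.coeff c)) (toField (U.pullback a c)) y = τ ∧
      confFactor (toField (𝕜 := 𝕜) (g.coeff a)) (toField (model U.sign U.curv)) (trans c a y) = τ := by
  obtain ⟨τ, h0, h1, h2⟩ := exists_pullback_eq hU ha hy
  exact ⟨τ, h0, confFactor_of_smul hn (toField_symm g hy.1) (toField_det_ne_zero g hy.1)
    (toField_smul h1), confFactor_of_smul hn (toField_symm g (trans_mem hy).1)
    (toField_det_ne_zero g (trans_mem hy).1) (toField_smul h2)⟩

include hU in
lemma contDiffOn_confFactor_model {a : Chart n M} (ha : a ∈ U.charts) : ContDiffOn ℝ ∞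
    (confFactor (toField (𝕜 := 𝕜) (g.coeff a)) (toField (model U.sign U.curv))) a.1.target :=
  contDiffOn_confFactor (fun i j => contDiffOn_ofReal (g.smooth a i j))
    (fun _ hy => toField_det_ne_zero g hy)
    (fun i j => contDiffOn_ofReal (contDiffOn_model (hU.regular a ha) i j))

include hU in
/-- The conformal factor of the model metric, in the coordinates of the identification. -/
lemma exists_confFactor_unit (hn : n ≠ 0) {a : Chart n M} (ha : a ∈ U.charts)
    (h : ∀ y ∈ s, y ∈ a.1.target) : ∃ x x' : smoothAlg 𝕜 s,
      Rep (confFactor (toField (g.coeff a)) (toField (model U.sign U.curv))) x ∧ x * x' = 1 := by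
  have hx := rep_restr (𝕜 := 𝕜) (s := s) ((contDiffOn_confFactor_model (𝕜 := 𝕜) hU ha).mono h)
  obtain ⟨x', hx'⟩ := exists_inverse (f := restr _ ((contDiffOn_confFactor_model (𝕜 := 𝕜) hU ha).mono h))
    fun y => by
      obtain ⟨τ, h0, -, hτ⟩ := exists_confFactor (𝕜 := 𝕜) hU hn ha (overlap_self (h y y.2))
      rw [trans_self (h y y.2)] at hτ
      rw [← hx y y.2, hτ]
      exact_mod_cast h0.ne'
  exact ⟨_, x', hx, hx'⟩

lemma schwXR_rel {a : MetricPair n (smoothAlg 𝕜 s)} {a' : MetricPair n (smoothAlg 𝕜 t)}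
    {T : CoordChange (der 𝕜 s) (der 𝕜 t)} (ha : T.MetricRel a a') (l m : 𝕜) (x x' : smoothAlg 𝕜 t)
    (i j : Fin n) : schwXR l m a (T.τ x) (T.τ x') i j =
      ∑ p, ∑ q, T.J p i * T.J q j * T.τ (schwXR l m a' x x' p q) := by
  have h : T.ConnRel (levi (der 𝕜 s) a) (levi (der 𝕜 t) a') := T.levi_rel ha
  rw [schwXR, h.schwR_eq ha, ha.scalR_eq der_comm, ha i j, Finset.mul_sum, ← Finset.sum_add_distrib,
    Finset.mul_sum]
  refine Finset.sum_congr rfl fun p _ => ?_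
  rw [Finset.mul_sum, ← Finset.sum_add_distrib, Finset.mul_sum]
  refine Finset.sum_congr rfl fun q _ => ?_
  rw [schwXR, map_mul, map_add, map_mul, map_mul, AlgHom.commutes, AlgHom.commutes]
  ring

include hU in
/-- The Schwarzian term is a tensor. -/
lemma schwX_trans (hn : n ≠ 0) (l m : 𝕜) {a : Chart n M} (ha : a ∈ U.charts) {y : E n}
    (hy : y ∈ overlap c a) (i j : Fin n) :
    schwX l m (toField (g.coeff c)) (toField (U.pullback a c)) y i j =
      ∑ k, ∑ q, (jac c a y k i : 𝕜) * (jac c a y q j : 𝕜) *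
        schwX l m (toField (g.coeff a)) (toField (model U.sign U.curv)) (trans c a y) k q := by
  have h := ovl_to c a
  have ht : ∀ y ∈ tgt a, y ∈ a.1.target := fun _ hy => hy
  obtain ⟨x, x', hx, hxx⟩ := exists_confFactor_unit (𝕜 := 𝕜) (s := tgt a) hU hn ha ht
  -- Both metrics are pulled back by the same Jacobian, so their ratio is a scalar function and has
  -- the same value in the two charts.
  have hx2 : Rep (confFactor (toField (g.coeff c)) (toField (U.pullback a c)))
      ((coordChange 𝕜 h).τ x) := (hx.pull h).congr fun z hz => by
    obtain ⟨τ, -, h1, h2⟩ := exists_confFactor (𝕜 := 𝕜) hU hn ha (h z hz).1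
    rw [h1, h2]
  have hxx2 : (coordChange 𝕜 h).τ x * (coordChange 𝕜 h).τ x' = 1 := by rw [← map_mul, hxx, map_one]
  have e := congrArg (ev ⟨y, hy⟩) (schwXR_rel (g.on_rel h ht) l m x x' i j)
  rw [← rep_schwX l m (g.rep_on _) hx2 hxx2 i j y hy] at e
  have e2 : ∀ k q, schwX l m (toField (g.coeff a)) (toField (model U.sign U.curv)) (trans c a y) k q = _ :=
    fun k q => rep_schwX l m (g.rep_on ht) hx hxx k q _ (h y hy).2
  simp only [e, e2, map_sum, map_mul]
  rfl

end Fields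

/-! ### Independence of the identification; the volume function -/

section Identifications

variable {𝕜 : Type*} [RCLike 𝕜] {n : ℕ} {M : Type*} [TopologicalSpace M] [ChartedSpace (E n) M]
  [IsManifold (𝓡 n) ∞ M] {c d : Chart n M} {s t : TopologicalSpace.Opens (E n)} {g : Metric n M}
  {U : ModelAtlas n M} (hU : U.Uniformizes g)

lemma pd_pd_ofReal {r : E n → ℝ} (hr : ContDiff ℝ ∞ r) (i j : Fin n) (z : E n) :
    pd i (pd j (fun z => (r z : 𝕜))) z = ((pd i (pd j r) z : ℝ) : 𝕜) := by
  have h1 : pd j (fun z => (r z : 𝕜)) = fun z => ((pd j r z : ℝ) : 𝕜) := by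
    funext z
    exact pd_ofReal (hr.differentiable (by simp) z) j
  have h2 : ContDiffOn ℝ ∞ (pd j r) Set.univ := contDiffOn_pd isOpen_univ hr.contDiffOn j
  rw [h1, pd_ofReal ((contDiffOn_univ.1 h2).differentiable (by simp) z)]

include hU in
/-- The quadratic function of a change of identifications, on a neighbourhood of a point. -/
lemma exists_factor_nhds {a b : Chart n M} (ha : a ∈ U.charts) (hb : b ∈ U.charts) {y : E n}
    (hy : y ∈ overlap a b) : ∃ (s : TopologicalSpace.Opens (E n)) (r : E n → ℝ), y ∈ s ∧
      ContDiff ℝ ∞ r ∧ (∀ z ∈ s, z ∈ overlap a b) ∧ (∀ z ∈ s, r z ≠ 0) ∧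
      (∀ z ∈ s, ∀ i j, r z ^ 2 * ∑ k, U.sign k * (jac a b z k i * jac a b z k j) =
        if i = j then U.sign i else 0) ∧
      ∀ z i j, 2 * r z * pd i (pd j r) z =
        (∑ k, U.sign k * pd k r z ^ 2) * if i = j then U.sign i else 0 := by
  have ho := (isOpen_overlap a b).mem_nhds hy
  obtain ⟨r, hr, hev, hq⟩ := (hU.moebius a ha b hb y hy).exists_factor hU.sign_eq
    (Filter.eventually_of_mem ho fun z hz => differentiableAt_trans hz)
  obtain ⟨s, hs, hso, hys⟩ := mem_nhds_iff.1 (hev.and ho)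
  exact ⟨⟨s, hso⟩, r, hys, hr, fun z hz => (hs hz).2, fun z hz => (hs hz).1.1,
    fun z hz => (hs hz).1.2, hq⟩

include hU in
lemma sign_mul_self (i : Fin n) : U.sign i * U.sign i = 1 := by
  rcases hU.sign_eq i with h | h <;> rw [h] <;> norm_num

include hU in
/-- The Schwarzian term does not depend on the identification. -/
lemma schwX_indep (hn : n ≠ 0) (l m : 𝕜) {a b : Chart n M} (ha : a ∈ U.charts) (hb : b ∈ U.charts)
    {y : E n} (hy : y ∈ overlap a b) (i j : Fin n) :
    schwX l m (toField (g.coeff a)) (toField (model U.sign U.curv)) y i j =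
      schwX l m (toField (g.coeff a)) (toField (U.pullback b a)) y i j := by
  -- For zero curvature the local metrics `φ^* g₀` may differ, but both are flat and related by a
  -- Möbius factor, so `schwR_flat` applies. For non-zero curvature they coincide by hypothesis.
  by_cases hK : U.curv = 0
  · obtain ⟨s, r, hys, hr, hs, h0, hJ, hrr⟩ := exists_factor_nhds hU ha hb hy
    have hst : ∀ z ∈ s, z ∈ a.1.target := fun z hz => (hs z hz).1
    have hmod : ∀ z, model U.sign U.curv z = Matrix.diagonal U.sign := fun z => by
      rw [hK, model]; simp
    obtain ⟨x, x', hx, hxx⟩ := exists_confFactor_unit (𝕜 := 𝕜) (s := s) hU hn ha hst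
    have hrs : ContDiffOn ℝ ∞ (fun z => (r z : 𝕜)) s := contDiffOn_ofReal hr.contDiffOn
    have hrr' := rep_restr (s := s) hrs
    obtain ⟨R, hR⟩ : ∃ R, R = restr _ hrs := ⟨_, rfl⟩
    rw [← hR] at hrr'
    obtain ⟨R', hRR⟩ := exists_inverse (f := R) fun z => by
      rw [← hrr' z z.2]; exact RCLike.ofReal_ne_zero.2 (h0 z z.2)
    -- In the coordinates of `a` the model metric is the constant diagonal matrix of signs; `hH` is
    -- the same for the inverse.
    have hG : ∀ j k, x * (g.on 𝕜 hst).g j k =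
        algebraMap 𝕜 _ (if j = k then (U.sign j : 𝕜) else 0) := fun j k => by
      refine smoothAlg_ext fun z => ?_
      obtain ⟨τ, -, h1, h2⟩ := exists_pullback_eq hU ha (overlap_self (hst z z.2))
      rw [trans_self (hst z z.2)] at h2
      have h3 := confFactor_of_smul (𝕜 := 𝕜) hn (toField_symm g (hst z z.2))
        (toField_det_ne_zero g (hst z z.2)) (toField_smul h2)
      rw [map_mul, ← hx z z.2, h3, ← (g.rep_on hst).g j k z z.2, AlgHom.commutes]
      have h4 := congrFun (congrFun h2 j) k
      rw [hmod, Matrix.smul_apply, smul_eq_mul] at h4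
      change (τ : 𝕜) * ((g.coeff a z j k : ℝ) : 𝕜) = _
      rw [← RCLike.ofReal_mul, ← h4, Matrix.diagonal_apply]
      split_ifs <;> simp
    have hH : ∀ j k, x' * (g.on 𝕜 hst).h j k =
        algebraMap 𝕜 _ (if j = k then (U.sign j : 𝕜) else 0) := fun j k => by
      have h1 := ((g.on 𝕜 hst).scale hxx).g_mul_h j k
      have h2 : ∀ p, ((g.on 𝕜 hst).scale hxx).g j p = _ := hG j
      simp only [h2, apply_ite (algebraMap 𝕜 (smoothAlg 𝕜 s)), map_zero, ite_mul, zero_mul,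
        Finset.sum_ite_eq, Finset.mem_univ, if_true] at h1
      have h3 : algebraMap 𝕜 (smoothAlg 𝕜 s) (U.sign j) * algebraMap 𝕜 (smoothAlg 𝕜 s) (U.sign j) = 1 := by
        rw [← map_mul, ← RCLike.ofReal_mul, sign_mul_self hU, RCLike.ofReal_one, map_one]
      have h4 : ((g.on 𝕜 hst).scale hxx).h j k = x' * (g.on 𝕜 hst).h j k := rfl
      rw [h4] at h1
      split_ifs at h1 ⊢
      · linear_combination algebraMap 𝕜 (smoothAlg 𝕜 s) (U.sign j) * h1 - x' * (g.on 𝕜 hst).h j k * h3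
      · rw [map_zero]
        linear_combination algebraMap 𝕜 (smoothAlg 𝕜 s) (U.sign j) * h1 - x' * (g.on 𝕜 hst).h j k * h3
    have hpf := schwR_flat (D := der 𝕜 s) (a := g.on 𝕜 hst) hxx
      (fun i j k => by rw [hG]; exact der_algebraMap i _) hRR (fun i j => by
        simp only [hG, hH]
        refine smoothAlg_ext fun z => ?_
        have h1 := congrArg (fun t : ℝ => (t : 𝕜)) (hrr z i j)
        simp only [RCLike.ofReal_mul, RCLike.ofReal_sum, RCLike.ofReal_pow] at h1
        simp only [map_mul, map_sum, ← hrr' z z.2, ← hrr'.pd _ z z.2, ← (hrr'.pd _).pd _ z z.2,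
          pd_pd_ofReal hr, pd_ofReal (hr.differentiable (by simp) z), AlgHom.commutes, map_ofNat,
          Algebra.algebraMap_self, RingHom.id_apply, ite_mul, zero_mul, Finset.sum_ite_eq,
          Finset.mem_univ, if_true]
        rw [RCLike.ofReal_ofNat] at h1
        refine h1.trans ?_
        congr 1
        · exact Finset.sum_congr rfl fun k _ => by ring
        · split_ifs <;> simp) i j
    -- The change of identifications pulls the flat metric back to `r⁻²` times itself, so the factor
    -- for `b` is `R' ^ 2` times the one for `a`.
    have hx2 : Rep (confFactor (toField (g.coeff a)) (toField (U.pullback b a))) (R' ^ 2 * x) := by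
      intro z hz
      obtain ⟨τ, -, h1, h2⟩ := exists_pullback_eq hU ha (overlap_self (hst z hz))
      rw [trans_self (hst z hz)] at h2
      have h3 := confFactor_of_smul (𝕜 := 𝕜) hn (toField_symm g (hst z hz))
        (toField_det_ne_zero g (hst z hz)) (toField_smul h2)
      have h4 : U.pullback b a z = ((r z ^ 2)⁻¹ * τ) • g.coeff a z := by
        rw [mul_smul, ← h2, hmod]
        ext p q
        rw [ModelAtlas.pullback, hmod, Matrix.mul_apply, Matrix.smul_apply, Matrix.diagonal_apply,
          ← hJ z hz p q, smul_eq_mul, inv_mul_cancel_left₀ (pow_ne_zero 2 (h0 z hz))]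
        refine Finset.sum_congr rfl fun k _ => ?_
        rw [Matrix.mul_diagonal, Matrix.transpose_apply]; ring
      have h5 : (r z : 𝕜) * ev ⟨z, hz⟩ R' = 1 := by
        have h6 : (r z : 𝕜) = ev ⟨z, hz⟩ R := hrr' z hz
        rw [h6, ← map_mul, hRR, map_one]
      rw [confFactor_of_smul (𝕜 := 𝕜) hn (toField_symm g (hst z hz))
        (toField_det_ne_zero g (hst z hz)) (toField_smul h4), map_mul, ← hx z hz, h3, map_pow,
        eq_inv_of_mul_eq_one_right h5]
      push_cast
      rw [inv_pow]
    have hxx2 : R' ^ 2 * x * (R ^ 2 * x') = 1 := by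
      linear_combination (R * R' + 1) * x * x' * hRR + hxx
    refine (rep_schwX l m (g.rep_on hst) hx hxx i j y hys).trans
      (Eq.trans ?_ (rep_schwX l m (g.rep_on hst) hx2 hxx2 i j y hys).symm)
    rw [schwXR, schwXR, hpf]
  · have hst : ∀ z ∈ ovl a b, z ∈ a.1.target := fun z hz => hz.1
    obtain ⟨x, x', hx, hxx⟩ := exists_confFactor_unit (𝕜 := 𝕜) (s := ovl a b) hU hn ha hst
    have hp : ∀ z ∈ ovl a b, U.pullback b a z = model U.sign U.curv z := fun z hz => by
      ext p q
      rw [hU.isometry hK a ha b hb z hz p q]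
      simp only [ModelAtlas.pullback, Matrix.mul_apply, Matrix.transpose_apply, Finset.sum_mul]
      rw [Finset.sum_comm]
      exact Finset.sum_congr rfl fun k _ => Finset.sum_congr rfl fun r _ => by ring
    have hx2 : Rep (confFactor (toField (g.coeff a)) (toField (U.pullback b a))) x :=
      hx.congr fun z hz => by simp only [confFactor, toField, hp z hz]
    exact (rep_schwX l m (g.rep_on hst) hx hxx i j y hy).trans
      (rep_schwX l m (g.rep_on hst) hx2 hxx i j y hy).symm

-- Covariance between identifications takes two moves: `schwX_indep` exchanges the model metric of
-- `a` for that of `b` in fixed coordinates, then `schwX_trans` changes the coordinates.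
include hU in
lemma isTensorOn_schwX (hn : n ≠ 0) (l m : 𝕜) : IsTensorOn U.charts
    (fun a => schwX l m (toField (g.coeff a)) (toField (model U.sign U.curv))) where
  smooth a ha i j := by
    obtain ⟨x, x', hx, hxx⟩ := exists_confFactor_unit (𝕜 := 𝕜) (s := tgt a) hU hn ha fun _ h => h
    exact (rep_schwX l m (g.rep_on (s := tgt a) fun _ h => h) hx hxx i j).contDiffOn
  cov a ha b hb y hy i j := by
    rw [schwX_indep hU hn l m ha hb hy]
    exact schwX_trans hU hn l m hb hy i j

/-! ### Dimension one -/

/-- The tensor that is contracted with the symbol in dimension one. -/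
def schwOneX (l m : 𝕜) (u : E n → 𝕜) (y : E n) (i j : Fin n) : 𝕜 :=
  -(2 * l * (m - 1) / (3 - 2 * (m - l))) * schwarz1 u i j y

lemma rep_schwarz1 {u : E n → 𝕜} {x x' : smoothAlg 𝕜 s} (hx : Rep u x) (hxx : x * x' = 1)
    (i j : Fin n) : Rep (schwarz1 u i j) (schwOneR (der 𝕜 s) x x' i j) := fun y hy => by
  have e : ev ⟨y, hy⟩ x' = (u y)⁻¹ := by
    refine eq_inv_of_mul_eq_one_right ?_
    rw [hx y hy, ← map_mul, hxx, map_one]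
  simp only [schwarz1, schwOneR, map_mul, map_sub, AlgHom.commutes, Algebra.algebraMap_self,
    RingHom.id_apply, e, (hx.pd _) y hy, ((hx.pd _).pd _) y hy, div_eq_mul_inv]

/-- The square root of the absolute value of the determinant of a metric. -/
def volume (𝕜 : Type*) [RCLike 𝕜] (g : Metric n M) (c : Chart n M) (z : E n) : 𝕜 :=
  ((√|(g.coeff c z).det| : ℝ) : 𝕜)

lemma contDiffOn_volume (g : Metric n M) (c : Chart n M) :
    ContDiffOn ℝ ∞ (volume 𝕜 g c) c.1.target := by
  have h1 : ContDiffOn ℝ ∞ (fun y => (g.coeff c y).det) c.1.target := contDiffOn_det (g.smooth c)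
  exact contDiffOn_ofReal ((h1.abs (g.nondeg c)).sqrt fun y hy => abs_ne_zero.2 (g.nondeg c y hy))

lemma volume_ne_zero (g : Metric n M) {y : E n} (hy : y ∈ c.1.target) : volume 𝕜 g c y ≠ 0 := by
  have : √|(g.coeff c y).det| ≠ 0 :=
    (Real.sqrt_ne_zero (abs_nonneg _)).2 (abs_ne_zero.2 (g.nondeg c y hy))
  exact RCLike.ofReal_ne_zero.2 this

lemma exists_volume_unit (𝕜 : Type*) [RCLike 𝕜] (g : Metric n M) (h : ∀ y ∈ s, y ∈ c.1.target) :
    ∃ x x' : smoothAlg 𝕜 s, Rep (volume 𝕜 g c) x ∧ x * x' = 1 := by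
  have hx := rep_restr (s := s) ((contDiffOn_volume (𝕜 := 𝕜) g c).mono h)
  obtain ⟨x', hx'⟩ := exists_inverse (f := restr _ ((contDiffOn_volume (𝕜 := 𝕜) g c).mono h))
    fun y => by
      rw [← hx y y.2]
      exact volume_ne_zero g (h y y.2)
  exact ⟨_, x', hx, hx'⟩

lemma volume_trans (g : Metric n M) {y : E n} (hy : y ∈ overlap c d) : volume 𝕜 g c y =
    ((|(jac c d y).det| : ℝ) : 𝕜) * volume 𝕜 g d (trans c d y) := by
  rw [volume, ← coeff_pullback g hy, Matrix.det_mul, Matrix.det_mul, Matrix.det_transpose, volume,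
    ← RCLike.ofReal_mul]
  congr 1
  rw [abs_mul, abs_mul, show ∀ a b : ℝ, a * b * a = a ^ 2 * b from fun a b => by ring,
    Real.sqrt_mul (sq_nonneg _), Real.sqrt_sq (abs_nonneg _)]

end Identifications

/-! ### The Schwarzian derivative as a tensor field on a curve -/

section DimensionOne

variable {𝕜 : Type*} [RCLike 𝕜] {M : Type*} [TopologicalSpace M] [ChartedSpace (E 1) M]
  [IsManifold (𝓡 1) ∞ M] {g : Metric 1 M} {U : ModelAtlas 1 M} (hU : U.Uniformizes g)

include hU in
lemma isTensorOn_schwOneX (l m : 𝕜) : IsTensorOn U.charts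
    (fun a => schwOneX l m (volume 𝕜 g a)) where
  smooth a ha i j := by
    obtain ⟨x, x', hx, hxx⟩ := exists_volume_unit (s := tgt a) 𝕜 g (c := a) fun _ h => h
    exact contDiffOn_const.mul (rep_schwarz1 hx hxx i j).contDiffOn
  cov a ha b hb y hy i j := by
    obtain ⟨s, r, hys, hr, hs, h0, hJ, hrr⟩ := exists_factor_nhds hU ha hb hy
    have h : ∀ y ∈ s, y ∈ overlap a b ∧ trans a b y ∈ tgt b := fun y hy => ovl_to a b y (hs y hy)
    have ht : ∀ y ∈ tgt b, y ∈ b.1.target := fun _ hy => hy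
    obtain ⟨x, x', hx, hxx⟩ := exists_volume_unit 𝕜 g ht
    obtain ⟨T, hT⟩ : ∃ T, T = coordChange 𝕜 h := ⟨_, rfl⟩
    have hv := rep_restr (𝕜 := 𝕜) (s := s) (contDiffOn_ofReal
      (((contDiffOn_det_jac a b).mono hs).abs fun z hz => det_jac_ne_zero (hs z hz)))
    obtain ⟨v, hve⟩ : ∃ v, v = restr (𝕜 := 𝕜) (s := s) _ (contDiffOn_ofReal
      (((contDiffOn_det_jac a b).mono hs).abs fun z hz => det_jac_ne_zero (hs z hz))) := ⟨_, rfl⟩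
    rw [← hve] at hv
    obtain ⟨v', hvv⟩ := exists_inverse (f := v) fun z => by
      rw [← hv z z.2]
      exact RCLike.ofReal_ne_zero.2 (abs_ne_zero.2 (det_jac_ne_zero (hs z z.2)))
    have hR := rep_restr (𝕜 := 𝕜) (s := s) (contDiffOn_ofReal hr.contDiffOn)
    obtain ⟨R, hRe⟩ : ∃ R, R = restr (𝕜 := 𝕜) (s := s) _ (contDiffOn_ofReal hr.contDiffOn) :=
      ⟨_, rfl⟩
    rw [← hRe] at hR
    have hx2 : Rep (volume 𝕜 g a) (v * T.τ x) := by
      rw [hT]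
      exact (hv.mul (hx.pull h)).congr fun z hz => volume_trans g (hs z hz)
    have hxx2 : v * T.τ x * (v' * T.τ x') = 1 := by
      have : T.τ x * T.τ x' = 1 := by rw [← map_mul, hxx, map_one]
      linear_combination v * v' * this + hvv
    have hTJ : ∀ z : s, ev z (T.J 0 0) = ((jac a b z 0 0 : ℝ) : 𝕜) := fun z => by rw [hT]; rfl
    -- Here `v` is the absolute value of the Jacobian, by which the volume functions are related,
    -- and `R` is the quadratic function of the Möbius map. Conformality gives `(R v)² = 1`; the
    -- differential equation is `hrr`, in which the sign occurs squared.
    have h1 := T.schwOneR_eq (v := v) (v' := v') (r := R) hxx hvv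
      (smoothAlg_ext fun z => by
        rw [map_mul, map_mul, ← hv z z.2, hTJ, ← RCLike.ofReal_mul, ← RCLike.ofReal_mul,
          abs_mul_abs_self, Matrix.det_fin_one])
      (smoothAlg_ext fun z => by
        have h2 := hJ z z.2 0 0
        simp only [Finset.univ_unique, Finset.sum_singleton, Fin.default_eq_zero, if_true] at h2
        have h3 := sign_mul_self hU 0
        simp only [map_mul, map_one, ← hv z z.2, ← hR z z.2]
        norm_cast
        rw [show ∀ p q : ℝ, p * q * (p * q) = p ^ 2 * (q * q) from fun p q => by ring,
          abs_mul_abs_self, Matrix.det_fin_one]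
        linear_combination U.sign 0 * h2 - (r z ^ 2 * (jac a b z 0 0 * jac a b z 0 0) - 1) * h3)
      (smoothAlg_ext fun z => by
        have h2 := congrArg (fun t : ℝ => (t : 𝕜)) (hrr z 0 0)
        have h3 := sign_mul_self hU 0
        simp only [Finset.univ_unique, Finset.sum_singleton, Fin.default_eq_zero, if_true] at h2
        simp only [map_mul, map_ofNat, ← hR z z.2, ← hR.pd _ z z.2, ← (hR.pd _).pd _ z z.2,
          pd_pd_ofReal hr, pd_ofReal (hr.differentiable (by simp) z)]
        norm_cast
        norm_cast at h2
        linear_combination h2 + pd 0 r z ^ 2 * h3) i j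
    have h4 := congrArg (ev ⟨y, hys⟩) h1
    rw [← rep_schwarz1 hx2 hxx2 i j y hys] at h4
    have h5 : ∀ p q, schwarz1 (volume 𝕜 g b) p q (trans a b y) = _ := fun p q =>
      rep_schwarz1 hx hxx p q _ (h y hys).2
    simp only [schwOneX, h4, h5, map_sum, map_mul, Finset.mul_sum]
    refine Finset.sum_congr rfl fun p _ => Finset.sum_congr rfl fun q _ => ?_
    rw [hT, mul_left_comm]
    rfl

end DimensionOne

/-! ### Existence, uniqueness and conformal invariance of the map -/

section Quantization

variable {𝕜 : Type*} [RCLike 𝕜] {n : ℕ} {M : Type*} [TopologicalSpace M] [ChartedSpace (E n) M]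
  [IsManifold (𝓡 n) ∞ M] {c d : Chart n M} {s t : TopologicalSpace.Opens (E n)} {g g' : Metric n M}
  {U : ModelAtlas n M} {l m b1 b2 b3 b4 : 𝕜} {X : Chart n M → E n → Fin n → Fin n → 𝕜}

/-- Prescribed components in the charts of `𝒜` determine each output density, hence the map. The
family `𝒜` consists of all charts when `n ≥ 3` and of the identifications when `n ≤ 2`. -/
lemma existsUnique_quantization {𝒜 : Set (Chart n M)} (hA : ∀ x : M, ∃ a ∈ 𝒜, x ∈ a.1.source)
    (hX : IsTensorOn Set.univ X)
    (h1 : IsQuantization U g (opMap l m b1 b2 b3 b4 g hX))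
    (h2 : ∀ Q : Symbol n M (m - l) →ₗ[𝕜] DiffOp n M l m 2, IsQuantization U g Q → ∀ P φ, ∀ a ∈ 𝒜,
      ∀ y ∈ a.1.target, ((Q P).1 φ).1 a y = totalIn l m b1 b2 b3 b4 g X P φ a y) :
    ∃! Q : Symbol n M (m - l) →ₗ[𝕜] DiffOp n M l m 2, IsQuantization U g Q :=
  ⟨_, h1, fun Q hQ => LinearMap.ext fun P => Subtype.ext <| LinearMap.ext fun φ =>
    density_ext hA fun a ha y hy => (h2 Q hQ P φ a ha y hy).trans (opMap_apply g hX P φ hy).symm⟩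

lemma totalIn_curvX (g : Metric n M) (P : Symbol n M (m - l)) (φ : Density n M l) (c : Chart n M)
    (y : E n) : totalIn l m (beta1 n l m) (beta2 n l m) (beta3 n l m) (beta4 n l m) g
      (fun c => curvX l m (toField (g.coeff c))) P φ c y =
      quant2 (toField (g.coeff c)) l m (P.1.1 c) (φ.1 c) y
        + curvTerm (toField (g.coeff c)) l m (P.1.1 c) y * φ.1 c y
        + quant1 (toField (g.coeff c)) l m (P.2.1.1 c) (P.2.2.1 c) (φ.1 c) y := by
  rw [curvTerm_eq_sum]
  rfl

lemma existsUnique_of_three_le (hn : 3 ≤ n) (U : ModelAtlas n M) (g : Metric n M) (l m : 𝕜) :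
    ∃! Q : Symbol n M (m - l) →ₗ[𝕜] DiffOp n M l m 2, IsQuantization U g Q := by
  refine existsUnique_quantization (b1 := beta1 n l m) (b2 := beta2 n l m) (b3 := beta3 n l m)
    (b4 := beta4 n l m) covering_univ (isTensorOn_curvX l m g) (fun P φ =>
    ⟨fun _ c y hy => ?_, fun h => absurd h (by omega), fun h => absurd h (by omega)⟩)
    fun Q hQ P φ c _ y hy => ?_
  · rw [opMap_apply _ _ _ _ hy, totalIn_curvX]
  · rw [(hQ P φ).1 hn c y hy, totalIn_curvX]

lemma existsUnique_of_eq_two (hn : n = 2) (hU : U.Uniformizes g) (l m : 𝕜) :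
    ∃! Q : Symbol n M (m - l) →ₗ[𝕜] DiffOp n M l m 2, IsQuantization U g Q := by
  obtain ⟨X, hX, hXa⟩ := (isTensorOn_schwX hU (by omega) l m).extend hU.cover
  have key : ∀ (P : Symbol n M (m - l)) (φ : Density n M l) (c : Chart n M), ∀ a ∈ U.charts,
      ∀ y ∈ overlap c a, totalIn l m (beta1 n l m) (beta2 n l m) (beta3 n l m) (beta4 n l m) g
        X P φ c y = quant2 (toField (g.coeff c)) l m (P.1.1 c) (φ.1 c) y
        + schwarzTerm (toField (g.coeff c)) (toField (U.pullback a c)) l m (P.1.1 c) y * φ.1 c y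
        + quant1 (toField (g.coeff c)) l m (P.2.1.1 c) (P.2.2.1 c) (φ.1 c) y := by
    intro P φ c a ha y hy
    -- In an arbitrary chart the extension of the tensor is the Schwarzian expression computed
    -- there, since both are the pullback from the identification `a`.
    have e : X c y = schwX l m (toField (g.coeff c)) (toField (U.pullback a c)) y := by
      funext i j
      rw [hXa c a ha y hy, schwX_trans hU (by omega) l m ha hy]
    rw [schwarzTerm_eq_sum, ← e]
    rfl
  refine existsUnique_quantization (b1 := beta1 n l m) (b2 := beta2 n l m) (b3 := beta3 n l m)
    (b4 := beta4 n l m) hU.cover hX (fun P φ =>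
    ⟨fun h => absurd h (by omega), fun _ c a ha y hy => ?_, fun h => absurd h (by omega)⟩)
    fun Q hQ P φ a ha y hy => ?_
  · rw [opMap_apply _ _ _ _ hy.1]
    exact key P φ c a ha y hy
  · rw [(hQ P φ).2.1 hn a a ha y (overlap_self hy), key P φ a a ha y (overlap_self hy)]

lemma MetricPair.h_eq_of_scale {R : Type*} [CommRing R] {a b : MetricPair n R} {x x' : R}
    (hx : x * x' = 1) (h : ∀ i j, b.g i j = x * a.g i j) (i j : Fin n) :
    b.h i j = x' * a.h i j := by
  have h1 : Matrix.of b.g * Matrix.of b.h = 1 := by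
    ext1 p q
    simpa [Matrix.mul_apply, Matrix.one_apply] using b.g_mul_h p q
  have h2 : Matrix.of (a.scale hx).h * Matrix.of b.g = 1 := by
    ext1 p q
    have h3 : ∀ p q, b.g p q = (a.scale hx).g p q := h
    simpa [Matrix.mul_apply, Matrix.one_apply, h3] using (a.scale hx).h_mul_g p q
  exact congrArg (fun A : Matrix (Fin n) (Fin n) R => A i j) (left_inv_eq_right_inv h2 h1).symm

/-- The conformal factor of two metrics in a chart. -/
lemma exists_conf {F : M → ℝ} (hF : ContMDiff (𝓡 n) 𝓘(ℝ, ℝ) ∞ F) (h0 : ∀ x, 0 < F x)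
    (hg : ∀ c, ∀ y ∈ c.1.target, g'.coeff c y = F (c.1.symm y) • g.coeff c y)
    (h : ∀ y ∈ s, y ∈ c.1.target) : ∃ x x' : smoothAlg 𝕜 s,
      Rep (fun y => (F (c.1.symm y) : 𝕜)) x ∧ x * x' = 1 ∧
      (∀ i j, (g'.on 𝕜 h).g i j = x * (g.on 𝕜 h).g i j) ∧
      ∀ i j, (g'.on 𝕜 h).h i j = x' * (g.on 𝕜 h).h i j := by
  have hs : ContDiffOn ℝ ∞ (fun y => (F (c.1.symm y) : 𝕜)) s :=
    contDiffOn_ofReal ((hF.comp_contMDiffOn (contMDiffOn_symm_of_mem_maximalAtlas c.2)).contDiffOn.mono h)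
  obtain ⟨x', hx'⟩ := exists_inverse (f := restr _ hs) fun y =>
    RCLike.ofReal_ne_zero.2 (h0 (c.1.symm y)).ne'
  have e : ∀ i j, (g'.on 𝕜 h).g i j = restr _ hs * (g.on 𝕜 h).g i j := fun i j =>
    smoothAlg_ext fun y => by
      have := congrArg (fun A => ((A i j : ℝ) : 𝕜)) (hg c y (h y y.2))
      simp only [Matrix.smul_apply, smul_eq_mul, RCLike.ofReal_mul] at this
      rw [map_mul]
      exact this
  exact ⟨_, x', rep_restr hs, hx', e, MetricPair.h_eq_of_scale hx' e⟩

lemma rep_symOn2 {w : 𝕜} (P : Symbol2 n M w) (h : ∀ y ∈ s, y ∈ c.1.target) (i j : Fin n) :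
    Rep (fun y => P.1 c y i j) (symOn2 P h i j) := rep_restr _

lemma rep_symOn1 {w : 𝕜} (P : Symbol1 n M w) (h : ∀ y ∈ s, y ∈ c.1.target) (i : Fin n) :
    Rep (fun y => P.1 c y i) (symOn1 P h i) := rep_restr _

lemma rep_denOn {w : 𝕜} (φ : Density n M w) (h : ∀ y ∈ s, y ∈ c.1.target) :
    Rep (φ.1 c) (denOn φ h) := rep_restr _

lemma quant1_conformal (hres : NonResonant n (m - l)) (hc : Conformal g g')
    (P : Symbol n M (m - l)) (φ : Density n M l) {y : E n} (hy : y ∈ c.1.target) :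
    quant1 (toField (g'.coeff c)) l m (P.2.1.1 c) (P.2.2.1 c) (φ.1 c) y =
      quant1 (toField (g.coeff c)) l m (P.2.1.1 c) (P.2.2.1 c) (φ.1 c) y := by
  obtain ⟨F, hF, h0, hg⟩ := hc
  have h : ∀ y ∈ tgt c, y ∈ c.1.target := fun _ h => h
  obtain ⟨x, x', -, hxx, e1, e2⟩ := exists_conf (𝕜 := 𝕜) hF h0 hg h
  rw [Rep.quant1 (g.rep_on h) (rep_symOn1 P.2.1 h) (rep_denOn P.2.2 h) (rep_denOn φ h) y hy,
    Rep.quant1 (g'.rep_on h) (rep_symOn1 P.2.1 h) (rep_denOn P.2.2 h) (rep_denOn φ h) y hy,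
    quant1_conf hres.2.2.1 hxx e1 e2]

lemma conformal_of_three_le (hn : 3 ≤ n) (hres : NonResonant n (m - l)) (hc : Conformal g g')
    (P : Symbol n M (m - l)) (φ : Density n M l) {y : E n} (hy : y ∈ c.1.target) :
    quant2 (toField (g'.coeff c)) l m (P.1.1 c) (φ.1 c) y
        + curvTerm (toField (g'.coeff c)) l m (P.1.1 c) y * φ.1 c y =
      quant2 (toField (g.coeff c)) l m (P.1.1 c) (φ.1 c) y
        + curvTerm (toField (g.coeff c)) l m (P.1.1 c) y * φ.1 c y := by
  obtain ⟨F, hF, h0, hg⟩ := hc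
  have h : ∀ y ∈ tgt c, y ∈ c.1.target := fun _ h => h
  obtain ⟨x, x', -, hxx, e1, e2⟩ := exists_conf (𝕜 := 𝕜) hF h0 hg h
  have hP := symOn2_symm P.1 h
  have e := congrArg (ev ⟨y, hy⟩) (conf_three hn der_comm hres hxx e1 e2 hP (denOn φ h))
  simp only [map_add, map_mul] at e
  rw [Rep.quant2 (g.rep_on h) (rep_symOn2 P.1 h) hP (rep_denOn φ h) y hy,
    Rep.quant2 (g'.rep_on h) (rep_symOn2 P.1 h) hP (rep_denOn φ h) y hy,
    Rep.curvTerm (g.rep_on h) (rep_symOn2 P.1 h) y hy,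
    Rep.curvTerm (g'.rep_on h) (rep_symOn2 P.1 h) y hy, rep_denOn φ h y hy]
  exact e

lemma conformal_of_eq_two (hn : n = 2) (hU : U.Uniformizes g) (hres : NonResonant n (m - l))
    (hc : Conformal g g') (P : Symbol n M (m - l)) (φ : Density n M l) {a : Chart n M}
    (ha : a ∈ U.charts) {y : E n} (hy : y ∈ overlap c a) :
    quant2 (toField (g'.coeff c)) l m (P.1.1 c) (φ.1 c) y
        + schwarzTerm (toField (g'.coeff c)) (toField (U.pullback a c)) l m (P.1.1 c) y * φ.1 c y =
      quant2 (toField (g.coeff c)) l m (P.1.1 c) (φ.1 c) y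
        + schwarzTerm (toField (g.coeff c)) (toField (U.pullback a c)) l m (P.1.1 c) y * φ.1 c y := by
  obtain ⟨F, hF, h0, hg⟩ := hc
  have h : ∀ y ∈ ovl c a, y ∈ c.1.target := fun _ h => h.1
  have hn0 : n ≠ 0 := by omega
  obtain ⟨x, x', hx, hxx, e1, e2⟩ := exists_conf (𝕜 := 𝕜) hF h0 hg h
  obtain ⟨z, z', hz, hzz⟩ := exists_confFactor_unit (𝕜 := 𝕜) (s := tgt a) hU hn0 ha fun _ h => h
  have hw : Rep (confFactor (toField (g.coeff c)) (toField (U.pullback a c)))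
      (pullHom 𝕜 (ovl_to c a) z) := (hz.pull (ovl_to c a)).congr fun y hy => by
    obtain ⟨τ, -, h1, h2⟩ := exists_confFactor (𝕜 := 𝕜) hU hn0 ha (c := c) hy
    rw [h1, h2]
  obtain ⟨w, hwe⟩ : ∃ w, w = pullHom 𝕜 (ovl_to c a) z := ⟨_, rfl⟩
  obtain ⟨w', hwe'⟩ : ∃ w', w' = pullHom 𝕜 (ovl_to c a) z' := ⟨_, rfl⟩
  have hww : w * w' = 1 := by rw [hwe, hwe', ← map_mul, hzz, map_one]
  rw [← hwe] at hw
  -- Relative to `g' = F g` the model metric has the old factor divided by `F`, the shape `H * F'`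
  -- required by `conf_two`.
  have hw2 : Rep (confFactor (toField (g'.coeff c)) (toField (U.pullback a c))) (w * x') := by
    intro y hy
    obtain ⟨τ, -, h1, h2⟩ := exists_pullback_eq hU ha (c := c) hy
    have h3 : U.pullback a c y = (τ * (F (c.1.symm y))⁻¹) • g'.coeff c y := by
      rw [hg c y hy.1, smul_smul, inv_mul_cancel_right₀ (h0 _).ne', h1]
    have h4 : (F (c.1.symm y) : 𝕜) * ev ⟨y, hy⟩ x' = 1 := by
      have h5 : (F (c.1.symm y) : 𝕜) = ev ⟨y, hy⟩ x := hx y hy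
      rw [h5, ← map_mul, hxx, map_one]
    rw [confFactor_of_smul hn0 (toField_symm g' hy.1) (toField_det_ne_zero g' hy.1) (toField_smul h3),
      map_mul, ← hw y hy, eq_inv_of_mul_eq_one_right h4,
      confFactor_of_smul hn0 (toField_symm g hy.1) (toField_det_ne_zero g hy.1) (toField_smul h1)]
    push_cast
    rfl
  have hww2 : w * x' * (w' * x) = 1 := by linear_combination w * w' * hxx + hww
  have hP := symOn2_symm P.1 h
  have e := congrArg (ev ⟨y, hy⟩) (conf_two hn der_comm hres hxx e1 e2 hP (denOn φ h) hww)
  simp only [map_add, map_mul] at e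
  rw [Rep.quant2 (g.rep_on h) (rep_symOn2 P.1 h) hP (rep_denOn φ h) y hy,
    Rep.quant2 (g'.rep_on h) (rep_symOn2 P.1 h) hP (rep_denOn φ h) y hy,
    Rep.schwarzTerm (g.rep_on h) hw hww (rep_symOn2 P.1 h) y hy,
    Rep.schwarzTerm (g'.rep_on h) hw2 hww2 (rep_symOn2 P.1 h) y hy, rep_denOn φ h y hy]
  exact e

end Quantization

/-! ### Dimension one: existence and conformal invariance -/

section DimensionOne

variable {𝕜 : Type*} [RCLike 𝕜] {M : Type*} [TopologicalSpace M] [ChartedSpace (E 1) M]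
  [IsManifold (𝓡 1) ∞ M] {g g' : Metric 1 M} {U : ModelAtlas 1 M} {l m : 𝕜} {c : Chart 1 M}

lemma quantOne_eq (G : E 1 → Matrix (Fin 1) (Fin 1) 𝕜) (u φ : E 1 → 𝕜) (P : E 1 → Fin 1 → Fin 1 → 𝕜)
    (y : E 1) : quantOne G u l m P φ y =
      quantGen G l m ((2 * l + 1) / (2 - (m - l))) 0
        (l * (2 * l + 1) / ((3 - 2 * (m - l)) * (2 - (m - l)))) 0 P φ y
      + (∑ i, ∑ j, schwOneX l m u y i j * P y i j) * φ y := by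
  simp only [quantOne, quantGen, schwOneX, Finset.univ_unique, Finset.sum_singleton]
  ring

lemma existsUnique_of_eq_one (hU : U.Uniformizes g) (l m : 𝕜) :
    ∃! Q : Symbol 1 M (m - l) →ₗ[𝕜] DiffOp 1 M l m 2, IsQuantization U g Q := by
  have hX1 := isTensorOn_schwOneX hU l m
  obtain ⟨X, hX, hXa⟩ := hX1.extend hU.cover
  have key : ∀ (P : Symbol 1 M (m - l)) (φ : Density 1 M l), ∀ a ∈ U.charts,
      ∀ y ∈ a.1.target, totalIn l m ((2 * l + 1) / (2 - (m - l))) 0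
        (l * (2 * l + 1) / ((3 - 2 * (m - l)) * (2 - (m - l)))) 0 g X P φ a y =
        quantOne (toField (g.coeff a)) (volume 𝕜 g a) l m (P.1.1 a) (φ.1 a) y
        + quant1 (toField (g.coeff a)) l m (P.2.1.1 a) (P.2.2.1 a) (φ.1 a) y := by
    intro P φ a ha y hy
    have e : X a y = schwOneX l m (volume 𝕜 g a) y := by
      funext i j
      rw [hXa a a ha y (overlap_self hy), ← hX1.cov a ha a ha y (overlap_self hy)]
    rw [quantOne_eq, ← e]
    rfl
  refine existsUnique_quantization (b1 := (2 * l + 1) / (2 - (m - l))) (b2 := 0)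
    (b3 := l * (2 * l + 1) / ((3 - 2 * (m - l)) * (2 - (m - l)))) (b4 := 0) hU.cover hX (fun P φ =>
    ⟨fun h => absurd h (by omega), fun h => absurd h (by omega), fun _ a ha y hy => ?_⟩)
    fun Q hQ P φ a ha y hy => ?_
  · rw [opMap_apply _ _ _ _ hy]
    exact key P φ a ha y hy
  · rw [key P φ a ha y hy]
    exact (hQ P φ).2.2 rfl a ha y hy

lemma conformal_of_eq_one (hres : NonResonant 1 (m - l))
    (hc : Conformal g g') (P : Symbol 1 M (m - l)) (φ : Density 1 M l)
    {y : E 1} (hy : y ∈ c.1.target) :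
    quantOne (toField (g'.coeff c)) (volume 𝕜 g' c) l m (P.1.1 c) (φ.1 c) y =
      quantOne (toField (g.coeff c)) (volume 𝕜 g c) l m (P.1.1 c) (φ.1 c) y := by
  obtain ⟨F, hF, h0, hg⟩ := hc
  have h : ∀ y ∈ tgt c, y ∈ c.1.target := fun _ h => h
  obtain ⟨u, u', hu, huu⟩ := exists_volume_unit 𝕜 g h
  obtain ⟨x, x', hx, hxx, e1, -⟩ := exists_conf (𝕜 := 𝕜) hF h0 hg h
  -- On a curve the volume function, which plays the role of `φ'`, is multiplied by `√F`, so
  -- `conf_one` is applied with `s = √F`.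
  have hs : ContDiffOn ℝ ∞ (fun y => ((√(F (c.1.symm y)) : ℝ) : 𝕜)) (tgt c) :=
    contDiffOn_ofReal ((hF.comp_contMDiffOn
      (contMDiffOn_symm_of_mem_maximalAtlas c.2)).contDiffOn.sqrt fun y _ => (h0 _).ne')
  obtain ⟨r, hr⟩ : ∃ r, r = restr (𝕜 := 𝕜) (s := tgt c) _ hs := ⟨_, rfl⟩
  have hrep := rep_restr hs
  rw [← hr] at hrep
  obtain ⟨r', hrr⟩ := exists_inverse (f := r) fun y => by
    rw [← hrep y y.2]
    exact RCLike.ofReal_ne_zero.2 (Real.sqrt_ne_zero'.2 (h0 _))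
  have hrx : x = r ^ 2 := smoothAlg_ext fun y => by
    rw [map_pow, ← hx y y.2, ← hrep y y.2, ← RCLike.ofReal_pow, Real.sq_sqrt (h0 _).le]
  rw [hrx] at e1
  have hrr2 : r ^ 2 * r' ^ 2 = 1 := by rw [← mul_pow, hrr, one_pow]
  have e2 := MetricPair.h_eq_of_scale hrr2 e1
  have hu2 : Rep (volume 𝕜 g' c) (r * u) := (hrep.mul hu).congr fun y hy => by
    rw [volume, volume, hg c y hy, Matrix.det_smul, Fintype.card_fin, pow_one, abs_mul,
      abs_of_pos (h0 _), Real.sqrt_mul (h0 _).le, RCLike.ofReal_mul]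
  -- `σ` is the sign of the metric. Only `σ² = 1` is needed: differentiating it shows that `σ` is
  -- locally constant, also when the chart is not connected.
  obtain ⟨σ, hσ⟩ : ∃ σ, σ = (g.on 𝕜 h).g 0 0 * u' ^ 2 := ⟨_, rfl⟩
  have hgu : (g.on 𝕜 h).g 0 0 * (g.on 𝕜 h).g 0 0 = u ^ 4 := smoothAlg_ext fun y => by
    rw [map_mul, map_pow, ← hu y y.2]
    change ((g.coeff c y 0 0 : ℝ) : 𝕜) * ((g.coeff c y 0 0 : ℝ) : 𝕜) = _
    rw [volume, ← RCLike.ofReal_mul, ← RCLike.ofReal_pow, Matrix.det_fin_one,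
      show ∀ p : ℝ, p ^ 4 = (p ^ 2) ^ 2 from fun p => by ring, Real.sq_sqrt (abs_nonneg _), sq_abs,
      pow_two]
  have hσ2 : σ * σ = 1 := by
    rw [hσ]
    linear_combination u' ^ 4 * hgu + (u * u' + 1) * (u ^ 2 * u' ^ 2 + 1) * huu
  have hσ3 : ∀ i, der 𝕜 _ i σ = 0 := fun i => by
    have h1 := congrArg (der 𝕜 _ i) hσ2
    rw [(der 𝕜 _ i).leibniz, Derivation.map_one_eq_zero, smul_eq_mul] at h1
    have h2 : algebraMap 𝕜 (smoothAlg 𝕜 (tgt c)) (1 / 2) * 2 = 1 := by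
      rw [← map_ofNat (algebraMap 𝕜 (smoothAlg 𝕜 (tgt c))) 2, ← map_mul]; norm_num
    linear_combination algebraMap 𝕜 (smoothAlg 𝕜 (tgt c)) (1 / 2) * σ * h1
      - der 𝕜 _ i σ * hσ2 - σ * σ * der 𝕜 _ i σ * h2
  have hag : ∀ i j, (g.on 𝕜 h).g i j = σ * u ^ 2 := fun i j => by
    rw [Subsingleton.elim i 0, Subsingleton.elim j 0, hσ]
    linear_combination (-(g.on 𝕜 h).g 0 0) * (u * u' + 1) * huu
  have e := congrArg (ev ⟨y, hy⟩) (conf_one hres hσ3 huu hrr hag e1 e2 (symOn2 P.1 h) (denOn φ h))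
  have hru : r * u * (r' * u') = 1 := by linear_combination r * r' * huu + hrr
  rw [Rep.quantOne (g.rep_on h) hu huu (rep_symOn2 P.1 h) (rep_denOn φ h) y hy,
    Rep.quantOne (g'.rep_on h) hu2 hru (rep_symOn2 P.1 h) (rep_denOn φ h) y hy]
  exact e

end DimensionOne

end ConfQuant

end

theorem theorem3p11 {𝕜 : Type*} [RCLike 𝕜] {n : ℕ} (hn : 1 ≤ n)
    {M : Type*} [TopologicalSpace M] [T2Space M] [SecondCountableTopology M]
    [ChartedSpace (ConfQuant.E n) M] [IsManifold (𝓡 n) ∞ M]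
    (l m : 𝕜) (hres : ConfQuant.NonResonant n (m - l))
    (g : ConfQuant.Metric n M)
    (U : ConfQuant.ModelAtlas n M) (hU : n ≤ 2 → U.Uniformizes g) :
    (∃! Q : ConfQuant.Symbol n M (m - l) →ₗ[𝕜] ConfQuant.DiffOp n M l m 2,
      ConfQuant.IsQuantization U g Q) ∧
    ∀ g' : ConfQuant.Metric n M, ConfQuant.Conformal g g' →
      ∀ Q : ConfQuant.Symbol n M (m - l) →ₗ[𝕜] ConfQuant.DiffOp n M l m 2,
        ConfQuant.IsQuantization U g' Q ↔ ConfQuant.IsQuantization U g Q := by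
  constructor
  · obtain h | h | h : n = 1 ∨ n = 2 ∨ 3 ≤ n := by omega
    · subst h
      exact ConfQuant.existsUnique_of_eq_one (hU (by norm_num)) l m
    · exact ConfQuant.existsUnique_of_eq_two h (hU (by omega)) l m
    · exact ConfQuant.existsUnique_of_three_le h U g l m
  -- The same `Q` is tested on both sides in the same charts, so it suffices that the prescribed
  -- values for `g'` and `g` agree at every point.
  · intro g' hc Q
    refine forall_congr' fun P => forall_congr' fun φ => and_congr ?_ (and_congr ?_ ?_)
    · refine forall_congr' fun h => forall_congr' fun c => forall_congr' fun y =>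
        forall_congr' fun hy => ?_
      rw [ConfQuant.conformal_of_three_le h hres hc P φ hy,
        ConfQuant.quant1_conformal hres hc P φ hy]
    · refine forall_congr' fun h => forall_congr' fun c => forall_congr' fun a =>
        forall_congr' fun ha => forall_congr' fun y => forall_congr' fun hy => ?_
      rw [ConfQuant.conformal_of_eq_two h (hU (by omega)) hres hc P φ ha hy,
        ConfQuant.quant1_conformal hres hc P φ hy.1]
    · refine forall_congr' fun h => forall_congr' fun a => forall_congr' fun ha =>
        forall_congr' fun y => forall_congr' fun hy => ?_
      subst h
      rw [ConfQuant.quant1_conformal hres hc P φ hy]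
      -- The square root in `IsQuantization` is `volume` only after unfolding, so the equality is
      -- supplied as a term.
      exact iff_of_eq (congrArg (fun z => _ = z + _)
        (ConfQuant.conformal_of_eq_one hres hc P φ hy))
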